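/- Consider the state-dependent memoryless multiple-access channel with strictly causal partial cribbing, with finite nonempty alphabets $\mathcal S_1,\mathcal S_2,\mathcal X_1,\mathcal X_2,\mathcal Y,\mathcal Z_1,\mathcal Z_2$, given by a state pmf $p_{S_1,S_2}(s_1,s_2)$ (the two components may be dependent), a channel law $p_{Y|X_1,X_2,S_1,S_2}(y|x_1,x_2,s_1,s_2)$ and functions $z_1:\mathcal X_1\times\mathcal S_1\to\mathcal Z_1$, $z_2:\mathcal X_2\times\mathcal S_2\to\mathcal Z_2$. The state pairs $(S_{1i},S_{2i})$ are i.i.d. with pmf $p_{S_1,S_2}$, independent of the messages, and $Z_{1i}=z_1(X_{1i},S_{1i})$, $Z_{2i}=z_2(X_{2i},S_{2i})$. For rates $R_1,R_2\ge 0$, an $(n,2^{nR_1},2^{nR_2},\epsilon)$ code consists of encoders $$x_{1,i}:[1:2^{nR_1}]\times\mathcal S_1^i\times\mathcal Z_2^{i-1}\to\mathcal X_1,\qquad x_{2,i}:[1:2^{nR_2}]\times\mathcal S_2^i\times\mathcal Z_1^{i-1}\to\mathcal X_2,\qquad 1\le i\le n,$$ and decoders $\hat m_j:\mathcal Y^n\times\mathcal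 S_1^n\times\mathcal S_2^n\to[1:2^{nR_j}]$, $j=1,2$, such that, for independent messages $M_j$ uniform on $[1:2^{nR_j}]=\{1,\dots,\lceil 2^{nR_j}\rceil\}$, $\Pr\{(\hat m_1,\hat m_2)\ne(M_1,M_2)\}\le\epsilon$. The pair $(R_1,R_2)$ is achievable if for every $\epsilon>0$ such a code exists for all sufficiently large $n$, and the capacity region is the closure of the set of achievable pairs. The capacity region equals the set of pairs $(R_1,R_2)$ with $R_1,R_2\ge0$ for which there exist a finite set $\mathcal U$ with $$|\mathcal U|\le\min\{|\mathcal S_1||\mathcal S_2|(|\mathcal Y|-1)+4,\ |\mathcal S_1||\mathcal S_2|(|\mathcal X_1||\mathcal X_2|-1)+3\}$$ and pmfs $p_U(u)$, $p_{X_1|U,S_1}(x_1|u,s_1)$, $p_{X_2|U,S_2}(x_2|u,s_2)$ such that $$\begin{aligned} R_1&\le I(X_1;Y|U,X_2,Z_1,S_1,S_2)+H(Z_1|U,S_1),\\ R_2&\le I(X_2;Y|U,X_1,Z_2,S_1,S_2)+H(Z_2|U,S_2),\\ R_1+R_2&\le I(X_1,X_2;Y|U,Z_1,Z_2,S_1,S_2)+H(Z_1,Z_2|U,S_1,S_2),\\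 R_1+R_2&\le I(X_1,X_2;Y|S_1,S_2), \end{aligned}$$ where $(U,S_1,S_2,X_1,X_2,Y)$ has the joint pmf $p_{S_1,S_2}(s_1,s_2)\,p_U(u)\,p_{X_1|U,S_1}(x_1|u,s_1)\,p_{X_2|U,S_2}(x_2|u,s_2)\,p_{Y|X_1,X_2,S_1,S_2}(y|x_1,x_2,s_1,s_2)$, $Z_1=z_1(X_1,S_1)$, $Z_2=z_2(X_2,S_2)$, and entropies and mutual informations are in bits (logarithms to base 2). -/

import Mathlib

open Filter Topology

noncomputable section

namespace CribMAC

/-! ### Information measures of finite-valued random variables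

A finite probability space is given by a finite type `Ω` and a pmf `p : Ω → ℝ`; random variables are
functions on `Ω`. All logarithms are to base 2. -/

section Information

variable {Ω α β γ : Type*} [Fintype Ω] [Fintype α] [Fintype β] [Fintype γ]

open Classical in
/-- The pmf of the random variable `A`: the probability of `A = a`. -/
def law (p : Ω → ℝ) (A : Ω → α) (a : α) : ℝ :=
  ∑ ω, if A ω = a then p ω else 0

/-- The conditional entropy `H(A | B) = - ∑_{a,b} p(a,b) log₂ p(a|b)`, in bits. Terms with
`p(a,b) = 0` contribute `0`. -/
def condEntropy (p : Ω → ℝ) (A : Ω → α) (B : Ω → β) : ℝ :=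
  -∑ a, ∑ b, law p (fun ω => (A ω, B ω)) (a, b) *
    Real.logb 2 (law p (fun ω => (A ω, B ω)) (a, b) / law p B b)

/-- The conditional mutual information `I(A ; B | C) = H(B | C) - H(B | A, C)`, in bits. -/
def condMutualInfo (p : Ω → ℝ) (A : Ω → α) (B : Ω → β) (C : Ω → γ) : ℝ :=
  condEntropy p B C - condEntropy p B (fun ω => (A ω, C ω))

end Information

/-! ### The channel -/

/-- A state-dependent memoryless multiple-access channel with partial cribbing, with finite
alphabets: the state pmf `p(s₁,s₂)`, the channel law `p(y|x₁,x₂,s₁,s₂)` and the two cribbing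
functions `z₁(x₁,s₁)` and `z₂(x₂,s₂)`. -/
structure Channel (S₁ S₂ X₁ X₂ Y Z₁ Z₂ : Type*) [Fintype S₁] [Fintype S₂] [Fintype Y] where
  pS : S₁ × S₂ → ℝ
  pS_mem : pS ∈ stdSimplex ℝ (S₁ × S₂)
  W : X₁ → X₂ → S₁ → S₂ → Y → ℝ
  W_mem : ∀ x₁ x₂ s₁ s₂, W x₁ x₂ s₁ s₂ ∈ stdSimplex ℝ Y
  z₁ : X₁ → S₁ → Z₁
  z₂ : X₂ → S₂ → Z₂

/-- A block code of length `n` with `M₁` and `M₂` messages. At time `i`, encoder 1 sees its message,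
its own states up to and including time `i`, and the cribbed signals `Z₂` strictly before time `i`;
encoder 2 symmetrically. The decoder sees the outputs and both state sequences. -/
structure Code (S₁ S₂ X₁ X₂ Y Z₁ Z₂ : Type*) (n M₁ M₂ : ℕ) where
  enc₁ : (i : Fin n) → Fin M₁ → (Set.Iic i → S₁) → (Set.Iio i → Z₂) → X₁
  enc₂ : (i : Fin n) → Fin M₂ → (Set.Iic i → S₂) → (Set.Iio i → Z₁) → X₂
  dec₁ : (Fin n → Y) → (Fin n → S₁) → (Fin n → S₂) → Fin M₁
  dec₂ : (Fin n → Y) → (Fin n → S₁) → (Fin n → S₂) → Fin M₂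

section Capacity

variable {S₁ S₂ X₁ X₂ Y Z₁ Z₂ : Type*} [Fintype S₁] [Fintype S₂] [Fintype Y]

/-- The pair of channel inputs at time `i` that the encoders produce, for given messages and
state sequences. -/
def inputs (ch : Channel S₁ S₂ X₁ X₂ Y Z₁ Z₂) {n M₁ M₂ : ℕ}
    (c : Code S₁ S₂ X₁ X₂ Y Z₁ Z₂ n M₁ M₂)
    (m₁ : Fin M₁) (m₂ : Fin M₂) (s₁ : Fin n → S₁) (s₂ : Fin n → S₂) (i : Fin n) : X₁ × X₂ :=
  (c.enc₁ i m₁ (fun j => s₁ j) (fun j => ch.z₂ (inputs ch c m₁ m₂ s₁ s₂ j).2 (s₂ j)),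
   c.enc₂ i m₂ (fun j => s₂ j) (fun j => ch.z₁ (inputs ch c m₁ m₂ s₁ s₂ j).1 (s₁ j)))
termination_by i
decreasing_by all_goals exact j.2

/-- The probability that the decoded message pair differs from the transmitted one, when the
messages are independent and uniform, the state pairs are i.i.d. (and independent of the messages),
and the channel is memoryless. -/
def errorProb (ch : Channel S₁ S₂ X₁ X₂ Y Z₁ Z₂) {n M₁ M₂ : ℕ}
    (c : Code S₁ S₂ X₁ X₂ Y Z₁ Z₂ n M₁ M₂) : ℝ :=
  ∑ m₁ : Fin M₁, ∑ m₂ : Fin M₂, ∑ s₁ : Fin n → S₁, ∑ s₂ : Fin n → S₂, ∑ y : Fin n → Y,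
    (1 / (M₁ : ℝ)) * (1 / (M₂ : ℝ)) * (∏ i, ch.pS (s₁ i, s₂ i)) *
      (∏ i, ch.W (inputs ch c m₁ m₂ s₁ s₂ i).1 (inputs ch c m₁ m₂ s₁ s₂ i).2
        (s₁ i) (s₂ i) (y i)) *
      (if (c.dec₁ y s₁ s₂, c.dec₂ y s₁ s₂) ≠ (m₁, m₂) then 1 else 0)

/-- A pair of nonnegative rates is achievable if for every `ε > 0`, for all sufficiently large `n`,
there is a code of length `n` with `⌈2^{nR₁}⌉` and `⌈2^{nR₂}⌉` messages and error probability at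
most `ε`. -/
def Achievable (ch : Channel S₁ S₂ X₁ X₂ Y Z₁ Z₂) (R : ℝ × ℝ) : Prop :=
  0 ≤ R.1 ∧ 0 ≤ R.2 ∧ ∀ ε : ℝ, 0 < ε → ∀ᶠ n : ℕ in atTop,
    ∃ c : Code S₁ S₂ X₁ X₂ Y Z₁ Z₂ n ⌈(2 : ℝ) ^ ((n : ℝ) * R.1)⌉₊ ⌈(2 : ℝ) ^ ((n : ℝ) * R.2)⌉₊,
      errorProb ch c ≤ ε

/-- The capacity region: the closure of the set of achievable rate pairs. -/
def capacityRegion (ch : Channel S₁ S₂ X₁ X₂ Y Z₁ Z₂) : Set (ℝ × ℝ) :=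
  closure {R | Achievable ch R}

end Capacity

/-! ### The single-letter region -/

section SingleLetter

variable {S₁ S₂ X₁ X₂ Y Z₁ Z₂ U : Type*} [Fintype S₁] [Fintype S₂] [Fintype X₁] [Fintype X₂]
  [Fintype Y] [Fintype Z₁] [Fintype Z₂] [Fintype U]

/-- The joint pmf
`p(u,s₁,s₂,x₁,x₂,y) = p(s₁,s₂) p(u) p(x₁|u,s₁) p(x₂|u,s₂) p(y|x₁,x₂,s₁,s₂)`. -/
def jointPMF (ch : Channel S₁ S₂ X₁ X₂ Y Z₁ Z₂) (pU : U → ℝ) (pX₁ : U → S₁ → X₁ → ℝ)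
    (pX₂ : U → S₂ → X₂ → ℝ) : U × S₁ × S₂ × X₁ × X₂ × Y → ℝ :=
  fun (u, s₁, s₂, x₁, x₂, y) =>
    ch.pS (s₁, s₂) * pU u * pX₁ u s₁ x₁ * pX₂ u s₂ x₂ * ch.W x₁ x₂ s₁ s₂ y

/-- The rate inequalities for a pair `(R₁, R₂)`:
* `R₁ ≤ I(X₁;Y|U,X₂,Z₁,S₁,S₂) + H(Z₁|U,S₁)`,
* `R₂ ≤ I(X₂;Y|U,X₁,Z₂,S₁,S₂) + H(Z₂|U,S₂)`,
* `R₁ + R₂ ≤ I(X₁,X₂;Y|U,Z₁,Z₂,S₁,S₂) + H(Z₁,Z₂|U,S₁,S₂)`,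
* `R₁ + R₂ ≤ I(X₁,X₂;Y|S₁,S₂)`,

under the joint pmf above, with `Z₁ = z₁(X₁,S₁)` and `Z₂ = z₂(X₂,S₂)`. -/
def RateBounds (ch : Channel S₁ S₂ X₁ X₂ Y Z₁ Z₂) (pU : U → ℝ) (pX₁ : U → S₁ → X₁ → ℝ)
    (pX₂ : U → S₂ → X₂ → ℝ) (R₁ R₂ : ℝ) : Prop :=
  let p := jointPMF ch pU pX₁ pX₂
  let u : U × S₁ × S₂ × X₁ × X₂ × Y → U := fun (u, _, _, _, _, _) => u
  let s₁ : U × S₁ × S₂ × X₁ × X₂ × Y → S₁ := fun (_, s₁, _, _, _, _) => s₁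
  let s₂ : U × S₁ × S₂ × X₁ × X₂ × Y → S₂ := fun (_, _, s₂, _, _, _) => s₂
  let x₁ : U × S₁ × S₂ × X₁ × X₂ × Y → X₁ := fun (_, _, _, x₁, _, _) => x₁
  let x₂ : U × S₁ × S₂ × X₁ × X₂ × Y → X₂ := fun (_, _, _, _, x₂, _) => x₂
  let y : U × S₁ × S₂ × X₁ × X₂ × Y → Y := fun (_, _, _, _, _, y) => y
  let z₁ : U × S₁ × S₂ × X₁ × X₂ × Y → Z₁ := fun ω => ch.z₁ (x₁ ω) (s₁ ω)
  let z₂ : U × S₁ × S₂ × X₁ × X₂ × Y → Z₂ := fun ω => ch.z₂ (x₂ ω) (s₂ ω)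
  R₁ ≤ condMutualInfo p x₁ y (fun ω => (u ω, x₂ ω, z₁ ω, s₁ ω, s₂ ω))
      + condEntropy p z₁ (fun ω => (u ω, s₁ ω)) ∧
  R₂ ≤ condMutualInfo p x₂ y (fun ω => (u ω, x₁ ω, z₂ ω, s₁ ω, s₂ ω))
      + condEntropy p z₂ (fun ω => (u ω, s₂ ω)) ∧
  R₁ + R₂ ≤ condMutualInfo p (fun ω => (x₁ ω, x₂ ω)) y
        (fun ω => (u ω, z₁ ω, z₂ ω, s₁ ω, s₂ ω))
      + condEntropy p (fun ω => (z₁ ω, z₂ ω)) (fun ω => (u ω, s₁ ω, s₂ ω)) ∧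
  R₁ + R₂ ≤ condMutualInfo p (fun ω => (x₁ ω, x₂ ω)) y (fun ω => (s₁ ω, s₂ ω))

end SingleLetter

end CribMAC

end

/-! Each of the first three bounds is a single information quantity. For encoder 1, p(y | u, x₂, z₁,
s₁, s₂) · p(z₁ | u, s₁) is the joint conditional law of crib and output when X₁ is random and X₂
known, so the mutual information plus the entropy is the expectation of log(W / that law). `cribDen`
is this law for any set `k` of random inputs, and `rateBounds_iff` turns the region into averages
over U of `cribInfo`, for the three nonempty kinds `k`, together with `outInfo`.

Converse. The auxiliary variable consists of a uniform time, the state sequences and the history of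
both cribbed signals. For given states and history, the message pairs that produce this history form
a rectangle (`pathCrib_eq_iff`). Uniform independent messages therefore stay independent, which
gives X₁ and X₂ the required product form given U (`sum_path_eq`). The role of Fano's inequality is
played by a change of measure (`sum_mul_logb_ge`): the true law is compared with a reference law
under which the flagged messages are hard to guess, and correct decoding is rewarded by the number
of messages. The relative entropy is a sum of single-letter densities (`mul_logb_sub_one_le`).

Achievability. A single block suffices. A code tree has one random node for each time and each
history of (Z₁, Z₂). Each encoder hears the other's crib and can compute its own, so both walk along
the same path and share the letter U. The path of a wrong message pair shares its nodes with the
true path until the cribbed signals first differ, at some time r, and visits independent nodes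
afterwards. Its likelihood is thus compared with `cribDen` before r and with `outLaw` after r. The
decoder demands a large likelihood ratio for every kind of error and every r. A wrong pair passes
with probability at most (n+1)/τ (`sum_wrong_le`), and the true pair fails with exponentially small
probability by a Chernoff bound (`treeMean_miss_le`, `eventually_sum_mul_rpow_le`). What is needed
is that the rate of kind `k` lies below both its `cribInfo` average and `outInfo`, which are the
four bounds.

The bound on the alphabet of U comes from a Carathéodory reduction (`exists_small_support`) that
keeps the relevant expectations and does not decrease one more. With a bounded alphabet the region
is closed by compactness, so the vanishing slack of the converse disappears. -/

namespace CribMAC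

/-! ### Product measures, change of measure, support reduction, exponential moments -/

section General

/-- Resampling one coordinate of a product distribution does not change expectations. -/
lemma sum_pi_resample {ι : Type*} [Fintype ι] [DecidableEq ι] {V : ι → Type*} [∀ i, Fintype (V i)]
    (w : ∀ i, V i → ℝ) (k : ι) (hk : ∑ g, w k g = 1) (F : (∀ i, V i) → ℝ) :
    ∑ v, (∏ i, w i (v i)) * F v =
      ∑ v, (∏ i, w i (v i)) * ∑ g, w k g * F (Function.update v k g) := by
  have hswap : ∀ (v : ∀ i, V i) (g : V k),
      (∏ i, w i (Function.update v k g i)) * w k (v k) = (∏ i, w i (v i)) * w k g := by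
    intro v g
    rw [← Finset.mul_prod_erase _ _ (Finset.mem_univ k),
      ← Finset.mul_prod_erase Finset.univ (fun i => w i (v i)) (Finset.mem_univ k)]
    have : ∏ i ∈ Finset.univ.erase k, w i (Function.update v k g i) =
        ∏ i ∈ Finset.univ.erase k, w i (v i) := by
      refine Finset.prod_congr rfl fun i hi => ?_
      rw [Function.update_of_ne (Finset.ne_of_mem_erase hi)]
    rw [this, Function.update_self]
    ring
  calc ∑ v, (∏ i, w i (v i)) * F v
      = ∑ x : (∀ i, V i) × V k, (∏ i, w i (x.1 i)) * w k x.2 * F x.1 := by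
        rw [Fintype.sum_prod_type]
        refine Finset.sum_congr rfl fun v _ => ?_
        simp only [mul_assoc, mul_comm (w k _)]
        simp only [← mul_assoc]
        rw [← Finset.mul_sum, hk, mul_one]
    _ = ∑ x : (∀ i, V i) × V k, (∏ i, w i (x.1 i)) * w k x.2 * F (Function.update x.1 k x.2) := by
        -- Exchanging the coordinate `v k` with its fresh copy is an involution, and it preserves
        -- the weight by `hswap`.
        refine Finset.sum_nbij' (fun x => (Function.update x.1 k x.2, x.1 k))
          (fun x => (Function.update x.1 k x.2, x.1 k)) ?_ ?_ ?_ ?_ ?_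
        · simp
        · simp
        · rintro ⟨v, g⟩ _; simp
        · rintro ⟨v, g⟩ _; simp
        · rintro ⟨v, g⟩ _; simp [hswap]
    _ = _ := by
        rw [Fintype.sum_prod_type]
        refine Finset.sum_congr rfl fun v _ => ?_
        rw [Finset.mul_sum]
        exact Finset.sum_congr rfl fun g _ => by ring

/-- A product distribution has total mass one. -/
lemma sum_pi_prod_eq_one {ι : Type*} [Fintype ι] [DecidableEq ι] {V : ι → Type*}
    [∀ i, Fintype (V i)] (w : ∀ i, V i → ℝ) (hw : ∀ i, ∑ g, w i g = 1) :
    ∑ v : ∀ i, V i, ∏ i, w i (v i) = 1 := by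
  rw [← Fintype.piFinset_univ, ← Finset.prod_univ_sum]
  simp [hw]

/-- Marginalising a product distribution onto one coordinate. -/
lemma sum_pi_marginal {ι : Type*} [Fintype ι] [DecidableEq ι] {V : ι → Type*}
    [∀ i, Fintype (V i)] (w : ∀ i, V i → ℝ) (hw : ∀ i, ∑ g, w i g = 1) (k : ι) (F : V k → ℝ) :
    ∑ v : ∀ i, V i, (∏ i, w i (v i)) * F (v k) = ∑ g, w k g * F g := by
  rw [sum_pi_resample w k (hw k) (fun v => F (v k))]
  simp only [Function.update_self]
  rw [← Finset.sum_mul, sum_pi_prod_eq_one w hw, one_mul]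

/-- Marginalising a product distribution onto two different coordinates. -/
lemma sum_pi_marginal₂ {ι : Type*} [Fintype ι] [DecidableEq ι] {V : ι → Type*}
    [∀ i, Fintype (V i)] (w : ∀ i, V i → ℝ) (hw : ∀ i, ∑ g, w i g = 1) {k l : ι} (hkl : k ≠ l)
    (F : V k → V l → ℝ) :
    ∑ v : ∀ i, V i, (∏ i, w i (v i)) * F (v k) (v l) =
      ∑ g, w k g * ∑ g', w l g' * F g g' := by
  rw [sum_pi_resample w l (hw l) (fun v => F (v k) (v l))]
  simp only [Function.update_self, Function.update_of_ne hkl]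
  exact sum_pi_marginal w hw k (fun g => ∑ g', w l g' * F g g')

/-- The expectation of a product of nonnegative adapted factors is at most the product of uniform
bounds on their conditional expectations given the past. -/
lemma sum_prod_adapted_le {n : ℕ} {V : Fin n → Type*} [∀ i, Fintype (V i)]
    (w : ∀ i, V i → ℝ) (hw0 : ∀ i g, 0 ≤ w i g) (hw : ∀ i, ∑ g, w i g = 1)
    (A : Fin n → (∀ i, V i) → ℝ) (hA0 : ∀ k v, 0 ≤ A k v)
    (hA : ∀ j k, j < k → ∀ v g, A j (Function.update v k g) = A j v)
    (κ : Fin n → ℝ) (hκ : ∀ k, 0 ≤ κ k)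
    (h : ∀ k v, (∀ j < k, A j v ≠ 0) → ∑ g, w k g * A k (Function.update v k g) ≤ κ k) :
    ∑ v, (∏ i, w i (v i)) * ∏ k, A k v ≤ ∏ k, κ k := by
  have key : ∀ m : ℕ, m ≤ n →
      ∑ v, (∏ i, w i (v i)) * ∏ k with k.val < m, A k v ≤ ∏ k : Fin n with k.val < m, κ k := by
    intro m
    induction m with
    | zero =>
      intro _
      simp [sum_pi_prod_eq_one w hw]
    | succ m ih =>
      intro hm
      set k : Fin n := ⟨m, hm⟩ with hkdef
      have hset : (Finset.univ.filter fun j : Fin n => j.val < m + 1) =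
          insert k (Finset.univ.filter fun j : Fin n => j.val < m) := by
        ext j
        simp [Fin.ext_iff, hkdef]
        omega
      have hnot : k ∉ (Finset.univ.filter fun j : Fin n => j.val < m) := by simp [hkdef]
      rw [hset, Finset.prod_insert hnot]
      have h1 : ∀ v, ∏ j ∈ insert k (Finset.univ.filter fun j : Fin n => j.val < m), A j v =
          A k v * ∏ j with j.val < m, A j v := fun v => Finset.prod_insert hnot
      simp only [h1]
      rw [sum_pi_resample w k (hw k)]
      have h2 : ∀ (v : ∀ i, V i) (g : V k), ∏ j with j.val < m, A j (Function.update v k g) =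
          ∏ j with j.val < m, A j v := by
        intro v g
        refine Finset.prod_congr rfl fun j hj => hA j k ?_ v g
        simpa [Fin.lt_def, hkdef] using hj
      simp only [h2]
      calc ∑ v, (∏ i, w i (v i)) *
              ∑ g, w k g * (A k (Function.update v k g) * ∏ j with j.val < m, A j v)
          ≤ ∑ v, κ k * ((∏ i, w i (v i)) * ∏ j with j.val < m, A j v) := by
            refine Finset.sum_le_sum fun v _ => ?_
            have hP : 0 ≤ ∏ i, w i (v i) := Finset.prod_nonneg fun i _ => hw0 i _
            have hQ : 0 ≤ ∏ j with j.val < m, A j v := Finset.prod_nonneg fun i _ => hA0 i _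
            simp only [← mul_assoc]
            rw [← Finset.sum_mul]
            -- The bound on the conditional expectation is assumed only for pasts on which no
            -- earlier factor vanishes; on the other pasts both sides are zero. Factors containing
            -- indicators can thus encode conditioning on an event of the past.
            by_cases hz : ∏ j with j.val < m, A j v = 0
            · simp [hz]
            · have hb := h k v (fun j hj => by
                exact Finset.prod_ne_zero_iff.1 hz j (by simpa [Fin.lt_def, hkdef] using hj))
              rw [← mul_assoc]
              refine mul_le_mul_of_nonneg_right ?_ hQ
              rw [mul_comm (κ k)]
              exact mul_le_mul_of_nonneg_left hb hP
        _ ≤ κ k * ∏ k : Fin n with k.val < m, κ k := by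
            rw [← Finset.mul_sum]
            exact mul_le_mul_of_nonneg_left (ih (by omega)) (hκ k)
  have := key n le_rfl
  simpa using this

/-- Unweighted form of `sum_prod_adapted_le` for conditional distributions. -/
lemma sum_prod_adapted_le_one {n : ℕ} {V : Type*} [Fintype V]
    (A : Fin n → (Fin n → V) → ℝ) (hA0 : ∀ k v, 0 ≤ A k v)
    (hA : ∀ j k, j < k → ∀ v g, A j (Function.update v k g) = A j v)
    (h : ∀ k v, ∑ g, A k (Function.update v k g) ≤ 1) :
    ∑ v, ∏ k, A k v ≤ 1 := by
  rcases isEmpty_or_nonempty V with hV | hV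
  · rcases n with _ | n
    · simp
    · simp
  -- A counting sum is an expectation under uniform coordinates once each factor is multiplied by
  -- the size of `V`.
  · have hc : (Fintype.card V : ℝ) ≠ 0 := by positivity
    have := sum_prod_adapted_le (V := fun _ : Fin n => V) (fun _ _ => (Fintype.card V : ℝ)⁻¹)
      (fun _ _ => by positivity) (fun _ => by simp [hc])
      (fun k v => (Fintype.card V : ℝ) * A k v) (fun k v => mul_nonneg (by positivity) (hA0 k v))
      (fun j k hjk v g => by rw [hA j k hjk]) (fun _ => 1) (fun _ => zero_le_one)
      (fun k v _ => by simpa [← mul_assoc, hc] using h k v)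
    simpa [Finset.prod_mul_distrib, ← mul_assoc, ← mul_pow, hc] using this

/-- The Donsker–Varadhan lower bound on relative entropy. -/
lemma sum_mul_logb_ge {Ω : Type*} [Fintype Ω] (P Q g : Ω → ℝ) (hP : ∀ ω, 0 ≤ P ω)
    (hP1 : ∑ ω, P ω = 1) (hg : ∀ ω, 0 < g ω) (hQ0 : ∀ ω, 0 ≤ Q ω) (hQ : ∀ ω, 0 < P ω → 0 < Q ω)
    {B : ℝ} (hB : 0 < B) (hQB : ∑ ω, Q ω * g ω ≤ B) :
    ∑ ω, P ω * Real.logb 2 (g ω) - Real.logb 2 B ≤ ∑ ω, P ω * Real.logb 2 (P ω / Q ω) := by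
  have h2 : (0 : ℝ) < Real.log 2 := Real.log_pos one_lt_two
  suffices hs : ∑ ω, P ω * Real.log (g ω) - Real.log B ≤ ∑ ω, P ω * Real.log (P ω / Q ω) by
    simp only [Real.logb, mul_div_assoc']
    rw [← Finset.sum_div, ← Finset.sum_div, ← sub_div]
    exact div_le_div_of_nonneg_right hs h2.le
  -- This is log x ≤ x − 1 at x = Q g / (B P), multiplied by P.
  have hpt : ∀ ω, P ω * Real.log (g ω) - P ω * Real.log B - P ω * Real.log (P ω / Q ω) ≤
      Q ω * g ω / B - P ω := by
    intro ω
    rcases (hP ω).eq_or_lt with h0 | h0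
    · simp only [← h0, zero_mul, sub_zero]
      have := mul_nonneg (hQ0 ω) (hg ω).le
      positivity
    · have hq := hQ ω h0
      have hx : 0 < Q ω * g ω / (B * P ω) := by have := hg ω; positivity
      have hl := Real.log_le_sub_one_of_pos hx
      rw [Real.log_div (mul_pos hq (hg ω)).ne' (mul_pos hB h0).ne',
        Real.log_mul hq.ne' (hg ω).ne', Real.log_mul hB.ne' h0.ne'] at hl
      rw [Real.log_div h0.ne' hq.ne']
      have := mul_le_mul_of_nonneg_left hl h0.le
      have he : P ω * (Q ω * g ω / (B * P ω) - 1) = Q ω * g ω / B - P ω := by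
        field_simp
      rw [he] at this
      linarith
  have := Finset.sum_le_sum fun ω (_ : ω ∈ Finset.univ) => hpt ω
  simp only [Finset.sum_sub_distrib, ← Finset.sum_mul, ← Finset.sum_div, hP1, one_mul] at this
  have : (∑ ω, Q ω * g ω) / B ≤ 1 := by rw [div_le_one hB]; exact hQB
  linarith

/-- Carathéodory-type reduction of the support of a distribution: finitely many expectations are
kept and one further expectation does not decrease. -/
lemma exists_small_support {U ι : Type*} [Fintype U] [Fintype ι] (L : ι → U → ℝ) (o : U → ℝ)
    (w : U → ℝ) (hw : ∀ u, 0 ≤ w u) :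
    ∃ w' : U → ℝ, (∀ u, 0 ≤ w' u) ∧ ∑ u, w' u = ∑ u, w u ∧
      (∀ j, ∑ u, w' u * L j u = ∑ u, w u * L j u) ∧ ∑ u, w u * o u ≤ ∑ u, w' u * o u ∧
      (Finset.univ.filter fun u => w' u ≠ 0).card ≤ Fintype.card ι + 1 := by
  classical
  induction hN : (Finset.univ.filter fun u => w u ≠ 0).card using Nat.strong_induction_on
    generalizing w with
  | _ N ih =>
  by_cases hle : N ≤ Fintype.card ι + 1
  · exact ⟨w, hw, rfl, fun _ => rfl, le_rfl, hN ▸ hle⟩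
  push Not at hle
  set T := Finset.univ.filter fun u => w u ≠ 0 with hT
  -- a nontrivial linear relation on the support
  let Φ : (T → ℝ) →ₗ[ℝ] (Option ι → ℝ) :=
    { toFun := fun v j => ∑ u : T, v u * (j.elim 1 fun i => L i u)
      map_add' := by intro x y; ext j; simp [add_mul, Finset.sum_add_distrib]
      map_smul' := by intro r x; ext j; simp [mul_assoc, Finset.mul_sum] }
  have hker : ∃ v : T → ℝ, Φ v = 0 ∧ v ≠ 0 := by
    have hlt : Module.finrank ℝ (Option ι → ℝ) < Module.finrank ℝ (T → ℝ) := by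
      simp [hN]; omega
    have := LinearMap.ker_ne_bot_of_finrank_lt (f := Φ) hlt
    obtain ⟨v, hv, hv0⟩ := Submodule.exists_mem_ne_zero_of_ne_bot this
    exact ⟨v, LinearMap.mem_ker.1 hv, hv0⟩
  obtain ⟨v₀, hv₀, hv₀0⟩ := hker
  obtain ⟨v, hv, hv0, hvo⟩ : ∃ v : T → ℝ, Φ v = 0 ∧ v ≠ 0 ∧ 0 ≤ ∑ u : T, v u * o u := by
    -- The relation may be negated, so its sign can be chosen such that moving along it does not
    -- decrease the objective `o`.
    rcases le_total 0 (∑ u : T, v₀ u * o u) with h | h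
    · exact ⟨v₀, hv₀, hv₀0, h⟩
    · exact ⟨-v₀, by simp [hv₀], by simpa using hv₀0, by simpa [Finset.sum_neg_distrib] using h⟩
  have hsum : ∑ u : T, v u = 0 := by simpa [Φ] using congrFun hv none
  have hL : ∀ j, ∑ u : T, v u * L j u = 0 := fun j => by simpa [Φ] using congrFun hv (some j)
  have hneg : ∃ u, v u < 0 := by
    by_contra! hcon
    exact hv0 (funext fun u => (Finset.sum_eq_zero_iff_of_nonneg fun u _ => hcon u).1 hsum u
      (Finset.mem_univ _))
  -- the first coordinate to vanish
  let Nn := Finset.univ.filter fun u : T => v u < 0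
  obtain ⟨u₀, hu₀, hmin⟩ := Nn.exists_min_image (fun u => w u / (-v u))
    (by obtain ⟨u, hu⟩ := hneg; exact ⟨u, by simp [Nn, hu]⟩)
  have hu₀neg : v u₀ < 0 := by simpa [Nn] using hu₀
  set θ := w u₀ / (-v u₀) with hθ
  have hθ0 : 0 ≤ θ := div_nonneg (hw _) (by linarith)
  let e : U → ℝ := fun u => if h : u ∈ T then v ⟨u, h⟩ else 0
  have he : ∀ f : U → ℝ, ∑ u, e u * f u = ∑ u : T, v u * f u := by
    intro f
    rw [← Finset.sum_subset (Finset.subset_univ T) (fun u _ hu => by simp [e, hu]),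
      ← Finset.sum_coe_sort T]
    exact Finset.sum_congr rfl fun u _ => by simp [e]
  let w' : U → ℝ := fun u => w u + θ * e u
  have hw' : ∀ f : U → ℝ, ∑ u, w' u * f u = ∑ u, w u * f u + θ * ∑ u : T, v u * f u := by
    intro f
    simp only [w', add_mul, Finset.sum_add_distrib, mul_assoc, ← Finset.mul_sum, he]
  have hw'0 : ∀ u, 0 ≤ w' u := by
    intro u
    by_cases hu : u ∈ T
    · simp only [w', e, hu, dif_pos]
      rcases lt_or_ge (v ⟨u, hu⟩) 0 with hneg | hpos
      · have := hmin ⟨u, hu⟩ (by simp [Nn, hneg])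
        change θ ≤ w u / (-v ⟨u, hu⟩) at this
        rw [le_div_iff₀ (by linarith)] at this
        linarith
      · exact add_nonneg (hw u) (mul_nonneg hθ0 hpos)
    · simpa [w', e, hu] using hw u
  -- `θ` is the largest step that keeps all weights nonnegative, so the weight at `u₀` becomes zero,
  -- and no point outside the old support gains mass.
  have hsub : (Finset.univ.filter fun u => w' u ≠ 0) ⊂ T := by
    rw [Finset.ssubset_iff_of_subset]
    · refine ⟨u₀, u₀.2, ?_⟩
      simp only [Finset.mem_filter, Finset.mem_univ, true_and, not_not, w', e, u₀.2, dif_pos]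
      rw [hθ, div_neg, neg_mul, div_mul_cancel₀ _ hu₀neg.ne, add_neg_cancel]
    · intro u hu
      by_contra hcon
      have hwu : w u = 0 := by simpa [T] using hcon
      have : w' u = 0 := by simp [w', e, hcon, hwu]
      simp [this] at hu
  obtain ⟨w'', h1, h2, h3, h4, h5⟩ := ih _ (hN ▸ Finset.card_lt_card hsub) w' hw'0 rfl
  refine ⟨w'', h1, ?_, fun j => ?_, ?_, h5⟩
  · have := hw' fun _ => 1
    simp only [mul_one, hsum, mul_zero, add_zero] at this
    rw [h2, this]
  · rw [h3, hw', hL, mul_zero, add_zero]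
  · refine le_trans ?_ h4
    rw [hw']
    have := mul_nonneg hθ0 hvo
    linarith

/-- Exponential moments of small order are governed by the mean of the logarithm. -/
lemma eventually_sum_mul_rpow_le {Ω : Type*} [Fintype Ω] (p r : Ω → ℝ) (hp1 : ∑ ω, p ω = 1)
    (hr : ∀ ω, p ω ≠ 0 → 0 < r ω) {K : ℝ} (hK : K < ∑ ω, p ω * Real.logb 2 (r ω)) :
    ∀ᶠ t : ℝ in 𝓝[>] 0, ∑ ω, p ω * r ω ^ (-t) ≤ (2 : ℝ) ^ (-(t * K)) := by
  have h2 : (0 : ℝ) < Real.log 2 := Real.log_pos one_lt_two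
  -- `f 0 = 0` because `p` has mass one, and f′(0) = K log 2 − ∑ p log r is negative by hypothesis;
  -- so `f` is negative immediately to the right of 0.
  let f : ℝ → ℝ := fun t => ∑ ω, p ω * Real.exp (-(t * Real.log (r ω))) -
    Real.exp (-(t * (K * Real.log 2)))
  have hd : HasDerivAt f (∑ ω, p ω * (-Real.log (r ω)) - (-(K * Real.log 2))) 0 := by
    have hexp : ∀ c : ℝ, HasDerivAt (fun t : ℝ => Real.exp (-(t * c))) (-c) 0 := by
      intro c
      have h1 : HasDerivAt (fun t : ℝ => -(t * c)) (-(1 * c)) 0 :=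
        ((hasDerivAt_id (0 : ℝ)).mul_const c).neg
      simpa using h1.exp
    exact (HasDerivAt.fun_sum fun ω _ => (hexp _).const_mul (p ω)).sub (hexp _)
  have hneg : ∑ ω, p ω * (-Real.log (r ω)) - (-(K * Real.log 2)) < 0 := by
    have : ∑ ω, p ω * Real.logb 2 (r ω) = (∑ ω, p ω * Real.log (r ω)) / Real.log 2 := by
      simp only [Real.logb, mul_div_assoc', Finset.sum_div]
    rw [this, lt_div_iff₀ h2] at hK
    simp only [mul_neg, Finset.sum_neg_distrib]
    linarith
  have hf0 : f 0 = 0 := by simp [f, hp1]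
  have hev : ∀ᶠ t : ℝ in 𝓝[>] 0, f t < 0 := by
    have hs := hd.hasDerivWithinAt (s := Set.Ioi 0)
    have := (hasDerivWithinAt_iff_tendsto_slope' (by simp)).1 hs
    filter_upwards [this.eventually (eventually_lt_nhds hneg), self_mem_nhdsWithin] with t ht ht0
    have ht0' : (0 : ℝ) < t := ht0
    rw [slope_def_field, hf0, sub_zero, sub_zero] at ht
    rcases div_neg_iff.1 ht with ⟨_, h⟩ | ⟨h, _⟩
    · linarith
    · exact h
  filter_upwards [hev] with t ht
  have h1 : ∑ ω, p ω * r ω ^ (-t) = ∑ ω, p ω * Real.exp (-(t * Real.log (r ω))) := by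
    refine Finset.sum_congr rfl fun ω _ => ?_
    by_cases h0 : p ω = 0
    · simp [h0]
    · rw [Real.rpow_def_of_pos (hr ω h0)]
      ring_nf
  have h3 : (2 : ℝ) ^ (-(t * K)) = Real.exp (-(t * (K * Real.log 2))) := by
    rw [Real.rpow_def_of_pos two_pos]
    ring_nf
  rw [h1, h3]
  have : f t < 0 := ht
  simp only [f] at this
  linarith

end General

end CribMAC

noncomputable section
namespace CribMAC

set_option linter.unusedSectionVars false

/-! ### Laws of random variables and entropies as expectations -/

section Law

variable {Ω α β γ : Type*} [Fintype Ω] [Fintype α] [Fintype β] [Fintype γ]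

lemma sum_law_mul (p : Ω → ℝ) (T : Ω → α) (g : α → ℝ) :
    ∑ t, law p T t * g t = ∑ ω, p ω * g (T ω) := by
  classical
  simp only [law, Finset.sum_mul]
  rw [Finset.sum_comm]
  refine Finset.sum_congr rfl fun ω _ => ?_
  rw [Finset.sum_eq_single (T ω)]
  · simp
  · intro b _ hb
    simp [hb.symm]
  · simp

lemma condEntropy_eq_sum (p : Ω → ℝ) (A : Ω → α) (B : Ω → β) :
    condEntropy p A B = -∑ ω, p ω *
      Real.logb 2 (law p (fun ω => (A ω, B ω)) (A ω, B ω) / law p B (B ω)) := by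
  rw [condEntropy, ← sum_law_mul p (fun ω => (A ω, B ω))
    (fun t => Real.logb 2 (law p (fun ω => (A ω, B ω)) t / law p B t.2)), Fintype.sum_prod_type]

/-- Makes every probability inside a logarithm positive at a point of positive mass, so that
logarithms of quotients can be split. -/
lemma le_law {p : Ω → ℝ} (hp : ∀ ω, 0 ≤ p ω) (T : Ω → α) (ω : Ω) : p ω ≤ law p T (T ω) := by
  classical
  have := Finset.single_le_sum (f := fun ω' => if T ω' = T ω then p ω' else 0)
    (fun ω' _ => by split_ifs <;> simp [hp]) (Finset.mem_univ ω)
  simp only [if_true] at this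
  refine this.trans (le_of_eq ?_)
  unfold law
  congr!

open Classical in
/-- Computing a law from a parametrisation of a fibre. -/
lemma law_eq_sum {ι : Type*} [Fintype ι] (p : Ω → ℝ) (T : Ω → α) (t : α) (g : ι → Ω)
    (hg : Function.Injective g) (Q : ι → Prop) (h : ∀ ω, T ω = t ↔ ∃ r, Q r ∧ g r = ω) :
    law p T t = ∑ r, if Q r then p (g r) else 0 := by
  rw [law, ← Finset.sum_filter, ← Finset.sum_filter, ← Finset.sum_image (f := p)
    (fun x _ y _ hxy => hg hxy)]
  refine Finset.sum_congr ?_ fun _ _ => rfl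
  ext ω
  simp [h]

/-- The chain rule H(A|B) = H(A,B) − H(B). Unlike the quotient form, it is visibly continuous in
`p`, also where masses vanish. -/
lemma condEntropy_eq_negMulLog {p : Ω → ℝ} (hp : ∀ ω, 0 ≤ p ω) (A : Ω → α) (B : Ω → β) :
    condEntropy p A B = (∑ t, Real.negMulLog (law p (fun ω => (A ω, B ω)) t) -
      ∑ b, Real.negMulLog (law p B b)) / Real.log 2 := by
  have h1 : ∑ t, Real.negMulLog (law p (fun ω => (A ω, B ω)) t) =
      -∑ ω, p ω * Real.log (law p (fun ω => (A ω, B ω)) (A ω, B ω)) := by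
    rw [← sum_law_mul p (fun ω => (A ω, B ω))
      (fun t => Real.log (law p (fun ω => (A ω, B ω)) t)), ← Finset.sum_neg_distrib]
    simp [Real.negMulLog]
  have h2 : ∑ b, Real.negMulLog (law p B b) = -∑ ω, p ω * Real.log (law p B (B ω)) := by
    rw [← sum_law_mul p B (fun t => Real.log (law p B t)), ← Finset.sum_neg_distrib]
    simp [Real.negMulLog]
  rw [condEntropy_eq_sum, h1, h2]
  simp only [Real.logb, mul_div_assoc']
  rw [← Finset.sum_div, ← neg_div, neg_sub_neg, ← Finset.sum_sub_distrib,
    ← Finset.sum_neg_distrib]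
  congr 1
  refine Finset.sum_congr rfl fun ω _ => ?_
  rcases (hp ω).eq_or_lt with h0 | h0
  · simp [← h0]
  · rw [Real.log_div (h0.trans_le (le_law hp (fun ω => (A ω, B ω)) ω)).ne'
      (h0.trans_le (le_law hp B ω)).ne']
    ring

end Law

/-! ### Single-letter densities and their positivity -/

section SingleLetterForms

variable {S₁ S₂ X₁ X₂ Y Z₁ Z₂ U : Type*} [Fintype S₁] [Fintype S₂] [Fintype X₁] [Fintype X₂]
  [Fintype Y] [Fintype Z₁] [Fintype Z₂] [Fintype U]

open Classical in
/-- The distribution `q` if `w` holds, the point mass at `x` otherwise. -/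
def kern {α : Type*} (w : Bool) (q : α → ℝ) (x x' : α) : ℝ :=
  if w then q x' else if x' = x then 1 else 0

open Classical in
/-- Joint probability of the cribbed signals `(ζ₁, ζ₂)` and the output `y` at given states, where
the inputs flagged by `c` are random and the other inputs equal `x₁`, `x₂`. -/
def cribLaw (ch : Channel S₁ S₂ X₁ X₂ Y Z₁ Z₂) (c : Bool × Bool) (a : S₁ → X₁ → ℝ)
    (b : S₂ → X₂ → ℝ) (s₁ : S₁) (s₂ : S₂) (x₁ : X₁) (x₂ : X₂) (ζ₁ : Z₁) (ζ₂ : Z₂) (y : Y) : ℝ :=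
  ∑ x₁', ∑ x₂', kern c.1 (a s₁) x₁ x₁' * kern c.2 (b s₂) x₂ x₂' *
    if ch.z₁ x₁' s₁ = ζ₁ ∧ ch.z₂ x₂' s₂ = ζ₂ then ch.W x₁' x₂' s₁ s₂ y else 0

/-- `cribLaw` at the cribbed signals belonging to `x₁` and `x₂`. -/
def cribDen (ch : Channel S₁ S₂ X₁ X₂ Y Z₁ Z₂) (c : Bool × Bool) (a : S₁ → X₁ → ℝ)
    (b : S₂ → X₂ → ℝ) (s₁ : S₁) (s₂ : S₂) (x₁ : X₁) (x₂ : X₂) (y : Y) : ℝ :=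
  cribLaw ch c a b s₁ s₂ x₁ x₂ (ch.z₁ x₁ s₁) (ch.z₂ x₂ s₂) y

/-- The output law given the states. -/
def outLaw (ch : Channel S₁ S₂ X₁ X₂ Y Z₁ Z₂) (pU : U → ℝ) (pX₁ : U → S₁ → X₁ → ℝ)
    (pX₂ : U → S₂ → X₂ → ℝ) (s₁ : S₁) (s₂ : S₂) (y : Y) : ℝ :=
  ∑ u, ∑ x₁, ∑ x₂, pU u * pX₁ u s₁ x₁ * pX₂ u s₂ x₂ * ch.W x₁ x₂ s₁ s₂ y

/-- The information, in bits, about the inputs flagged by `c` in the cribbed signals and the output,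
for given input laws. -/
def cribInfo (ch : Channel S₁ S₂ X₁ X₂ Y Z₁ Z₂) (c : Bool × Bool) (a : S₁ → X₁ → ℝ)
    (b : S₂ → X₂ → ℝ) : ℝ :=
  ∑ s₁, ∑ s₂, ∑ x₁, ∑ x₂, ∑ y, ch.pS (s₁, s₂) * a s₁ x₁ * b s₂ x₂ * ch.W x₁ x₂ s₁ s₂ y *
    Real.logb 2 (ch.W x₁ x₂ s₁ s₂ y / cribDen ch c a b s₁ s₂ x₁ x₂ y)

/-- The information in bits about both inputs in the output. -/
def outInfo (ch : Channel S₁ S₂ X₁ X₂ Y Z₁ Z₂) (pU : U → ℝ) (pX₁ : U → S₁ → X₁ → ℝ)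
    (pX₂ : U → S₂ → X₂ → ℝ) : ℝ :=
  ∑ u, ∑ s₁, ∑ s₂, ∑ x₁, ∑ x₂, ∑ y, ch.pS (s₁, s₂) * pU u * pX₁ u s₁ x₁ * pX₂ u s₂ x₂ *
    ch.W x₁ x₂ s₁ s₂ y * Real.logb 2 (ch.W x₁ x₂ s₁ s₂ y / outLaw ch pU pX₁ pX₂ s₁ s₂ y)

lemma kern_nonneg {α : Type*} (w : Bool) {q : α → ℝ} (hq : ∀ x, 0 ≤ q x) (x x' : α) :
    0 ≤ kern w q x x' := by
  unfold kern
  split_ifs <;> simp [hq]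

lemma sum_kern {α : Type*} [Fintype α] (w : Bool) {q : α → ℝ} (hq : ∑ x, q x = 1) (x : α) :
    ∑ x', kern w q x x' = 1 := by
  classical
  cases w <;> simp [kern, hq]

lemma W_nonneg (ch : Channel S₁ S₂ X₁ X₂ Y Z₁ Z₂) (x₁ : X₁) (x₂ : X₂) (s₁ : S₁) (s₂ : S₂) (y : Y) :
    0 ≤ ch.W x₁ x₂ s₁ s₂ y := (ch.W_mem x₁ x₂ s₁ s₂).1 y

lemma sum_W (ch : Channel S₁ S₂ X₁ X₂ Y Z₁ Z₂) (x₁ : X₁) (x₂ : X₂) (s₁ : S₁) (s₂ : S₂) :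
    ∑ y, ch.W x₁ x₂ s₁ s₂ y = 1 := (ch.W_mem x₁ x₂ s₁ s₂).2

lemma cribLaw_nonneg (ch : Channel S₁ S₂ X₁ X₂ Y Z₁ Z₂) (c : Bool × Bool) {a : S₁ → X₁ → ℝ}
    {b : S₂ → X₂ → ℝ} (ha : ∀ s x, 0 ≤ a s x) (hb : ∀ s x, 0 ≤ b s x) (s₁ : S₁) (s₂ : S₂)
    (x₁ : X₁) (x₂ : X₂) (ζ₁ : Z₁) (ζ₂ : Z₂) (y : Y) :
    0 ≤ cribLaw ch c a b s₁ s₂ x₁ x₂ ζ₁ ζ₂ y := by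
  refine Finset.sum_nonneg fun _ _ => Finset.sum_nonneg fun _ _ => mul_nonneg (mul_nonneg
    (kern_nonneg _ (ha _) _ _) (kern_nonneg _ (hb _) _ _)) ?_
  split_ifs
  · exact W_nonneg ..
  · exact le_rfl

lemma kern_self_pos {α : Type*} (w : Bool) {q : α → ℝ} {x : α} (hq : 0 < q x) :
    0 < kern w q x x := by
  cases w <;> simp [kern, hq]

/-- The actual input pair is one of the terms of the sum, whichever inputs are flagged, and its
contribution is positive. -/
lemma cribDen_pos (ch : Channel S₁ S₂ X₁ X₂ Y Z₁ Z₂) (c : Bool × Bool) {a : S₁ → X₁ → ℝ}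
    {b : S₂ → X₂ → ℝ} (ha : ∀ s x, 0 ≤ a s x) (hb : ∀ s x, 0 ≤ b s x) {s₁ : S₁} {s₂ : S₂}
    {x₁ : X₁} {x₂ : X₂} {y : Y} (h₁ : 0 < a s₁ x₁) (h₂ : 0 < b s₂ x₂)
    (hW : 0 < ch.W x₁ x₂ s₁ s₂ y) : 0 < cribDen ch c a b s₁ s₂ x₁ x₂ y := by
  classical
  have hnn : ∀ x₁' x₂', 0 ≤ kern c.1 (a s₁) x₁ x₁' * kern c.2 (b s₂) x₂ x₂' *
      if ch.z₁ x₁' s₁ = ch.z₁ x₁ s₁ ∧ ch.z₂ x₂' s₂ = ch.z₂ x₂ s₂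
        then ch.W x₁' x₂' s₁ s₂ y else 0 := by
    intro x₁' x₂'
    refine mul_nonneg (mul_nonneg (kern_nonneg _ (ha _) _ _) (kern_nonneg _ (hb _) _ _)) ?_
    split_ifs
    · exact W_nonneg ..
    · exact le_rfl
  unfold cribDen cribLaw
  refine Finset.sum_pos' (fun _ _ => Finset.sum_nonneg fun _ _ => ?_) ⟨x₁, Finset.mem_univ _,
    Finset.sum_pos' (fun _ _ => ?_) ⟨x₂, Finset.mem_univ _, ?_⟩⟩
  · convert hnn _ _
  · convert hnn _ _
  · have := kern_self_pos c.1 h₁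
    have := kern_self_pos c.2 h₂
    simp only [and_self, if_true]
    positivity

lemma outLaw_pos (ch : Channel S₁ S₂ X₁ X₂ Y Z₁ Z₂) {pU : U → ℝ} {pX₁ : U → S₁ → X₁ → ℝ}
    {pX₂ : U → S₂ → X₂ → ℝ} (hU : ∀ u, 0 ≤ pU u) (h₁ : ∀ u s x, 0 ≤ pX₁ u s x)
    (h₂ : ∀ u s x, 0 ≤ pX₂ u s x) {u : U} {s₁ : S₁} {s₂ : S₂} {x₁ : X₁} {x₂ : X₂} {y : Y}
    (h : 0 < pU u * pX₁ u s₁ x₁ * pX₂ u s₂ x₂ * ch.W x₁ x₂ s₁ s₂ y) :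
    0 < outLaw ch pU pX₁ pX₂ s₁ s₂ y := by
  have hnn : ∀ u x₁ x₂, 0 ≤ pU u * pX₁ u s₁ x₁ * pX₂ u s₂ x₂ * ch.W x₁ x₂ s₁ s₂ y :=
    fun u x₁ x₂ => mul_nonneg (mul_nonneg (mul_nonneg (hU u) (h₁ ..)) (h₂ ..)) (W_nonneg ..)
  exact Finset.sum_pos' (fun _ _ => Finset.sum_nonneg fun _ _ => Finset.sum_nonneg fun _ _ =>
    hnn _ _ _) ⟨u, Finset.mem_univ _, Finset.sum_pos' (fun _ _ => Finset.sum_nonneg fun _ _ =>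
    hnn _ _ _) ⟨x₁, Finset.mem_univ _, Finset.sum_pos' (fun _ _ =>
    hnn _ _ _) ⟨x₂, Finset.mem_univ _, h⟩⟩⟩

end SingleLetterForms

/-! ### The joint pmf: sign, support and iterated sums -/

section RateBoundsForms

variable {S₁ S₂ X₁ X₂ Y Z₁ Z₂ U : Type*} [Fintype S₁] [Fintype S₂] [Fintype X₁] [Fintype X₂]
  [Fintype Y] [Fintype Z₁] [Fintype Z₂] [Fintype U]
  (ch : Channel S₁ S₂ X₁ X₂ Y Z₁ Z₂) {pU : U → ℝ} {pX₁ : U → S₁ → X₁ → ℝ}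
  {pX₂ : U → S₂ → X₂ → ℝ}

lemma jointPMF_nonneg (hU : ∀ u, 0 ≤ pU u) (h₁ : ∀ u s, pX₁ u s ∈ stdSimplex ℝ X₁)
    (h₂ : ∀ u s, pX₂ u s ∈ stdSimplex ℝ X₂) (ω : U × S₁ × S₂ × X₁ × X₂ × Y) :
    0 ≤ jointPMF ch pU pX₁ pX₂ ω := by
  obtain ⟨u, s₁, s₂, x₁, x₂, y⟩ := ω
  exact mul_nonneg (mul_nonneg (mul_nonneg (mul_nonneg (ch.pS_mem.1 _) (hU u)) ((h₁ u s₁).1 _))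
    ((h₂ u s₂).1 _)) (W_nonneg ..)

lemma pos_of_jointPMF_ne_zero (hU : ∀ u, 0 ≤ pU u) (h₁ : ∀ u s, pX₁ u s ∈ stdSimplex ℝ X₁)
    (h₂ : ∀ u s, pX₂ u s ∈ stdSimplex ℝ X₂) {u : U} {s₁ : S₁} {s₂ : S₂} {x₁ : X₁} {x₂ : X₂} {y : Y}
    (h : jointPMF ch pU pX₁ pX₂ (u, s₁, s₂, x₁, x₂, y) ≠ 0) :
    0 < ch.pS (s₁, s₂) ∧ 0 < pU u ∧ 0 < pX₁ u s₁ x₁ ∧ 0 < pX₂ u s₂ x₂ ∧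
      0 < ch.W x₁ x₂ s₁ s₂ y := by
  simp only [jointPMF, mul_ne_zero_iff] at h
  obtain ⟨⟨⟨⟨hs, hu⟩, h1⟩, h2⟩, hw⟩ := h
  exact ⟨(ch.pS_mem.1 _).lt_of_ne' hs, (hU u).lt_of_ne' hu, ((h₁ u s₁).1 _).lt_of_ne' h1,
    ((h₂ u s₂).1 _).lt_of_ne' h2, (W_nonneg ..).lt_of_ne' hw⟩

lemma sum_jointPMF_mul (f : U × S₁ × S₂ × X₁ × X₂ × Y → ℝ) :
    ∑ ω, jointPMF ch pU pX₁ pX₂ ω * f ω = ∑ u, ∑ s₁, ∑ s₂, ∑ x₁, ∑ x₂, ∑ y,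
      ch.pS (s₁, s₂) * pU u * pX₁ u s₁ x₁ * pX₂ u s₂ x₂ * ch.W x₁ x₂ s₁ s₂ y *
        f (u, s₁, s₂, x₁, x₂, y) := by
  simp only [Fintype.sum_prod_type, jointPMF]

end RateBoundsForms

end CribMAC
end

noncomputable section
namespace CribMAC

set_option linter.unusedSectionVars false

/-! ### The four rate bounds as expectations of log-likelihood ratios -/

section RateBoundsForms

variable {S₁ S₂ X₁ X₂ Y Z₁ Z₂ U : Type*} [Fintype S₁] [Fintype S₂] [Fintype X₁] [Fintype X₂]
  [Fintype Y] [Fintype Z₁] [Fintype Z₂] [Fintype U]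
  (ch : Channel S₁ S₂ X₁ X₂ Y Z₁ Z₂) {pU : U → ℝ} {pX₁ : U → S₁ → X₁ → ℝ}
  {pX₂ : U → S₂ → X₂ → ℝ}

/-- Combining the densities of a conditional mutual information and a conditional entropy. -/
lemma condMutualInfo_add_condEntropy {Ω α β γ δ ε : Type*} [Fintype Ω] [Fintype α] [Fintype β]
    [Fintype γ] [Fintype δ] [Fintype ε] {p : Ω → ℝ} (hp : ∀ ω, 0 ≤ p ω) (A : Ω → α) (B : Ω → β)
    (C : Ω → γ) (D : Ω → δ) (E : Ω → ε) (f g : Ω → ℝ)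
    (hf : ∀ ω, p ω ≠ 0 → law p (fun ω => (B ω, (A ω, C ω))) (B ω, (A ω, C ω)) =
      f ω * law p (fun ω => (A ω, C ω)) (A ω, C ω))
    (hg : ∀ ω, p ω ≠ 0 → law p (fun ω => (B ω, C ω)) (B ω, C ω) *
      law p (fun ω => (D ω, E ω)) (D ω, E ω) = g ω * (law p C (C ω) * law p E (E ω))) :
    condMutualInfo p A B C + condEntropy p D E = ∑ ω, p ω * Real.logb 2 (f ω / g ω) := by
  rw [condMutualInfo, condEntropy_eq_sum, condEntropy_eq_sum, condEntropy_eq_sum]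
  rw [sub_neg_eq_add, ← sub_eq_add_neg, neg_add_eq_sub, ← Finset.sum_sub_distrib,
    ← Finset.sum_sub_distrib]
  refine Finset.sum_congr rfl fun ω _ => ?_
  by_cases h0 : p ω = 0
  · simp [h0]
  have hpos := (hp ω).lt_of_ne' h0
  have h1 := hpos.trans_le (le_law hp (fun ω => (B ω, (A ω, C ω))) ω)
  have h2 := hpos.trans_le (le_law hp (fun ω => (A ω, C ω)) ω)
  have h3 := hpos.trans_le (le_law hp (fun ω => (B ω, C ω)) ω)
  have h4 := hpos.trans_le (le_law hp (fun ω => (D ω, E ω)) ω)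
  have h5 := hpos.trans_le (le_law hp C ω)
  have h6 := hpos.trans_le (le_law hp E ω)
  have hf' := hf ω h0
  have hg' := hg ω h0
  have e1 : f ω = law p (fun ω => (B ω, (A ω, C ω))) (B ω, (A ω, C ω)) /
      law p (fun ω => (A ω, C ω)) (A ω, C ω) := by rw [hf', mul_div_cancel_right₀ _ h2.ne']
  have e2 : g ω = (law p (fun ω => (B ω, C ω)) (B ω, C ω) / law p C (C ω)) *
      (law p (fun ω => (D ω, E ω)) (D ω, E ω) / law p E (E ω)) := by
    rw [div_mul_div_comm, hg', mul_div_cancel_right₀ _ (mul_pos h5 h6).ne']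
  rw [e1, e2, Real.logb_div (div_pos h1 h2).ne' (mul_pos (div_pos h3 h5) (div_pos h4 h6)).ne',
    Real.logb_mul (div_pos h3 h5).ne' (div_pos h4 h6).ne']
  ring

/-- The case of the preceding lemma in which the entropy term belongs to a constant variable and
vanishes. -/
lemma condMutualInfo_eq_sum {Ω α β γ : Type*} [Fintype Ω] [Fintype α] [Fintype β]
    [Fintype γ] {p : Ω → ℝ} (hp : ∀ ω, 0 ≤ p ω) (A : Ω → α) (B : Ω → β)
    (C : Ω → γ) (f g : Ω → ℝ)
    (hf : ∀ ω, p ω ≠ 0 → law p (fun ω => (B ω, (A ω, C ω))) (B ω, (A ω, C ω)) =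
      f ω * law p (fun ω => (A ω, C ω)) (A ω, C ω))
    (hg : ∀ ω, p ω ≠ 0 → law p (fun ω => (B ω, C ω)) (B ω, C ω) = g ω * law p C (C ω)) :
    condMutualInfo p A B C = ∑ ω, p ω * Real.logb 2 (f ω / g ω) := by
  have h := condMutualInfo_add_condEntropy hp A B C (fun _ : Ω => ()) (fun _ : Ω => ()) f g hf
    (fun ω h0 => by rw [hg ω h0, mul_assoc]; simp [law])
  have hz : condEntropy p (fun _ : Ω => ()) (fun _ : Ω => ()) = 0 := by
    rw [condEntropy_eq_sum]
    by_cases h : ∑ ω, p ω = 0 <;> simp [law, h]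
  rw [hz, add_zero] at h
  exact h

lemma sum_mul_W (r : ℝ) (x₁ : X₁) (x₂ : X₂) (s₁ : S₁) (s₂ : S₂) :
    ∑ y, r * ch.W x₁ x₂ s₁ s₂ y = r := by
  rw [← Finset.mul_sum, sum_W, mul_one]

open Classical in
lemma sum_ite_mul_W (Q : Prop) (r : ℝ) (x₁ : X₁) (x₂ : X₂) (s₁ : S₁) (s₂ : S₂) :
    (∑ y, if Q then r * ch.W x₁ x₂ s₁ s₂ y else 0) = if Q then r else 0 := by
  split_ifs
  · exact sum_mul_W ch r x₁ x₂ s₁ s₂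
  · simp

/-- The first rate bound as an expectation. -/
lemma rateBound₁_eq (hU : ∀ u, 0 ≤ pU u) (h₁ : ∀ u s, pX₁ u s ∈ stdSimplex ℝ X₁)
    (h₂ : ∀ u s, pX₂ u s ∈ stdSimplex ℝ X₂) :
    condMutualInfo (jointPMF ch pU pX₁ pX₂) (fun ω => ω.2.2.2.1) (fun ω => ω.2.2.2.2.2)
        (fun ω => (ω.1, ω.2.2.2.2.1, ch.z₁ ω.2.2.2.1 ω.2.1, ω.2.1, ω.2.2.1)) +
      condEntropy (jointPMF ch pU pX₁ pX₂) (fun ω => ch.z₁ ω.2.2.2.1 ω.2.1)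
        (fun ω => (ω.1, ω.2.1)) =
    ∑ ω, jointPMF ch pU pX₁ pX₂ ω * Real.logb 2 (ch.W ω.2.2.2.1 ω.2.2.2.2.1 ω.2.1 ω.2.2.1
        ω.2.2.2.2.2 / cribDen ch (true, false) (pX₁ ω.1) (pX₂ ω.1) ω.2.1 ω.2.2.1 ω.2.2.2.1
        ω.2.2.2.2.1 ω.2.2.2.2.2) := by
  classical
  refine condMutualInfo_add_condEntropy (jointPMF_nonneg ch hU h₁ h₂) _ _ _ _ _ _ _ ?_ ?_
  · rintro ⟨u, s₁, s₂, x₁, x₂, y⟩ h0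
    rw [law_eq_sum (ι := Unit) _ _ _ (fun _ => (u, s₁, s₂, x₁, x₂, y))
        (by simp [Function.Injective])
        (fun _ => True) (by rintro ⟨u', s₁', s₂', x₁', x₂', y'⟩; simp; grind),
      law_eq_sum (ι := Y) _ _ _ (fun y => (u, s₁, s₂, x₁, x₂, y)) (by simp [Function.Injective])
        (fun _ => True) (by rintro ⟨u', s₁', s₂', x₁', x₂', y'⟩; simp; grind)]
    simp only [jointPMF, if_true, sum_mul_W, Finset.univ_unique, Finset.sum_singleton]
    ring
  · rintro ⟨u, s₁, s₂, x₁, x₂, y⟩ h0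
    rw [law_eq_sum (ι := X₁) _ _ _ (fun x₁ => (u, s₁, s₂, x₁, x₂, y)) (by simp [Function.Injective])
        (fun x₁' => ch.z₁ x₁' s₁ = ch.z₁ x₁ s₁)
        (by rintro ⟨u', s₁', s₂', x₁', x₂', y'⟩; simp; grind),
      law_eq_sum (ι := X₁ × S₂ × X₂ × Y) _ _ _ (fun r => (u, s₁, r.2.1, r.1, r.2.2.1, r.2.2.2))
        (by intro r r' h; grind)
        (fun r => ch.z₁ r.1 s₁ = ch.z₁ x₁ s₁)
        (by rintro ⟨u', s₁', s₂', x₁', x₂', y'⟩; simp; grind),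
      law_eq_sum (ι := X₁ × Y) _ _ _ (fun r => (u, s₁, s₂, r.1, x₂, r.2))
        (by intro r r' h; grind)
        (fun r => ch.z₁ r.1 s₁ = ch.z₁ x₁ s₁)
        (by rintro ⟨u', s₁', s₂', x₁', x₂', y'⟩; simp; grind),
      law_eq_sum (ι := S₂ × X₁ × X₂ × Y) _ _ _ (fun r => (u, s₁, r.1, r.2.1, r.2.2.1, r.2.2.2))
        (by intro r r' h; grind)
        (fun r => True)
        (by rintro ⟨u', s₁', s₂', x₁', x₂', y'⟩; simp; grind)]
    simp only [jointPMF, if_true, sum_mul_W, Fintype.sum_prod_type, sum_ite_mul_W]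
    have hs₁ : ∀ u s, ∑ x, pX₁ u s x = 1 := fun u s => (h₁ u s).2
    have hs₂ : ∀ u s, ∑ x, pX₂ u s x = 1 := fun u s => (h₂ u s).2
    have e1 : (∑ x₁', if ch.z₁ x₁' s₁ = ch.z₁ x₁ s₁ then
        ch.pS (s₁, s₂) * pU u * pX₁ u s₁ x₁' * pX₂ u s₂ x₂ * ch.W x₁' x₂ s₁ s₂ y else 0) =
        ch.pS (s₁, s₂) * pU u * pX₂ u s₂ x₂ *
          cribDen ch (true, false) (pX₁ u) (pX₂ u) s₁ s₂ x₁ x₂ y := by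
      rw [cribDen, cribLaw, Finset.mul_sum]
      refine Finset.sum_congr rfl fun x₁' _ => ?_
      rw [Finset.sum_eq_single x₂ (fun x₂' _ h => by simp [kern, h]) (by simp)]
      by_cases hz : ch.z₁ x₁' s₁ = ch.z₁ x₁ s₁ <;> simp [kern, hz]
      ring
    -- Given U and S₁, the signal Z₁ is independent of S₂ and X₂. Hence the same sum over the fibre
    -- of `ch.z₁` occurs here and in `e3`; it cancels together with the marginal of S₁ shared with
    -- `e4`, and only `cribDen` remains.
    have e2 : (∑ x₁', ∑ s₂', ∑ x₂', if ch.z₁ x₁' s₁ = ch.z₁ x₁ s₁ then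
        ch.pS (s₁, s₂') * pU u * pX₁ u s₁ x₁' * pX₂ u s₂' x₂' else 0) =
        pU u * (∑ s₂', ch.pS (s₁, s₂')) * ∑ x₁', if ch.z₁ x₁' s₁ = ch.z₁ x₁ s₁ then
          pX₁ u s₁ x₁' else 0 := by
      rw [Finset.mul_sum]
      refine Finset.sum_congr rfl fun x₁' _ => ?_
      split_ifs
      · simp only [← Finset.mul_sum, hs₂, mul_one, ← Finset.sum_mul]
        ring
      · simp
    have e3 : (∑ x₁', if ch.z₁ x₁' s₁ = ch.z₁ x₁ s₁ then
        ch.pS (s₁, s₂) * pU u * pX₁ u s₁ x₁' * pX₂ u s₂ x₂ else 0) =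
        ch.pS (s₁, s₂) * pU u * pX₂ u s₂ x₂ * ∑ x₁', if ch.z₁ x₁' s₁ = ch.z₁ x₁ s₁ then
          pX₁ u s₁ x₁' else 0 := by
      rw [Finset.mul_sum]
      refine Finset.sum_congr rfl fun x₁' _ => ?_
      split_ifs
      · ring
      · simp
    have e4 : ∑ s₂', ∑ x₁', ∑ x₂', ch.pS (s₁, s₂') * pU u * pX₁ u s₁ x₁' * pX₂ u s₂' x₂' =
        pU u * ∑ s₂', ch.pS (s₁, s₂') := by
      simp only [← Finset.mul_sum, hs₂, mul_one, hs₁, ← Finset.sum_mul]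
      ring
    rw [e1, e2, e3, e4]
    ring

/-- The second rate bound as an expectation. -/
lemma rateBound₂_eq (hU : ∀ u, 0 ≤ pU u) (h₁ : ∀ u s, pX₁ u s ∈ stdSimplex ℝ X₁)
    (h₂ : ∀ u s, pX₂ u s ∈ stdSimplex ℝ X₂) :
    condMutualInfo (jointPMF ch pU pX₁ pX₂) (fun ω => ω.2.2.2.2.1) (fun ω => ω.2.2.2.2.2)
        (fun ω => (ω.1, ω.2.2.2.1, ch.z₂ ω.2.2.2.2.1 ω.2.2.1, ω.2.1, ω.2.2.1)) +
      condEntropy (jointPMF ch pU pX₁ pX₂) (fun ω => ch.z₂ ω.2.2.2.2.1 ω.2.2.1)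
        (fun ω => (ω.1, ω.2.2.1)) =
    ∑ ω, jointPMF ch pU pX₁ pX₂ ω * Real.logb 2 (ch.W ω.2.2.2.1 ω.2.2.2.2.1 ω.2.1 ω.2.2.1
        ω.2.2.2.2.2 / cribDen ch (false, true) (pX₁ ω.1) (pX₂ ω.1) ω.2.1 ω.2.2.1 ω.2.2.2.1
        ω.2.2.2.2.1 ω.2.2.2.2.2) := by
  classical
  refine condMutualInfo_add_condEntropy (jointPMF_nonneg ch hU h₁ h₂) _ _ _ _ _ _ _ ?_ ?_
  · rintro ⟨u, s₁, s₂, x₁, x₂, y⟩ h0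
    rw [law_eq_sum (ι := Unit) _ _ _ (fun _ => (u, s₁, s₂, x₁, x₂, y))
        (by simp [Function.Injective])
        (fun _ => True) (by rintro ⟨u', s₁', s₂', x₁', x₂', y'⟩; simp; grind),
      law_eq_sum (ι := Y) _ _ _ (fun y => (u, s₁, s₂, x₁, x₂, y)) (by simp [Function.Injective])
        (fun _ => True) (by rintro ⟨u', s₁', s₂', x₁', x₂', y'⟩; simp; grind)]
    simp only [jointPMF, if_true, sum_mul_W, Finset.univ_unique, Finset.sum_singleton]
    ring
  · rintro ⟨u, s₁, s₂, x₁, x₂, y⟩ h0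
    rw [law_eq_sum (ι := X₂) _ _ _ (fun x₂ => (u, s₁, s₂, x₁, x₂, y)) (by simp [Function.Injective])
        (fun x₂' => ch.z₂ x₂' s₂ = ch.z₂ x₂ s₂)
        (by rintro ⟨u', s₁', s₂', x₁', x₂', y'⟩; simp; grind),
      law_eq_sum (ι := X₂ × S₁ × X₁ × Y) _ _ _ (fun r => (u, r.2.1, s₂, r.2.2.1, r.1, r.2.2.2))
        (by intro r r' h; grind)
        (fun r => ch.z₂ r.1 s₂ = ch.z₂ x₂ s₂)
        (by rintro ⟨u', s₁', s₂', x₁', x₂', y'⟩; simp; grind),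
      law_eq_sum (ι := X₂ × Y) _ _ _ (fun r => (u, s₁, s₂, x₁, r.1, r.2))
        (by intro r r' h; grind)
        (fun r => ch.z₂ r.1 s₂ = ch.z₂ x₂ s₂)
        (by rintro ⟨u', s₁', s₂', x₁', x₂', y'⟩; simp; grind),
      law_eq_sum (ι := S₁ × X₁ × X₂ × Y) _ _ _ (fun r => (u, r.1, s₂, r.2.1, r.2.2.1, r.2.2.2))
        (by intro r r' h; grind)
        (fun r => True)
        (by rintro ⟨u', s₁', s₂', x₁', x₂', y'⟩; simp; grind)]
    simp only [jointPMF, if_true, sum_mul_W, Fintype.sum_prod_type, sum_ite_mul_W]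
    have hs₁ : ∀ u s, ∑ x, pX₁ u s x = 1 := fun u s => (h₁ u s).2
    have hs₂ : ∀ u s, ∑ x, pX₂ u s x = 1 := fun u s => (h₂ u s).2
    have e1 : (∑ x₂', if ch.z₂ x₂' s₂ = ch.z₂ x₂ s₂ then
        ch.pS (s₁, s₂) * pU u * pX₁ u s₁ x₁ * pX₂ u s₂ x₂' * ch.W x₁ x₂' s₁ s₂ y else 0) =
        ch.pS (s₁, s₂) * pU u * pX₁ u s₁ x₁ *
          cribDen ch (false, true) (pX₁ u) (pX₂ u) s₁ s₂ x₁ x₂ y := by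
      rw [cribDen, cribLaw, Finset.sum_eq_single x₁ (fun x₁' _ h => by simp [kern, h]) (by simp),
        Finset.mul_sum]
      refine Finset.sum_congr rfl fun x₂' _ => ?_
      by_cases hz : ch.z₂ x₂' s₂ = ch.z₂ x₂ s₂ <;> simp [kern, hz]
      ring
    have e2 : (∑ x₂', ∑ s₁', ∑ x₁', if ch.z₂ x₂' s₂ = ch.z₂ x₂ s₂ then
        ch.pS (s₁', s₂) * pU u * pX₁ u s₁' x₁' * pX₂ u s₂ x₂' else 0) =
        pU u * (∑ s₁', ch.pS (s₁', s₂)) * ∑ x₂', if ch.z₂ x₂' s₂ = ch.z₂ x₂ s₂ then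
          pX₂ u s₂ x₂' else 0 := by
      rw [Finset.mul_sum]
      refine Finset.sum_congr rfl fun x₂' _ => ?_
      split_ifs
      · simp only [← Finset.mul_sum, hs₁, mul_one, ← Finset.sum_mul]
        ring
      · simp
    have e3 : (∑ x₂', if ch.z₂ x₂' s₂ = ch.z₂ x₂ s₂ then
        ch.pS (s₁, s₂) * pU u * pX₁ u s₁ x₁ * pX₂ u s₂ x₂' else 0) =
        ch.pS (s₁, s₂) * pU u * pX₁ u s₁ x₁ * ∑ x₂', if ch.z₂ x₂' s₂ = ch.z₂ x₂ s₂ then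
          pX₂ u s₂ x₂' else 0 := by
      rw [Finset.mul_sum]
      refine Finset.sum_congr rfl fun x₂' _ => ?_
      split_ifs
      · ring
      · simp
    have e4 : ∑ s₁', ∑ x₁', ∑ x₂', ch.pS (s₁', s₂) * pU u * pX₁ u s₁' x₁' * pX₂ u s₂ x₂' =
        pU u * ∑ s₁', ch.pS (s₁', s₂) := by
      simp only [← Finset.mul_sum, hs₂, mul_one, hs₁, ← Finset.sum_mul]
      ring
    rw [e1, e2, e3, e4]
    ring

/-- The third rate bound as an expectation. -/
lemma rateBound₃_eq (hU : ∀ u, 0 ≤ pU u) (h₁ : ∀ u s, pX₁ u s ∈ stdSimplex ℝ X₁)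
    (h₂ : ∀ u s, pX₂ u s ∈ stdSimplex ℝ X₂) :
    condMutualInfo (jointPMF ch pU pX₁ pX₂) (fun ω => (ω.2.2.2.1, ω.2.2.2.2.1))
        (fun ω => ω.2.2.2.2.2)
        (fun ω => (ω.1, ch.z₁ ω.2.2.2.1 ω.2.1, ch.z₂ ω.2.2.2.2.1 ω.2.2.1, ω.2.1, ω.2.2.1)) +
      condEntropy (jointPMF ch pU pX₁ pX₂)
        (fun ω => (ch.z₁ ω.2.2.2.1 ω.2.1, ch.z₂ ω.2.2.2.2.1 ω.2.2.1))
        (fun ω => (ω.1, ω.2.1, ω.2.2.1)) =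
    ∑ ω, jointPMF ch pU pX₁ pX₂ ω * Real.logb 2 (ch.W ω.2.2.2.1 ω.2.2.2.2.1 ω.2.1 ω.2.2.1
        ω.2.2.2.2.2 / cribDen ch (true, true) (pX₁ ω.1) (pX₂ ω.1) ω.2.1 ω.2.2.1 ω.2.2.2.1
        ω.2.2.2.2.1 ω.2.2.2.2.2) := by
  classical
  refine condMutualInfo_add_condEntropy (jointPMF_nonneg ch hU h₁ h₂) _ _ _ _ _ _ _ ?_ ?_
  · rintro ⟨u, s₁, s₂, x₁, x₂, y⟩ h0
    rw [law_eq_sum (ι := Unit) _ _ _ (fun _ => (u, s₁, s₂, x₁, x₂, y))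
        (by simp [Function.Injective])
        (fun _ => True) (by rintro ⟨u', s₁', s₂', x₁', x₂', y'⟩; simp; grind),
      law_eq_sum (ι := Y) _ _ _ (fun y => (u, s₁, s₂, x₁, x₂, y)) (by simp [Function.Injective])
        (fun _ => True) (by rintro ⟨u', s₁', s₂', x₁', x₂', y'⟩; simp; grind)]
    simp only [jointPMF, if_true, sum_mul_W, Finset.univ_unique, Finset.sum_singleton]
    ring
  · rintro ⟨u, s₁, s₂, x₁, x₂, y⟩ h0
    rw [law_eq_sum (ι := X₁ × X₂) _ _ _ (fun r => (u, s₁, s₂, r.1, r.2, y))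
        (by intro r r' h; grind)
        (fun r => ch.z₁ r.1 s₁ = ch.z₁ x₁ s₁ ∧ ch.z₂ r.2 s₂ = ch.z₂ x₂ s₂)
        (by rintro ⟨u', s₁', s₂', x₁', x₂', y'⟩; simp; grind),
      law_eq_sum (ι := X₁ × X₂ × Y) _ _ _ (fun r => (u, s₁, s₂, r.1, r.2.1, r.2.2))
        (by intro r r' h; grind)
        (fun r => ch.z₁ r.1 s₁ = ch.z₁ x₁ s₁ ∧ ch.z₂ r.2.1 s₂ = ch.z₂ x₂ s₂)
        (by rintro ⟨u', s₁', s₂', x₁', x₂', y'⟩; simp; grind),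
      law_eq_sum (ι := X₁ × X₂ × Y) _ _ _ (fun r => (u, s₁, s₂, r.1, r.2.1, r.2.2))
        (by intro r r' h; grind)
        (fun r => ch.z₁ r.1 s₁ = ch.z₁ x₁ s₁ ∧ ch.z₂ r.2.1 s₂ = ch.z₂ x₂ s₂)
        (by rintro ⟨u', s₁', s₂', x₁', x₂', y'⟩; simp; grind),
      law_eq_sum (ι := X₁ × X₂ × Y) _ _ _ (fun r => (u, s₁, s₂, r.1, r.2.1, r.2.2))
        (by intro r r' h; grind)
        (fun r => True)
        (by rintro ⟨u', s₁', s₂', x₁', x₂', y'⟩; simp; grind)]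
    simp only [jointPMF, if_true, sum_mul_W, Fintype.sum_prod_type]
    have hs₁ : ∀ u s, ∑ x, pX₁ u s x = 1 := fun u s => (h₁ u s).2
    have hs₂ : ∀ u s, ∑ x, pX₂ u s x = 1 := fun u s => (h₂ u s).2
    have e1 : (∑ x₁', ∑ x₂', if ch.z₁ x₁' s₁ = ch.z₁ x₁ s₁ ∧ ch.z₂ x₂' s₂ = ch.z₂ x₂ s₂ then
        ch.pS (s₁, s₂) * pU u * pX₁ u s₁ x₁' * pX₂ u s₂ x₂' * ch.W x₁' x₂' s₁ s₂ y else 0) =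
        ch.pS (s₁, s₂) * pU u * cribDen ch (true, true) (pX₁ u) (pX₂ u) s₁ s₂ x₁ x₂ y := by
      simp only [cribDen, cribLaw, Finset.mul_sum]
      refine Finset.sum_congr rfl fun x₁' _ => Finset.sum_congr rfl fun x₂' _ => ?_
      split_ifs
      · simp [kern]
        ring
      · simp
    have e2 : ∑ x₁', ∑ x₂', ch.pS (s₁, s₂) * pU u * pX₁ u s₁ x₁' * pX₂ u s₂ x₂' =
        ch.pS (s₁, s₂) * pU u := by
      simp only [← Finset.mul_sum, hs₂, mul_one, hs₁]
    rw [e1, e2]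
    ring

/-- The fourth rate bound as an expectation. -/
lemma rateBound₄_eq (hU : ∀ u, 0 ≤ pU u) (h₁ : ∀ u s, pX₁ u s ∈ stdSimplex ℝ X₁)
    (h₂ : ∀ u s, pX₂ u s ∈ stdSimplex ℝ X₂) (hU1 : ∑ u, pU u = 1) :
    condMutualInfo (jointPMF ch pU pX₁ pX₂) (fun ω => (ω.2.2.2.1, ω.2.2.2.2.1))
        (fun ω => ω.2.2.2.2.2) (fun ω => (ω.2.1, ω.2.2.1)) =
    ∑ ω, jointPMF ch pU pX₁ pX₂ ω * Real.logb 2 (ch.W ω.2.2.2.1 ω.2.2.2.2.1 ω.2.1 ω.2.2.1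
        ω.2.2.2.2.2 / outLaw ch pU pX₁ pX₂ ω.2.1 ω.2.2.1 ω.2.2.2.2.2) := by
  classical
  refine condMutualInfo_eq_sum (jointPMF_nonneg ch hU h₁ h₂) _ _ _ _ _ ?_ ?_
  · rintro ⟨u, s₁, s₂, x₁, x₂, y⟩ h0
    rw [law_eq_sum (ι := U) _ _ _ (fun u => (u, s₁, s₂, x₁, x₂, y)) (by simp [Function.Injective])
        (fun _ => True) (by rintro ⟨u', s₁', s₂', x₁', x₂', y'⟩; simp; grind),
      law_eq_sum (ι := U × Y) _ _ _ (fun r => (r.1, s₁, s₂, x₁, x₂, r.2))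
        (by intro r r' h; grind)
        (fun _ => True) (by rintro ⟨u', s₁', s₂', x₁', x₂', y'⟩; simp; grind)]
    simp only [jointPMF, if_true, sum_mul_W, Fintype.sum_prod_type, Finset.mul_sum]
    exact Finset.sum_congr rfl fun u _ => by ring
  · rintro ⟨u, s₁, s₂, x₁, x₂, y⟩ h0
    rw [law_eq_sum (ι := U × X₁ × X₂) _ _ _ (fun r => (r.1, s₁, s₂, r.2.1, r.2.2, y))
        (by intro r r' h; grind)
        (fun r => True)
        (by rintro ⟨u', s₁', s₂', x₁', x₂', y'⟩; simp; grind),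
      law_eq_sum (ι := U × X₁ × X₂ × Y) _ _ _ (fun r => (r.1, s₁, s₂, r.2.1, r.2.2.1, r.2.2.2))
        (by intro r r' h; grind)
        (fun r => True)
        (by rintro ⟨u', s₁', s₂', x₁', x₂', y'⟩; simp; grind)]
    simp only [jointPMF, if_true, sum_mul_W, Fintype.sum_prod_type]
    have hs₁ : ∀ u s, ∑ x, pX₁ u s x = 1 := fun u s => (h₁ u s).2
    have hs₂ : ∀ u s, ∑ x, pX₂ u s x = 1 := fun u s => (h₂ u s).2
    simp only [← Finset.mul_sum, hs₁, hs₂, mul_one, hU1, outLaw]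
    simp only [Finset.sum_mul]
    exact Finset.sum_congr rfl fun u _ => Finset.sum_congr rfl fun x₁ _ =>
      Finset.sum_congr rfl fun x₂ _ => by ring

/-- The reference law is formed for each value of U separately, so these bounds are linear in `pU`;
the support reduction relies on this. -/
lemma sum_jointPMF_eq_cribInfo (c : Bool × Bool) :
    ∑ ω, jointPMF ch pU pX₁ pX₂ ω * Real.logb 2 (ch.W ω.2.2.2.1 ω.2.2.2.2.1 ω.2.1 ω.2.2.1
        ω.2.2.2.2.2 / cribDen ch c (pX₁ ω.1) (pX₂ ω.1) ω.2.1 ω.2.2.1 ω.2.2.2.1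
        ω.2.2.2.2.1 ω.2.2.2.2.2) = ∑ u, pU u * cribInfo ch c (pX₁ u) (pX₂ u) := by
  rw [sum_jointPMF_mul]
  simp only [cribInfo, Finset.mul_sum]
  refine Finset.sum_congr rfl fun u _ => Finset.sum_congr rfl fun s₁ _ =>
    Finset.sum_congr rfl fun s₂ _ => Finset.sum_congr rfl fun x₁ _ =>
    Finset.sum_congr rfl fun x₂ _ => Finset.sum_congr rfl fun y _ => by ring

/-- The rate bounds, with the information quantities written as expectations. -/
lemma rateBounds_iff (hU : pU ∈ stdSimplex ℝ U) (h₁ : ∀ u s, pX₁ u s ∈ stdSimplex ℝ X₁)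
    (h₂ : ∀ u s, pX₂ u s ∈ stdSimplex ℝ X₂) (R₁ R₂ : ℝ) :
    RateBounds ch pU pX₁ pX₂ R₁ R₂ ↔
      R₁ ≤ ∑ u, pU u * cribInfo ch (true, false) (pX₁ u) (pX₂ u) ∧
      R₂ ≤ ∑ u, pU u * cribInfo ch (false, true) (pX₁ u) (pX₂ u) ∧
      R₁ + R₂ ≤ ∑ u, pU u * cribInfo ch (true, true) (pX₁ u) (pX₂ u) ∧
      R₁ + R₂ ≤ outInfo ch pU pX₁ pX₂ := by
  have e1 := rateBound₁_eq ch hU.1 h₁ h₂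
  have e2 := rateBound₂_eq ch hU.1 h₁ h₂
  have e3 := rateBound₃_eq ch hU.1 h₁ h₂
  have e4 := rateBound₄_eq ch hU.1 h₁ h₂ hU.2
  rw [sum_jointPMF_eq_cribInfo] at e1 e2 e3
  rw [sum_jointPMF_mul] at e4
  rw [← e1, ← e2, ← e3, outInfo, ← e4]
  rfl

end RateBoundsForms

end CribMAC
end

noncomputable section
namespace CribMAC

set_option linter.unusedSectionVars false

/-! ### The size of the auxiliary alphabet -/

section Cardinality

variable {S₁ S₂ X₁ X₂ Y Z₁ Z₂ U : Type*} [Fintype S₁] [Fintype S₂] [Fintype X₁] [Fintype X₂]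
  [Fintype Y] [Fintype Z₁] [Fintype Z₂] [Fintype U]
  (ch : Channel S₁ S₂ X₁ X₂ Y Z₁ Z₂) {pU : U → ℝ} {pX₁ : U → S₁ → X₁ → ℝ}
  {pX₂ : U → S₂ → X₂ → ℝ}

lemma sum_comm_last {α β γ δ M : Type*} [Fintype α] [Fintype β] [Fintype γ] [Fintype δ]
    [AddCommMonoid M] (f : α → β → γ → δ → M) :
    ∑ a, ∑ b, ∑ c, ∑ d, f a b c d = ∑ d, ∑ a, ∑ b, ∑ c, f a b c d := by
  symm
  rw [Finset.sum_comm]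
  refine Finset.sum_congr rfl fun a _ => ?_
  rw [Finset.sum_comm]
  refine Finset.sum_congr rfl fun b _ => ?_
  rw [Finset.sum_comm]

/-- Separates the part linear in `pU` from the output entropy, which depends on `pU` only through
the output law. If the output law is preserved, the linear part can serve as the objective of the
support reduction. -/
lemma outInfo_eq_sub (hU : ∀ u, 0 ≤ pU u) (h₁ : ∀ u s, pX₁ u s ∈ stdSimplex ℝ X₁)
    (h₂ : ∀ u s, pX₂ u s ∈ stdSimplex ℝ X₂) :
    outInfo ch pU pX₁ pX₂ = ∑ u, pU u * (∑ s₁, ∑ s₂, ∑ x₁, ∑ x₂, ∑ y, ch.pS (s₁, s₂) *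
        pX₁ u s₁ x₁ * pX₂ u s₂ x₂ * ch.W x₁ x₂ s₁ s₂ y * Real.logb 2 (ch.W x₁ x₂ s₁ s₂ y)) -
      ∑ s₁, ∑ s₂, ∑ y, ch.pS (s₁, s₂) * outLaw ch pU pX₁ pX₂ s₁ s₂ y *
        Real.logb 2 (outLaw ch pU pX₁ pX₂ s₁ s₂ y) := by
  have hsplit : outInfo ch pU pX₁ pX₂ = ∑ u, ∑ s₁, ∑ s₂, ∑ x₁, ∑ x₂, ∑ y,
      (pU u * (ch.pS (s₁, s₂) * pX₁ u s₁ x₁ * pX₂ u s₂ x₂ * ch.W x₁ x₂ s₁ s₂ y *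
        Real.logb 2 (ch.W x₁ x₂ s₁ s₂ y)) -
      ch.pS (s₁, s₂) * (pU u * pX₁ u s₁ x₁ * pX₂ u s₂ x₂ * ch.W x₁ x₂ s₁ s₂ y) *
        Real.logb 2 (outLaw ch pU pX₁ pX₂ s₁ s₂ y)) := by
    unfold outInfo
    refine Finset.sum_congr rfl fun u _ => Finset.sum_congr rfl fun s₁ _ =>
      Finset.sum_congr rfl fun s₂ _ => Finset.sum_congr rfl fun x₁ _ =>
      Finset.sum_congr rfl fun x₂ _ => Finset.sum_congr rfl fun y _ => ?_
    by_cases h0 : jointPMF ch pU pX₁ pX₂ (u, s₁, s₂, x₁, x₂, y) = 0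
    · simp only [jointPMF] at h0
      have e1 : pU u * (ch.pS (s₁, s₂) * pX₁ u s₁ x₁ * pX₂ u s₂ x₂ * ch.W x₁ x₂ s₁ s₂ y *
        Real.logb 2 (ch.W x₁ x₂ s₁ s₂ y)) = ch.pS (s₁, s₂) * pU u * pX₁ u s₁ x₁ * pX₂ u s₂ x₂ *
          ch.W x₁ x₂ s₁ s₂ y * Real.logb 2 (ch.W x₁ x₂ s₁ s₂ y) := by ring
      have e2 : ch.pS (s₁, s₂) * (pU u * pX₁ u s₁ x₁ * pX₂ u s₂ x₂ * ch.W x₁ x₂ s₁ s₂ y) =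
        ch.pS (s₁, s₂) * pU u * pX₁ u s₁ x₁ * pX₂ u s₂ x₂ * ch.W x₁ x₂ s₁ s₂ y := by ring
      rw [e1, e2, h0]
      ring
    · obtain ⟨_, hu, h1, h2, hw⟩ := pos_of_jointPMF_ne_zero ch hU h₁ h₂ h0
      have := outLaw_pos ch hU (fun u s => (h₁ u s).1) (fun u s => (h₂ u s).1)
        (mul_pos (mul_pos (mul_pos hu h1) h2) hw)
      rw [Real.logb_div hw.ne' this.ne']
      ring
  rw [hsplit]
  simp only [Finset.sum_sub_distrib]
  refine congrArg₂ (· - ·) ?_ ?_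
  · simp only [Finset.mul_sum]
  · rw [Finset.sum_comm]
    refine Finset.sum_congr rfl fun s₁ _ => ?_
    rw [Finset.sum_comm]
    refine Finset.sum_congr rfl fun s₂ _ => ?_
    rw [sum_comm_last]
    refine Finset.sum_congr rfl fun y _ => ?_
    simp only [← Finset.sum_mul, ← Finset.mul_sum]
    simp only [outLaw]

/-- The fourth bound sees U only through the law of the inputs given the states, so it is unchanged
whenever that law is preserved. -/
lemma outInfo_eq_of_inputLaw :
    outInfo ch pU pX₁ pX₂ = ∑ s₁, ∑ s₂, ∑ x₁, ∑ x₂, ∑ y, ch.pS (s₁, s₂) *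
      (∑ u, pU u * (pX₁ u s₁ x₁ * pX₂ u s₂ x₂)) * ch.W x₁ x₂ s₁ s₂ y *
      Real.logb 2 (ch.W x₁ x₂ s₁ s₂ y / ∑ x₁, ∑ x₂, (∑ u, pU u * (pX₁ u s₁ x₁ * pX₂ u s₂ x₂)) *
        ch.W x₁ x₂ s₁ s₂ y) := by
  have hq : ∀ s₁ s₂ y, outLaw ch pU pX₁ pX₂ s₁ s₂ y =
      ∑ x₁, ∑ x₂, (∑ u, pU u * (pX₁ u s₁ x₁ * pX₂ u s₂ x₂)) * ch.W x₁ x₂ s₁ s₂ y := by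
    intro s₁ s₂ y
    rw [outLaw, Finset.sum_comm]
    refine Finset.sum_congr rfl fun x₁ _ => ?_
    rw [Finset.sum_comm]
    refine Finset.sum_congr rfl fun x₂ _ => ?_
    rw [Finset.sum_mul]
    exact Finset.sum_congr rfl fun u _ => by ring
  simp only [← hq]
  rw [outInfo, Finset.sum_comm]
  refine Finset.sum_congr rfl fun s₁ _ => ?_
  rw [Finset.sum_comm]
  refine Finset.sum_congr rfl fun s₂ _ => ?_
  rw [Finset.sum_comm]
  refine Finset.sum_congr rfl fun x₁ _ => ?_
  rw [Finset.sum_comm]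
  refine Finset.sum_congr rfl fun x₂ _ => ?_
  rw [Finset.sum_comm]
  refine Finset.sum_congr rfl fun y _ => ?_
  rw [Finset.mul_sum, Finset.sum_mul, Finset.sum_mul]
  exact Finset.sum_congr rfl fun u _ => by ring

/-- Restricting the auxiliary variable to its support. -/
lemma exists_fin_of_support {R₁ R₂ : ℝ} {N : ℕ} (hU : pU ∈ stdSimplex ℝ U)
    (h₁ : ∀ u s, pX₁ u s ∈ stdSimplex ℝ X₁) (h₂ : ∀ u s, pX₂ u s ∈ stdSimplex ℝ X₂)
    (h : RateBounds ch pU pX₁ pX₂ R₁ R₂)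
    (hN : (Finset.univ.filter fun u => pU u ≠ 0).card ≤ N) :
    ∃ k : ℕ, k ≤ N ∧ ∃ pU : Fin k → ℝ, pU ∈ stdSimplex ℝ (Fin k) ∧
      ∃ pX₁ : Fin k → S₁ → X₁ → ℝ, (∀ u s₁, pX₁ u s₁ ∈ stdSimplex ℝ X₁) ∧
      ∃ pX₂ : Fin k → S₂ → X₂ → ℝ, (∀ u s₂, pX₂ u s₂ ∈ stdSimplex ℝ X₂) ∧
        RateBounds ch pU pX₁ pX₂ R₁ R₂ := by
  set T := Finset.univ.filter fun u => pU u ≠ 0 with hT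
  let e := T.equivFin.symm
  have hsum : ∀ f : U → ℝ, ∑ i, pU (e i) * f (e i) = ∑ u, pU u * f u := by
    intro f
    rw [Equiv.sum_comp e (fun u : T => pU u * f u), Finset.sum_coe_sort T (fun u => pU u * f u)]
    refine Finset.sum_subset (Finset.subset_univ _) fun u _ hu => ?_
    have : pU u = 0 := by simpa [T] using hu
    simp [this]
  have hU' : (fun i => pU (e i)) ∈ stdSimplex ℝ (Fin T.card) := by
    refine ⟨fun i => hU.1 _, ?_⟩
    have := hsum fun _ => 1
    simpa [hU.2] using this
  refine ⟨T.card, hN, fun i => pU (e i), hU', fun i => pX₁ (e i), fun i => h₁ _,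
    fun i => pX₂ (e i), fun i => h₂ _, ?_⟩
  rw [rateBounds_iff ch hU h₁ h₂] at h
  rw [rateBounds_iff ch hU' (fun i => h₁ _) (fun i => h₂ _)]
  -- In this form all four bounds depend on `pU` only through expectations over U, which do not
  -- notice points of mass zero.
  rw [outInfo_eq_of_inputLaw] at h ⊢
  have hc : ∀ c, ∑ i, pU (e i) * cribInfo ch c (pX₁ (e i)) (pX₂ (e i)) =
      ∑ u, pU u * cribInfo ch c (pX₁ u) (pX₂ u) :=
    fun c => hsum fun u => cribInfo ch c (pX₁ u) (pX₂ u)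
  have hx : ∀ s₁ s₂ x₁ x₂, ∑ i, pU (e i) * (pX₁ (e i) s₁ x₁ * pX₂ (e i) s₂ x₂) =
      ∑ u, pU u * (pX₁ u s₁ x₁ * pX₂ u s₂ x₂) :=
    fun s₁ s₂ x₁ x₂ => hsum fun u => pX₁ u s₁ x₁ * pX₂ u s₂ x₂
  simp only [hc, hx]
  exact h

/-- Summing out the last coordinate of a conditional law from the others. -/
lemma eq_of_eq_off {α : Type*} [Fintype α] {f g : α → ℝ} (hfg : ∑ x, f x = ∑ x, g x) (x₀ : α)
    (h : ∀ x, x ≠ x₀ → f x = g x) (x : α) : f x = g x := by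
  classical
  by_cases hx : x = x₀
  · subst hx
    rw [← Finset.add_sum_erase _ _ (Finset.mem_univ x),
      ← Finset.add_sum_erase _ g (Finset.mem_univ x),
      Finset.sum_congr rfl fun y hy => h y (Finset.ne_of_mem_erase hy)] at hfg
    exact add_right_cancel hfg
  · exact h x hx

lemma sum_outLaw (h₁ : ∀ u s, pX₁ u s ∈ stdSimplex ℝ X₁)
    (h₂ : ∀ u s, pX₂ u s ∈ stdSimplex ℝ X₂) (s₁ : S₁) (s₂ : S₂) :
    ∑ y, outLaw ch pU pX₁ pX₂ s₁ s₂ y = ∑ u, pU u := by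
  unfold outLaw
  rw [← sum_comm_last]
  simp only [sum_mul_W]
  refine Finset.sum_congr rfl fun u _ => ?_
  simp only [← Finset.mul_sum, (h₂ u s₂).2, (h₁ u s₁).2, mul_one]

/-- Preserved are the output probabilities, |Y| − 1 for each state pair, and the three averages of
`cribInfo`; the linear part of `outInfo` is the objective. The fourth extra point of the support is
due to the total mass. -/
lemma exists_fin_card_output [Nonempty Y] {R₁ R₂ : ℝ} (hU : pU ∈ stdSimplex ℝ U)
    (h₁ : ∀ u s, pX₁ u s ∈ stdSimplex ℝ X₁) (h₂ : ∀ u s, pX₂ u s ∈ stdSimplex ℝ X₂)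
    (h : RateBounds ch pU pX₁ pX₂ R₁ R₂) :
    ∃ k : ℕ, k ≤ Fintype.card S₁ * Fintype.card S₂ * (Fintype.card Y - 1) + 4 ∧
      ∃ pU : Fin k → ℝ, pU ∈ stdSimplex ℝ (Fin k) ∧
      ∃ pX₁ : Fin k → S₁ → X₁ → ℝ, (∀ u s₁, pX₁ u s₁ ∈ stdSimplex ℝ X₁) ∧
      ∃ pX₂ : Fin k → S₂ → X₂ → ℝ, (∀ u s₂, pX₂ u s₂ ∈ stdSimplex ℝ X₂) ∧
        RateBounds ch pU pX₁ pX₂ R₁ R₂ := by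
  classical
  obtain ⟨y₀⟩ := ‹Nonempty Y›
  let L : (S₁ × S₂ × {y : Y // y ≠ y₀}) ⊕ Fin 3 → U → ℝ := Sum.elim
    (fun r u => ∑ x₁, ∑ x₂, pX₁ u r.1 x₁ * pX₂ u r.2.1 x₂ * ch.W x₁ x₂ r.1 r.2.1 r.2.2)
    ![fun u => cribInfo ch (true, false) (pX₁ u) (pX₂ u),
      fun u => cribInfo ch (false, true) (pX₁ u) (pX₂ u),
      fun u => cribInfo ch (true, true) (pX₁ u) (pX₂ u)]
  obtain ⟨w, hw0, hw1, hL, ho, hcard⟩ := exists_small_support L (fun u => ∑ s₁, ∑ s₂, ∑ x₁, ∑ x₂,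
    ∑ y, ch.pS (s₁, s₂) * pX₁ u s₁ x₁ * pX₂ u s₂ x₂ * ch.W x₁ x₂ s₁ s₂ y *
      Real.logb 2 (ch.W x₁ x₂ s₁ s₂ y)) pU hU.1
  have hw : w ∈ stdSimplex ℝ U := ⟨hw0, by rw [hw1, hU.2]⟩
  have hq : ∀ s₁ s₂ y, outLaw ch w pX₁ pX₂ s₁ s₂ y = outLaw ch pU pX₁ pX₂ s₁ s₂ y := by
    intro s₁ s₂
    -- The probability of the omitted letter `y₀` is determined by the others and the total mass.
    refine eq_of_eq_off (by rw [sum_outLaw ch h₁ h₂, sum_outLaw ch h₁ h₂, hw1]) y₀ fun y hy => ?_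
    have := hL (Sum.inl (s₁, s₂, ⟨y, hy⟩))
    simpa only [outLaw, L, Sum.elim_inl, Finset.mul_sum, ← mul_assoc] using this
  refine exists_fin_of_support ch hw h₁ h₂ (R₁ := R₁) (R₂ := R₂) ?_ (hcard.trans (le_of_eq ?_))
  · rw [rateBounds_iff ch hU h₁ h₂, outInfo_eq_sub ch hU.1 h₁ h₂] at h
    rw [rateBounds_iff ch hw h₁ h₂, outInfo_eq_sub ch hw.1 h₁ h₂]
    simp only [hq]
    have e0 := hL (Sum.inr 0)
    have e1 := hL (Sum.inr 1)
    have e2 := hL (Sum.inr 2)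
    simp only [L, Sum.elim_inr, Matrix.cons_val] at e0 e1 e2
    rw [e0, e1, e2]
    exact ⟨h.1, h.2.1, h.2.2.1, h.2.2.2.trans (sub_le_sub_right ho _)⟩
  · simp [Fintype.card_subtype_compl, mul_assoc]

/-- Preserving the whole input law fixes the fourth bound. Two averages of `cribInfo` are preserved
as well and the third is the objective; with the total mass this gives the constant 3. -/
lemma exists_fin_card_input [Nonempty X₁] [Nonempty X₂] {R₁ R₂ : ℝ} (hU : pU ∈ stdSimplex ℝ U)
    (h₁ : ∀ u s, pX₁ u s ∈ stdSimplex ℝ X₁) (h₂ : ∀ u s, pX₂ u s ∈ stdSimplex ℝ X₂)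
    (h : RateBounds ch pU pX₁ pX₂ R₁ R₂) :
    ∃ k : ℕ, k ≤ Fintype.card S₁ * Fintype.card S₂ *
        (Fintype.card X₁ * Fintype.card X₂ - 1) + 3 ∧
      ∃ pU : Fin k → ℝ, pU ∈ stdSimplex ℝ (Fin k) ∧
      ∃ pX₁ : Fin k → S₁ → X₁ → ℝ, (∀ u s₁, pX₁ u s₁ ∈ stdSimplex ℝ X₁) ∧
      ∃ pX₂ : Fin k → S₂ → X₂ → ℝ, (∀ u s₂, pX₂ u s₂ ∈ stdSimplex ℝ X₂) ∧
        RateBounds ch pU pX₁ pX₂ R₁ R₂ := by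
  classical
  obtain ⟨x₀⟩ := (inferInstance : Nonempty (X₁ × X₂))
  let L : (S₁ × S₂ × {x : X₁ × X₂ // x ≠ x₀}) ⊕ Fin 2 → U → ℝ := Sum.elim
    (fun r u => pX₁ u r.1 r.2.2.1.1 * pX₂ u r.2.1 r.2.2.1.2)
    ![fun u => cribInfo ch (true, false) (pX₁ u) (pX₂ u),
      fun u => cribInfo ch (false, true) (pX₁ u) (pX₂ u)]
  obtain ⟨w, hw0, hw1, hL, ho, hcard⟩ := exists_small_support L
    (fun u => cribInfo ch (true, true) (pX₁ u) (pX₂ u)) pU hU.1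
  have hw : w ∈ stdSimplex ℝ U := ⟨hw0, by rw [hw1, hU.2]⟩
  have hsum : ∀ (w : U → ℝ) s₁ s₂, ∑ x : X₁ × X₂, ∑ u, w u * (pX₁ u s₁ x.1 * pX₂ u s₂ x.2) =
      ∑ u, w u := by
    intro w s₁ s₂
    rw [Finset.sum_comm]
    refine Finset.sum_congr rfl fun u _ => ?_
    rw [Fintype.sum_prod_type]
    simp only [← Finset.mul_sum, (h₂ u s₂).2, (h₁ u s₁).2, mul_one]
  have hq : ∀ s₁ s₂ (x : X₁ × X₂), ∑ u, w u * (pX₁ u s₁ x.1 * pX₂ u s₂ x.2) =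
      ∑ u, pU u * (pX₁ u s₁ x.1 * pX₂ u s₂ x.2) := by
    intro s₁ s₂
    refine eq_of_eq_off (by rw [hsum, hsum, hw1]) x₀ fun x hx => ?_
    exact hL (Sum.inl (s₁, s₂, ⟨x, hx⟩))
  have hq' : ∀ s₁ s₂ x₁ x₂, ∑ u, w u * (pX₁ u s₁ x₁ * pX₂ u s₂ x₂) =
      ∑ u, pU u * (pX₁ u s₁ x₁ * pX₂ u s₂ x₂) := fun s₁ s₂ x₁ x₂ => hq s₁ s₂ (x₁, x₂)
  refine exists_fin_of_support ch hw h₁ h₂ (R₁ := R₁) (R₂ := R₂) ?_ (hcard.trans (le_of_eq ?_))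
  · rw [rateBounds_iff ch hU h₁ h₂, outInfo_eq_of_inputLaw ch] at h
    rw [rateBounds_iff ch hw h₁ h₂, outInfo_eq_of_inputLaw ch]
    simp only [hq']
    have e0 := hL (Sum.inr 0)
    have e1 := hL (Sum.inr 1)
    simp only [L, Sum.elim_inr, Matrix.cons_val] at e0 e1
    rw [e0, e1]
    exact ⟨h.1, h.2.1, h.2.2.1.trans ho, h.2.2.2⟩
  · simp [Fintype.card_subtype_compl, mul_assoc]

lemma nonempty_of_channel (ch : Channel S₁ S₂ X₁ X₂ Y Z₁ Z₂) : Nonempty S₁ ∧ Nonempty S₂ := by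
  by_contra hcon
  have : IsEmpty (S₁ × S₂) := by
    rw [← not_nonempty_iff, nonempty_prod]
    exact hcon
  have := ch.pS_mem.2
  simp at this

/-- The reduction that preserves the output law singles out a reference letter of `Y`, so one must
exist. -/
lemma nonempty_output (ch : Channel S₁ S₂ X₁ X₂ Y Z₁ Z₂) [Nonempty X₁] [Nonempty X₂] :
    Nonempty Y := by
  obtain ⟨⟨s₁⟩, ⟨s₂⟩⟩ := nonempty_of_channel ch
  by_contra hcon
  rw [not_nonempty_iff] at hcon
  have := (ch.W_mem (Classical.arbitrary X₁) (Classical.arbitrary X₂) s₁ s₂).2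
  simp at this

/-- The cardinality bound on the auxiliary alphabet. -/
lemma exists_fin_of_rateBounds [Nonempty X₁] [Nonempty X₂] {R₁ R₂ : ℝ}
    (hU : pU ∈ stdSimplex ℝ U)
    (h₁ : ∀ u s, pX₁ u s ∈ stdSimplex ℝ X₁) (h₂ : ∀ u s, pX₂ u s ∈ stdSimplex ℝ X₂)
    (h : RateBounds ch pU pX₁ pX₂ R₁ R₂) :
    ∃ k : ℕ, k ≤ min
        (Fintype.card S₁ * Fintype.card S₂ * (Fintype.card Y - 1) + 4)
        (Fintype.card S₁ * Fintype.card S₂ * (Fintype.card X₁ * Fintype.card X₂ - 1) + 3) ∧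
      ∃ pU : Fin k → ℝ, pU ∈ stdSimplex ℝ (Fin k) ∧
      ∃ pX₁ : Fin k → S₁ → X₁ → ℝ, (∀ u s₁, pX₁ u s₁ ∈ stdSimplex ℝ X₁) ∧
      ∃ pX₂ : Fin k → S₂ → X₂ → ℝ, (∀ u s₂, pX₂ u s₂ ∈ stdSimplex ℝ X₂) ∧
        RateBounds ch pU pX₁ pX₂ R₁ R₂ := by
  have := nonempty_output ch
  rcases min_choice (Fintype.card S₁ * Fintype.card S₂ * (Fintype.card Y - 1) + 4)
    (Fintype.card S₁ * Fintype.card S₂ * (Fintype.card X₁ * Fintype.card X₂ - 1) + 3) with hm | hm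
  · rw [hm]
    exact exists_fin_card_output ch hU h₁ h₂ h
  · rw [hm]
    exact exists_fin_card_input ch hU h₁ h₂ h

end Cardinality

/-! ### Closedness of the region for a fixed auxiliary alphabet -/

section Closedness

variable {S₁ S₂ X₁ X₂ Y Z₁ Z₂ U : Type*} [Fintype S₁] [Fintype S₂] [Fintype X₁] [Fintype X₂]
  [Fintype Y] [Fintype Z₁] [Fintype Z₂] [Fintype U]
  (ch : Channel S₁ S₂ X₁ X₂ Y Z₁ Z₂)

lemma continuous_condEntropy {P Ω α β : Type*} [TopologicalSpace P] [Fintype Ω] [Fintype α]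
    [Fintype β] (p : P → Ω → ℝ) (hp : ∀ t ω, 0 ≤ p t ω) (hc : ∀ ω, Continuous fun t => p t ω)
    (A : Ω → α) (B : Ω → β) : Continuous fun t => condEntropy (p t) A B := by
  classical
  simp only [condEntropy_eq_negMulLog (hp _)]
  have hlaw : ∀ {γ : Type _} (T : Ω → γ) (c : γ), Continuous fun t => law (p t) T c := by
    intro γ T c
    refine continuous_finsetSum _ fun ω _ => ?_
    split_ifs
    · exact hc ω
    · exact continuous_const
  -- Same claim as `hlaw`, which is local and hence fixed to one universe, whereas `α × β` and `β`
  -- may live in different ones.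
  have hlaw' : ∀ (T : Ω → β) (c : β), Continuous fun t => law (p t) T c := by
    intro T c
    refine continuous_finsetSum _ fun ω _ => ?_
    split_ifs
    · exact hc ω
    · exact continuous_const
  exact ((continuous_finsetSum _ fun c _ => Real.continuous_negMulLog.comp (hlaw _ c)).sub
    (continuous_finsetSum _ fun c _ => Real.continuous_negMulLog.comp (hlaw' _ c))).div_const _

variable (U) in
/-- The pairs satisfying the rate bounds for some input laws with auxiliary alphabet `U` form a
closed set. -/
lemma isClosed_rateBounds :
    IsClosed {R : ℝ × ℝ | ∃ pU : U → ℝ, pU ∈ stdSimplex ℝ U ∧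
      ∃ pX₁ : U → S₁ → X₁ → ℝ, (∀ u s₁, pX₁ u s₁ ∈ stdSimplex ℝ X₁) ∧
      ∃ pX₂ : U → S₂ → X₂ → ℝ, (∀ u s₂, pX₂ u s₂ ∈ stdSimplex ℝ X₂) ∧
        RateBounds ch pU pX₁ pX₂ R.1 R.2} := by
  let K := stdSimplex ℝ U × (U → S₁ → stdSimplex ℝ X₁) × (U → S₂ → stdSimplex ℝ X₂)
  let p : K → U × S₁ × S₂ × X₁ × X₂ × Y → ℝ := fun t =>
    jointPMF ch t.1 (fun u s => t.2.1 u s) (fun u s => t.2.2 u s)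
  have hp : ∀ t ω, 0 ≤ p t ω := fun t ω =>
    jointPMF_nonneg ch t.1.2.1 (fun u s => (t.2.1 u s).2) (fun u s => (t.2.2 u s).2) ω
  have hc : ∀ ω, Continuous fun t => p t ω := by
    rintro ⟨u, s₁, s₂, x₁, x₂, y⟩
    simp only [p, jointPMF]
    have c0 : Continuous fun t : K => (t.1 : U → ℝ) u :=
      (continuous_apply u).comp (continuous_subtype_val.comp continuous_fst)
    have c1 : Continuous fun t : K => (t.2.1 u s₁ : X₁ → ℝ) x₁ :=
      (continuous_apply x₁).comp (continuous_subtype_val.comp ((continuous_apply s₁).comp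
        ((continuous_apply u).comp (continuous_fst.comp continuous_snd))))
    have c2 : Continuous fun t : K => (t.2.2 u s₂ : X₂ → ℝ) x₂ :=
      (continuous_apply x₂).comp (continuous_subtype_val.comp ((continuous_apply s₂).comp
        ((continuous_apply u).comp (continuous_snd.comp continuous_snd))))
    exact (((continuous_const.mul c0).mul c1).mul c2).mul continuous_const
  have hclosed : IsClosed {r : K × (ℝ × ℝ) | RateBounds ch r.1.1 (fun u s => r.1.2.1 u s)
      (fun u s => r.1.2.2 u s) r.2.1 r.2.2} := by
    have hle : ∀ {f g : K × (ℝ × ℝ) → ℝ}, Continuous f → Continuous g →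
        IsClosed {r | f r ≤ g r} := fun hf hg => isClosed_le hf hg
    have r1 : Continuous fun r : K × (ℝ × ℝ) => r.2.1 := continuous_fst.comp continuous_snd
    have r2 : Continuous fun r : K × (ℝ × ℝ) => r.2.2 := continuous_snd.comp continuous_snd
    simp only [RateBounds, condMutualInfo, Set.ofPred_and]
    refine (hle r1 ?_).inter ((hle r2 ?_).inter ((hle (r1.add r2) ?_).inter
      (hle (r1.add r2) ?_)))
    · exact (((continuous_condEntropy p hp hc _ _).sub (continuous_condEntropy p hp hc _ _)).add
        (continuous_condEntropy p hp hc _ _)).comp continuous_fst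
    · exact (((continuous_condEntropy p hp hc _ _).sub (continuous_condEntropy p hp hc _ _)).add
        (continuous_condEntropy p hp hc _ _)).comp continuous_fst
    · exact (((continuous_condEntropy p hp hc _ _).sub (continuous_condEntropy p hp hc _ _)).add
        (continuous_condEntropy p hp hc _ _)).comp continuous_fst
    · exact ((continuous_condEntropy p hp hc _ _).sub (continuous_condEntropy p hp hc _ _)).comp
        continuous_fst
  -- The region is the projection of the closed set `hclosed` along the compact space of input laws,
  -- and such a projection is a closed map.
  have : CompactSpace (stdSimplex ℝ U) := isCompact_iff_compactSpace.1 (isCompact_stdSimplex ℝ U)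
  have : CompactSpace (stdSimplex ℝ X₁) := isCompact_iff_compactSpace.1 (isCompact_stdSimplex ℝ X₁)
  have : CompactSpace (stdSimplex ℝ X₂) := isCompact_iff_compactSpace.1 (isCompact_stdSimplex ℝ X₂)
  convert isClosedMap_snd_of_compactSpace _ hclosed using 1
  ext R
  constructor
  · rintro ⟨pU, hU, pX₁, h₁, pX₂, h₂, h⟩
    exact ⟨((⟨pU, hU⟩, fun u s => ⟨pX₁ u s, h₁ u s⟩, fun u s => ⟨pX₂ u s, h₂ u s⟩), R), h, rfl⟩
  · rintro ⟨⟨t, R'⟩, h, rfl⟩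
    exact ⟨_, t.1.2, _, fun u s => (t.2.1 u s).2, _, fun u s => (t.2.2 u s).2, h⟩

end Closedness

end CribMAC
end

noncomputable section
namespace CribMAC

set_option linter.unusedSectionVars false

/-! ### Converse: paths of a code and compatible messages -/

section Paths

variable {S₁ S₂ X₁ X₂ Y Z₁ Z₂ : Type*} [Fintype S₁] [Fintype S₂] [Fintype X₁] [Fintype X₂]
  [Fintype Y] [Fintype Z₁] [Fintype Z₂]
  (ch : Channel S₁ S₂ X₁ X₂ Y Z₁ Z₂) {n M₁ M₂ : ℕ} (c : Code S₁ S₂ X₁ X₂ Y Z₁ Z₂ n M₁ M₂)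

/-- The channel inputs for a message pair and a sequence of state pairs. -/
def pathIn (m : Fin M₁ × Fin M₂) (s : Fin n → S₁ × S₂) (i : Fin n) : X₁ × X₂ :=
  inputs ch c m.1 m.2 (fun j => (s j).1) (fun j => (s j).2) i

/-- The cribbed signals for a message pair and a sequence of state pairs. -/
def pathCrib (m : Fin M₁ × Fin M₂) (s : Fin n → S₁ × S₂) (i : Fin n) : Z₁ × Z₂ :=
  (ch.z₁ (pathIn ch c m s i).1 (s i).1, ch.z₂ (pathIn ch c m s i).2 (s i).2)

/-- The input of encoder 1 for a given history of cribbed signals. -/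
def encIn₁ (i : Fin n) (m₁ : Fin M₁) (s₁ : Fin n → S₁) (z : Set.Iio i → Z₁ × Z₂) : X₁ :=
  c.enc₁ i m₁ (fun j => s₁ j) (fun j => (z j).2)

/-- The input of encoder 2 for a given history of cribbed signals. -/
def encIn₂ (i : Fin n) (m₂ : Fin M₂) (s₂ : Fin n → S₂) (z : Set.Iio i → Z₁ × Z₂) : X₂ :=
  c.enc₂ i m₂ (fun j => s₂ j) (fun j => (z j).1)

lemma pathIn_eq (m : Fin M₁ × Fin M₂) (s : Fin n → S₁ × S₂) (i : Fin n) :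
    pathIn ch c m s i =
      (encIn₁ c i m.1 (fun j => (s j).1) (fun j => pathCrib ch c m s j),
        encIn₂ c i m.2 (fun j => (s j).2) (fun j => pathCrib ch c m s j)) := by
  rw [pathIn, inputs]
  rfl

/-- Causality of the code, by induction over time: the inputs use no later states, directly or
through the cribbed signals. -/
lemma pathIn_congr (m : Fin M₁ × Fin M₂) {s s' : Fin n → S₁ × S₂} (i : Fin n)
    (h : ∀ j ≤ i, s j = s' j) : pathIn ch c m s i = pathIn ch c m s' i := by
  induction i using WellFoundedLT.induction with
  | _ i ih =>
    have hz : ∀ j : Set.Iio i, pathCrib ch c m s j = pathCrib ch c m s' j := by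
      intro j
      have hj : (j : Fin n) < i := j.2
      simp only [pathCrib, ih j hj fun k hk => h k (hk.trans hj.le), h j hj.le]
    have hs : ∀ j : Set.Iic i, s j = s' j := fun j => h j j.2
    rw [pathIn_eq, pathIn_eq]
    simp only [encIn₁, encIn₂, hz, hs]

lemma pathIn_update (m : Fin M₁ × Fin M₂) (s : Fin n → S₁ × S₂) {i k : Fin n} (hik : i < k)
    (t : S₁ × S₂) : pathIn ch c m (Function.update s k t) i = pathIn ch c m s i :=
  pathIn_congr ch c m i fun _ hj => Function.update_of_ne (hj.trans_lt hik).ne _ _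

lemma pathCrib_update (m : Fin M₁ × Fin M₂) (s : Fin n → S₁ × S₂) {i k : Fin n} (hik : i < k)
    (t : S₁ × S₂) : pathCrib ch c m (Function.update s k t) i = pathCrib ch c m s i := by
  simp only [pathCrib, pathIn_update ch c m s hik, Function.update_of_ne hik.ne]

open Classical in
/-- The messages of encoder 1 compatible with a history. -/
def compSet₁ (i : Fin n) (s₁ : Fin n → S₁) (z : Set.Iio i → Z₁ × Z₂) : Finset (Fin M₁) :=
  {m | ∀ j (hj : j < i), ch.z₁ (encIn₁ c j m s₁ fun k => z ⟨k, lt_trans k.2 hj⟩) (s₁ j) =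
    (z ⟨j, hj⟩).1}

open Classical in
/-- The messages of encoder 2 compatible with a history. -/
def compSet₂ (i : Fin n) (s₂ : Fin n → S₂) (z : Set.Iio i → Z₁ × Z₂) : Finset (Fin M₂) :=
  {m | ∀ j (hj : j < i), ch.z₂ (encIn₂ c j m s₂ fun k => z ⟨k, lt_trans k.2 hj⟩) (s₂ j) =
    (z ⟨j, hj⟩).2}

/-- The heart of the converse. Along a prescribed history each encoder can be tested alone, since
what it would receive from the other is part of the history. The message pairs consistent with a
history thus form a product set, and given states and history the two messages remain independent.
-/
lemma pathCrib_eq_iff (m : Fin M₁ × Fin M₂) (s : Fin n → S₁ × S₂) (i : Fin n)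
    (z : Set.Iio i → Z₁ × Z₂) :
    (fun j : Set.Iio i => pathCrib ch c m s j) = z ↔
      m.1 ∈ compSet₁ ch c i (fun j => (s j).1) z ∧ m.2 ∈ compSet₂ ch c i (fun j => (s j).2) z := by
  classical
  simp only [compSet₁, compSet₂, Finset.mem_filter, Finset.mem_univ, true_and]
  constructor
  · rintro rfl
    refine ⟨fun j hj => ?_, fun j hj => ?_⟩
    · simp only [pathCrib, pathIn_eq ch c m s j]
    · simp only [pathCrib, pathIn_eq ch c m s j]
  · rintro ⟨h1, h2⟩
    -- Compatibility is tested along `z`, not along the actual signals; the two agree by induction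
    -- over time.
    have key : ∀ j (hj : j < i), pathCrib ch c m s j = z ⟨j, hj⟩ := by
      intro j
      induction j using WellFoundedLT.induction with
      | _ j ih =>
        intro hj
        have hz : (fun k : Set.Iio j => pathCrib ch c m s k) =
            fun k : Set.Iio j => z ⟨k, lt_trans k.2 hj⟩ :=
          funext fun k => ih k k.2 (lt_trans k.2 hj)
        rw [pathCrib, pathIn_eq, hz]
        exact Prod.ext (h1 j hj) (h2 j hj)
    exact funext fun j => key j j.2

lemma encIn₁_congr {i : Fin n} (m : Fin M₁) {s s' : Fin n → S₁} (z : Set.Iio i → Z₁ × Z₂)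
    (h : ∀ j ≤ i, s j = s' j) : encIn₁ c i m s z = encIn₁ c i m s' z := by
  have hs : ∀ j : Set.Iic i, s j = s' j := fun j => h j j.2
  simp only [encIn₁, hs]

lemma encIn₂_congr {i : Fin n} (m : Fin M₂) {s s' : Fin n → S₂} (z : Set.Iio i → Z₁ × Z₂)
    (h : ∀ j ≤ i, s j = s' j) : encIn₂ c i m s z = encIn₂ c i m s' z := by
  have hs : ∀ j : Set.Iic i, s j = s' j := fun j => h j j.2
  simp only [encIn₂, hs]

lemma compSet₁_congr {i : Fin n} {s s' : Fin n → S₁} (z : Set.Iio i → Z₁ × Z₂)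
    (h : ∀ j < i, s j = s' j) : compSet₁ ch c i s z = compSet₁ ch c i s' z := by
  classical
  unfold compSet₁
  refine Finset.filter_congr fun m _ => forall_congr' fun j => forall_congr' fun hj => ?_
  rw [encIn₁_congr c m _ fun k hk => h k (hk.trans_lt hj), h j hj]

lemma compSet₂_congr {i : Fin n} {s s' : Fin n → S₂} (z : Set.Iio i → Z₁ × Z₂)
    (h : ∀ j < i, s j = s' j) : compSet₂ ch c i s z = compSet₂ ch c i s' z := by
  classical
  unfold compSet₂
  refine Finset.filter_congr fun m _ => forall_congr' fun j => forall_congr' fun hj => ?_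
  rw [encIn₂_congr c m _ fun k hk => h k (hk.trans_lt hj), h j hj]

end Paths

/-! ### Uniform laws on finite message sets -/

section Empirical

variable {M X : Type*} [Fintype X] [Nonempty X]

open Classical in
/-- The distribution of `f m` for `m` uniform on `A`, and a point mass if `A` is empty. -/
def empLaw (A : Finset M) (f : M → X) (x : X) : ℝ :=
  if A.Nonempty then ((A.filter fun m => f m = x).card : ℝ) / A.card
  else if x = Classical.arbitrary X then 1 else 0

lemma empLaw_nonneg (A : Finset M) (f : M → X) (x : X) : 0 ≤ empLaw A f x := by
  unfold empLaw
  split_ifs <;> positivity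

/-- Groups the messages by the value of `f`. For empty `A` the factor `A.card` kills the arbitrary
point mass, whose only role is to keep `empLaw` in the simplex. -/
lemma sum_eq_card_mul_empLaw (A : Finset M) (f : M → X) (φ : X → ℝ) :
    ∑ m ∈ A, φ (f m) = A.card * ∑ x, empLaw A f x * φ x := by
  classical
  rcases A.eq_empty_or_nonempty with h | h
  · simp [h]
  · have hc : (A.card : ℝ) ≠ 0 := by exact_mod_cast h.card_pos.ne'
    rw [← Finset.sum_fiberwise A f, Finset.mul_sum]
    refine Finset.sum_congr rfl fun x _ => ?_
    rw [Finset.sum_congr rfl fun m hm => by rw [(Finset.mem_filter.1 hm).2],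
      Finset.sum_const, nsmul_eq_mul]
    simp only [empLaw, h, if_true]
    field_simp

lemma empLaw_mem_stdSimplex (A : Finset M) (f : M → X) : empLaw A f ∈ stdSimplex ℝ X := by
  classical
  refine ⟨empLaw_nonneg A f, ?_⟩
  rcases A.eq_empty_or_nonempty with h | h
  · simp [empLaw, h]
  · have hc : (A.card : ℝ) ≠ 0 := by exact_mod_cast h.card_pos.ne'
    have := sum_eq_card_mul_empLaw A f fun _ => 1
    simp only [Finset.sum_const, nsmul_eq_mul, mul_one] at this
    exact mul_left_cancel₀ hc (by rw [← this, mul_one])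

lemma empLaw_pos {A : Finset M} (f : M → X) {m : M} (hm : m ∈ A) : 0 < empLaw A f (f m) := by
  classical
  have h : A.Nonempty := ⟨m, hm⟩
  simp only [empLaw, h, if_true]
  refine div_pos ?_ (by exact_mod_cast h.card_pos)
  exact_mod_cast Finset.card_pos.2 ⟨m, by simp [hm]⟩

end Empirical

/-! ### Converse: conditional input laws given the history -/

section SelectedLaws

variable {S₁ S₂ X₁ X₂ Y Z₁ Z₂ : Type*} [Fintype S₁] [Fintype S₂] [Fintype X₁] [Fintype X₂]
  [Fintype Y] [Fintype Z₁] [Fintype Z₂] [Nonempty X₁] [Nonempty X₂]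
  (ch : Channel S₁ S₂ X₁ X₂ Y Z₁ Z₂) {n M₁ M₂ : ℕ} (c : Code S₁ S₂ X₁ X₂ Y Z₁ Z₂ n M₁ M₂)

/-- The law of input 1 given its state and the history. -/
def selLaw₁ (i : Fin n) (s₁ : Fin n → S₁) (z : Set.Iio i → Z₁ × Z₂) (t : S₁) : X₁ → ℝ :=
  empLaw (compSet₁ ch c i s₁ z) fun m => encIn₁ c i m (Function.update s₁ i t) z

/-- The law of input 2 given its state and the history. -/
def selLaw₂ (i : Fin n) (s₂ : Fin n → S₂) (z : Set.Iio i → Z₁ × Z₂) (t : S₂) : X₂ → ℝ :=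
  empLaw (compSet₂ ch c i s₂ z) fun m => encIn₂ c i m (Function.update s₂ i t) z

/-- The state at time `i` is overwritten by the argument `t`, and compatibility involves earlier
states only. So although the auxiliary variable carries the full state sequence, the current state
acts as a fresh independent draw. -/
lemma selLaw₁_congr (i : Fin n) {s s' : Fin n → S₁} (z : Set.Iio i → Z₁ × Z₂)
    (h : ∀ j < i, s j = s' j) : selLaw₁ ch c i s z = selLaw₁ ch c i s' z := by
  funext t
  unfold selLaw₁
  rw [compSet₁_congr ch c z h]
  congr 1
  funext m
  refine encIn₁_congr c m z fun j hj => ?_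
  rcases hj.eq_or_lt with rfl | hj
  · simp
  · rw [Function.update_of_ne hj.ne, Function.update_of_ne hj.ne, h j hj]

lemma selLaw₂_congr (i : Fin n) {s s' : Fin n → S₂} (z : Set.Iio i → Z₁ × Z₂)
    (h : ∀ j < i, s j = s' j) : selLaw₂ ch c i s z = selLaw₂ ch c i s' z := by
  funext t
  unfold selLaw₂
  rw [compSet₂_congr ch c z h]
  congr 1
  funext m
  refine encIn₂_congr c m z fun j hj => ?_
  rcases hj.eq_or_lt with rfl | hj
  · simp
  · rw [Function.update_of_ne hj.ne, Function.update_of_ne hj.ne, h j hj]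

/-- The transmitted message is compatible with the history it produces. This gives the absolute
continuity that the change of measure requires. -/
lemma selLaw₁_path_pos (m : Fin M₁ × Fin M₂) (s : Fin n → S₁ × S₂) (i : Fin n) :
    0 < selLaw₁ ch c i (fun j => (s j).1) (fun j => pathCrib ch c m s j) (s i).1
      (pathIn ch c m s i).1 := by
  have h := ((pathCrib_eq_iff ch c m s i _).1 rfl).1
  have := empLaw_pos (fun m₁ => encIn₁ c i m₁ (Function.update (fun j => (s j).1) i (s i).1)
    (fun j : Set.Iio i => pathCrib ch c m s j)) h
  rw [Function.update_eq_self i (fun j => (s j).1)] at this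
  rwa [selLaw₁, Function.update_eq_self i (fun j => (s j).1), pathIn_eq]

lemma selLaw₂_path_pos (m : Fin M₁ × Fin M₂) (s : Fin n → S₁ × S₂) (i : Fin n) :
    0 < selLaw₂ ch c i (fun j => (s j).2) (fun j => pathCrib ch c m s j) (s i).2
      (pathIn ch c m s i).2 := by
  have h := ((pathCrib_eq_iff ch c m s i _).1 rfl).2
  have := empLaw_pos (fun m₂ => encIn₂ c i m₂ (Function.update (fun j => (s j).2) i (s i).2)
    (fun j : Set.Iio i => pathCrib ch c m s j)) h
  rw [Function.update_eq_self i (fun j => (s j).2)] at this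
  rwa [selLaw₂, Function.update_eq_self i (fun j => (s j).2), pathIn_eq]

/-- The joint law at time `i` of the history, the states and the inputs. -/
lemma sum_path_eq (i : Fin n)
    (ψ : (Fin n → S₁ × S₂) → (Set.Iio i → Z₁ × Z₂) → X₁ → X₂ → ℝ) :
    ∑ m, ∑ s : Fin n → S₁ × S₂, (∏ j, ch.pS (s j)) *
        ψ s (fun j => pathCrib ch c m s j) (pathIn ch c m s i).1 (pathIn ch c m s i).2 =
      ∑ s : Fin n → S₁ × S₂, ∑ z : Set.Iio i → Z₁ × Z₂, (∏ j, ch.pS (s j)) *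
        ((compSet₁ ch c i (fun j => (s j).1) z).card *
          (compSet₂ ch c i (fun j => (s j).2) z).card) *
        ∑ t, ∑ x₁, ∑ x₂, ch.pS t * selLaw₁ ch c i (fun j => (s j).1) z t.1 x₁ *
          selLaw₂ ch c i (fun j => (s j).2) z t.2 x₂ * ψ (Function.update s i t) z x₁ x₂ := by
  classical
  rw [Finset.sum_comm]
  simp only [← Finset.mul_sum]
  -- The state at time `i` is replaced by a fresh `t`; the history before `i` is unaffected
  -- (`hcrib`).
  rw [sum_pi_resample (fun _ => ch.pS) i ch.pS_mem.2]
  refine Finset.sum_congr rfl fun s _ => ?_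
  simp only [mul_assoc]
  rw [← Finset.mul_sum]
  congr 1
  have hcrib : ∀ m t, (fun j : Set.Iio i => pathCrib ch c m (Function.update s i t) j) =
      fun j : Set.Iio i => pathCrib ch c m s j :=
    fun m t => funext fun j => pathCrib_update ch c m s (Set.mem_Iio.1 j.2) t
  have hpath : ∀ m t, pathIn ch c m (Function.update s i t) i =
      (encIn₁ c i m.1 (Function.update (fun j => (s j).1) i t.1) (fun j => pathCrib ch c m s j),
       encIn₂ c i m.2 (Function.update (fun j => (s j).2) i t.2)
        (fun j => pathCrib ch c m s j)) := by
    intro m t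
    rw [pathIn_eq, hcrib]
    congr! with j j
    · exact Function.apply_update (fun _ => Prod.fst) s i t j
    · exact Function.apply_update (fun _ => Prod.snd) s i t j
  simp only [hcrib, hpath]
  -- Message pairs are grouped by the history they produce, and each group is a rectangle. The
  -- double sum over the rectangle then factors into the two empirical laws in `hsel`.
  have hz : ∀ (F : (Set.Iio i → Z₁ × Z₂) → Fin M₁ × Fin M₂ → ℝ),
      ∑ m, F (fun j => pathCrib ch c m s j) m =
        ∑ z, ∑ m₁ ∈ compSet₁ ch c i (fun j => (s j).1) z,
          ∑ m₂ ∈ compSet₂ ch c i (fun j => (s j).2) z, F z (m₁, m₂) := by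
    intro F
    simp only [← Finset.sum_product']
    rw [← Finset.sum_fiberwise Finset.univ fun m => (fun j : Set.Iio i => pathCrib ch c m s j)]
    refine Finset.sum_congr rfl fun z _ => ?_
    refine Finset.sum_congr ?_ ?_
    · ext m
      simp only [Finset.mem_filter, Finset.mem_univ, true_and, Finset.mem_product]
      exact pathCrib_eq_iff ch c m s i z
    · rintro m hm
      rw [Finset.mem_product, ← pathCrib_eq_iff ch c m s i z] at hm
      rw [hm]
  have hsel : ∀ t z, ∑ m₁ ∈ compSet₁ ch c i (fun j => (s j).1) z,
      ∑ m₂ ∈ compSet₂ ch c i (fun j => (s j).2) z, ψ (Function.update s i t) z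
        (encIn₁ c i m₁ (Function.update (fun j => (s j).1) i t.1) z)
        (encIn₂ c i m₂ (Function.update (fun j => (s j).2) i t.2) z) =
      (compSet₁ ch c i (fun j => (s j).1) z).card * ((compSet₂ ch c i (fun j => (s j).2) z).card *
        ∑ x₁, ∑ x₂, selLaw₁ ch c i (fun j => (s j).1) z t.1 x₁ *
          (selLaw₂ ch c i (fun j => (s j).2) z t.2 x₂ * ψ (Function.update s i t) z x₁ x₂)) := by
    intro t z
    have h2 : ∀ x₁, ∑ m₂ ∈ compSet₂ ch c i (fun j => (s j).2) z, ψ (Function.update s i t) z x₁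
        (encIn₂ c i m₂ (Function.update (fun j => (s j).2) i t.2) z) = _ := fun x₁ =>
      sum_eq_card_mul_empLaw _ _ fun x₂ => ψ (Function.update s i t) z x₁ x₂
    simp only [h2]
    rw [← Finset.mul_sum, sum_eq_card_mul_empLaw _ _ fun x₁ => ∑ x₂, empLaw
      (compSet₂ ch c i (fun j => (s j).2) z) (fun m₂ => encIn₂ c i m₂
        (Function.update (fun j => (s j).2) i t.2) z) x₂ * ψ (Function.update s i t) z x₁ x₂]
    rw [mul_left_comm]
    simp only [Finset.mul_sum]
    rfl
  have hz' : ∀ t : S₁ × S₂, ∑ m : Fin M₁ × Fin M₂,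
      ψ (Function.update s i t) (fun j => pathCrib ch c m s j)
        (encIn₁ c i m.1 (Function.update (fun j => (s j).1) i t.1)
          (fun j => pathCrib ch c m s j))
        (encIn₂ c i m.2 (Function.update (fun j => (s j).2) i t.2)
          (fun j => pathCrib ch c m s j)) = _ := fun t =>
    hz fun z m => ψ (Function.update s i t) z
      (encIn₁ c i m.1 (Function.update (fun j => (s j).1) i t.1) z)
      (encIn₂ c i m.2 (Function.update (fun j => (s j).2) i t.2) z)
  simp only [hz', hsel, Finset.mul_sum]
  rw [Finset.sum_comm]
  refine Finset.sum_congr rfl fun z _ => Finset.sum_congr rfl fun t _ =>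
    Finset.sum_congr rfl fun x₁ _ => Finset.sum_congr rfl fun x₂ _ => by ring

end SelectedLaws

end CribMAC
end

noncomputable section
namespace CribMAC

set_option linter.unusedSectionVars false

/-! ### Converse: change of measure -/

section Converse

variable {S₁ S₂ X₁ X₂ Y Z₁ Z₂ : Type*} [Fintype S₁] [Fintype S₂] [Fintype X₁] [Fintype X₂]
  [Fintype Y] [Fintype Z₁] [Fintype Z₂]
  (ch : Channel S₁ S₂ X₁ X₂ Y Z₁ Z₂) {n M₁ M₂ : ℕ} (c : Code S₁ S₂ X₁ X₂ Y Z₁ Z₂ n M₁ M₂)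

/-- Transition probability of the channel at time `i` along the path of a message pair. -/
def pathW (m : Fin M₁ × Fin M₂) (s : Fin n → S₁ × S₂) (i : Fin n) (y : Y) : ℝ :=
  ch.W (pathIn ch c m s i).1 (pathIn ch c m s i).2 (s i).1 (s i).2 y

/-- The joint probability of messages, states and outputs. -/
def codeProb (ω : (Fin M₁ × Fin M₂) × (Fin n → S₁ × S₂) × (Fin n → Y)) : ℝ :=
  ((M₁ : ℝ) * M₂)⁻¹ * (∏ j, ch.pS (ω.2.1 j)) * ∏ i, pathW ch c ω.1 ω.2.1 i (ω.2.2 i)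

lemma pathW_nonneg (m : Fin M₁ × Fin M₂) (s : Fin n → S₁ × S₂) (i : Fin n) (y : Y) :
    0 ≤ pathW ch c m s i y := W_nonneg ..

lemma sum_pathW (m : Fin M₁ × Fin M₂) (s : Fin n → S₁ × S₂) (i : Fin n) :
    ∑ y, pathW ch c m s i y = 1 := sum_W ..

lemma prod_pS_nonneg (s : Fin n → S₁ × S₂) : 0 ≤ ∏ j, ch.pS (s j) :=
  Finset.prod_nonneg fun _ _ => ch.pS_mem.1 _

lemma sum_prod_pS : ∑ s : Fin n → S₁ × S₂, ∏ j, ch.pS (s j) = 1 :=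
  sum_pi_prod_eq_one (fun _ => ch.pS) fun _ => ch.pS_mem.2

lemma codeProb_nonneg (ω : (Fin M₁ × Fin M₂) × (Fin n → S₁ × S₂) × (Fin n → Y)) :
    0 ≤ codeProb ch c ω :=
  mul_nonneg (mul_nonneg (by positivity) (prod_pS_nonneg ch _))
    (Finset.prod_nonneg fun _ _ => pathW_nonneg ..)

lemma errorProb_eq_sum : errorProb ch c = ∑ ω, codeProb ch c ω *
    (if (c.dec₁ ω.2.2 (fun j => (ω.2.1 j).1) (fun j => (ω.2.1 j).2),
      c.dec₂ ω.2.2 (fun j => (ω.2.1 j).1) (fun j => (ω.2.1 j).2)) ≠ ω.1 then 1 else 0) := by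
  simp only [errorProb, Fintype.sum_prod_type]
  refine Finset.sum_congr rfl fun m₁ _ => Finset.sum_congr rfl fun m₂ _ => ?_
  rw [← (Equiv.arrowProdEquivProdArrow (Fin n) (fun _ => S₁) (fun _ => S₂)).symm.sum_comp,
    Fintype.sum_prod_type]
  refine Finset.sum_congr rfl fun s₁ _ => Finset.sum_congr rfl fun s₂ _ =>
    Finset.sum_congr rfl fun y _ => ?_
  simp only [codeProb, pathW, pathIn, Equiv.arrowProdEquivProdArrow, Equiv.coe_fn_symm_mk, one_div,
    mul_inv]
  rfl

lemma sum_codeProb_mul (F : (Fin M₁ × Fin M₂) → (Fin n → S₁ × S₂) → (Fin n → Y) → ℝ) :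
    ∑ ω, codeProb ch c ω * F ω.1 ω.2.1 ω.2.2 = ∑ m, ∑ s : Fin n → S₁ × S₂,
      ((M₁ : ℝ) * M₂)⁻¹ * ((∏ j, ch.pS (s j)) * ∑ y : Fin n → Y,
        (∏ i, pathW ch c m s i (y i)) * F m s y) := by
  rw [Fintype.sum_prod_type]
  refine Finset.sum_congr rfl fun m _ => ?_
  rw [Fintype.sum_prod_type]
  refine Finset.sum_congr rfl fun s _ => ?_
  rw [Finset.mul_sum, Finset.mul_sum]
  exact Finset.sum_congr rfl fun y _ => by simp only [codeProb]; ring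

lemma sum_codeProb (h₁ : 0 < M₁) (h₂ : 0 < M₂) : ∑ ω, codeProb ch c ω = 1 := by
  have := sum_codeProb_mul ch c fun _ _ _ => 1
  simp only [mul_one] at this
  rw [this]
  have hy : ∀ m s, ∑ y : Fin n → Y, ∏ i, pathW ch c m s i (y i) = 1 := fun m s =>
    sum_pi_prod_eq_one (fun i => pathW ch c m s i) (sum_pathW ch c m s)
  simp only [hy, mul_one, ← Finset.mul_sum, sum_prod_pS]
  have h₁' : (M₁ : ℝ) ≠ 0 := by exact_mod_cast h₁.ne'
  have h₂' : (M₂ : ℝ) ≠ 0 := by exact_mod_cast h₂.ne'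
  simp
  field_simp

/-- Lower bound on an accumulated information density by the log-cardinality of the messages that
are decoded correctly. -/
lemma mul_logb_sub_one_le (h₁ : 0 < M₁) (h₂ : 0 < M₂)
    (D : (Fin M₁ × Fin M₂) → (Fin n → S₁ × S₂) → Fin n → Y → ℝ) (hD : ∀ m s i y, 0 ≤ D m s i y)
    (hpos : ∀ m s y, 0 < codeProb ch c (m, s, y) → ∀ i, 0 < D m s i (y i))
    (E : (Fin M₁ × Fin M₂) → (Fin n → S₁ × S₂) → (Fin n → Y) → Prop)
    [∀ m s y, Decidable (E m s y)] {K : ℝ} (hK : 0 < K)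
    (hQ : ∑ m, ∑ s : Fin n → S₁ × S₂, ((M₁ : ℝ) * M₂)⁻¹ * ((∏ j, ch.pS (s j)) *
      ∑ y : Fin n → Y, (∏ i, D m s i (y i)) * (if E m s y then K else 1)) ≤ 2) :
    (∑ ω, codeProb ch c ω * if E ω.1 ω.2.1 ω.2.2 then 1 else 0) * Real.logb 2 K - 1 ≤
      ∑ i, ∑ m, ∑ s : Fin n → S₁ × S₂, ((M₁ : ℝ) * M₂)⁻¹ * ((∏ j, ch.pS (s j)) *
        ∑ y, pathW ch c m s i y * Real.logb 2 (pathW ch c m s i y / D m s i y)) := by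
  -- The reference measure keeps messages and states but draws the outputs from `D`. The test
  -- function is `K` on `E` and 1 elsewhere; the bound 2 on its reference expectation costs the
  -- single bit subtracted in the conclusion.
  have key := sum_mul_logb_ge (codeProb ch c)
    (fun ω => ((M₁ : ℝ) * M₂)⁻¹ * (∏ j, ch.pS (ω.2.1 j)) * ∏ i, D ω.1 ω.2.1 i (ω.2.2 i))
    (fun ω => if E ω.1 ω.2.1 ω.2.2 then K else 1) (codeProb_nonneg ch c) (sum_codeProb ch c h₁ h₂)
    (fun ω => by split_ifs <;> simp [hK])
    (fun ω => mul_nonneg (mul_nonneg (by positivity) (prod_pS_nonneg ch _))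
      (Finset.prod_nonneg fun _ _ => hD ..))
    (fun ω hω => by
      have hp := hpos ω.1 ω.2.1 ω.2.2 hω
      have h0 : 0 < ((M₁ : ℝ) * M₂)⁻¹ * (∏ j, ch.pS (ω.2.1 j)) :=
        lt_of_le_of_ne (mul_nonneg (by positivity) (prod_pS_nonneg ch _))
          (fun h => by rw [codeProb, ← h, zero_mul] at hω; exact lt_irrefl _ hω)
      exact mul_pos h0 (Finset.prod_pos fun i _ => hp i))
    two_pos (by
      refine le_trans (le_of_eq ?_) hQ
      rw [Fintype.sum_prod_type]
      refine Finset.sum_congr rfl fun m _ => ?_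
      rw [Fintype.sum_prod_type]
      refine Finset.sum_congr rfl fun s _ => ?_
      rw [Finset.mul_sum, Finset.mul_sum]
      exact Finset.sum_congr rfl fun y _ => by ring)
  have e1 : ∑ ω, codeProb ch c ω * Real.logb 2 (if E ω.1 ω.2.1 ω.2.2 then K else 1) =
      (∑ ω, codeProb ch c ω * if E ω.1 ω.2.1 ω.2.2 then 1 else 0) * Real.logb 2 K := by
    rw [Finset.sum_mul]
    refine Finset.sum_congr rfl fun ω _ => ?_
    split_ifs <;> simp
  have e2 : ∑ ω, codeProb ch c ω * Real.logb 2 (codeProb ch c ω / (((M₁ : ℝ) * M₂)⁻¹ *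
      (∏ j, ch.pS (ω.2.1 j)) * ∏ i, D ω.1 ω.2.1 i (ω.2.2 i))) =
      ∑ ω, codeProb ch c ω * ∑ i, Real.logb 2 (pathW ch c ω.1 ω.2.1 i (ω.2.2 i) /
        D ω.1 ω.2.1 i (ω.2.2 i)) := by
    refine Finset.sum_congr rfl fun ω _ => ?_
    rcases (codeProb_nonneg ch c ω).eq_or_lt with h0 | h0
    · simp [← h0]
    · have hp := hpos ω.1 ω.2.1 ω.2.2 h0
      have hne := h0.ne'
      rw [codeProb, mul_ne_zero_iff] at hne
      rw [codeProb, mul_div_mul_left _ _ hne.1, ← Finset.prod_div_distrib,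
        Real.logb_prod _ _ fun i _ => div_ne_zero
          (Finset.prod_ne_zero_iff.1 hne.2 i (Finset.mem_univ i))
          (hp i).ne']
  have e3 : Real.logb 2 2 = 1 := by simp
  rw [e1, e2, e3, sum_codeProb_mul ch c fun m s y => ∑ i, Real.logb 2 (pathW ch c m s i (y i) /
    D m s i (y i))] at key
  refine key.trans (le_of_eq ?_)
  symm
  rw [Finset.sum_comm]
  refine Finset.sum_congr rfl fun m _ => ?_
  rw [Finset.sum_comm]
  refine Finset.sum_congr rfl fun s _ => ?_
  rw [← Finset.mul_sum, ← Finset.mul_sum]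
  congr 2
  simp only [Finset.mul_sum (s := (Finset.univ : Finset (Fin n)))]
  symm
  rw [Finset.sum_comm]
  refine Finset.sum_congr rfl fun i _ => ?_
  exact (sum_pi_marginal (fun i => pathW ch c m s i) (sum_pathW ch c m s) i
    fun y => Real.logb 2 (pathW ch c m s i y / D m s i y))

end Converse

end CribMAC
end

noncomputable section
namespace CribMAC

set_option linter.unusedSectionVars false

/-! ### Converse: the single-letter law of a code and the mass of the reference measure -/

section Converse

variable {S₁ S₂ X₁ X₂ Y Z₁ Z₂ : Type*} [Fintype S₁] [Fintype S₂] [Fintype X₁] [Fintype X₂]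
  [Fintype Y] [Fintype Z₁] [Fintype Z₂]
  (ch : Channel S₁ S₂ X₁ X₂ Y Z₁ Z₂)

lemma kern_congr {α : Type*} {w : Bool} (q : α → ℝ) {x x' : α} (h : w = false → x = x') :
    kern w q x = kern w q x' := by
  cases w
  · rw [h rfl]
  · rfl

/-- Flagged inputs are averaged out, so only the unflagged ones enter. Through them the reference
law depends only on the messages that are not flagged. -/
lemma cribLaw_congr (k : Bool × Bool) (a : S₁ → X₁ → ℝ) (b : S₂ → X₂ → ℝ) (s₁ : S₁) (s₂ : S₂)
    {x₁ x₁' : X₁} {x₂ x₂' : X₂} (h₁ : k.1 = false → x₁ = x₁') (h₂ : k.2 = false → x₂ = x₂')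
    (ζ₁ : Z₁) (ζ₂ : Z₂) (y : Y) :
    cribLaw ch k a b s₁ s₂ x₁ x₂ ζ₁ ζ₂ y = cribLaw ch k a b s₁ s₂ x₁' x₂' ζ₁ ζ₂ y := by
  simp only [cribLaw, kern_congr (a s₁) h₁, kern_congr (b s₂) h₂]

lemma sum_cribLaw (k : Bool × Bool) {a : S₁ → X₁ → ℝ} {b : S₂ → X₂ → ℝ}
    (ha : ∀ s, a s ∈ stdSimplex ℝ X₁) (hb : ∀ s, b s ∈ stdSimplex ℝ X₂) (s₁ : S₁) (s₂ : S₂)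
    (x₁ : X₁) (x₂ : X₂) :
    ∑ g : (Z₁ × Z₂) × Y, cribLaw ch k a b s₁ s₂ x₁ x₂ g.1.1 g.1.2 g.2 = 1 := by
  classical
  simp only [cribLaw]
  rw [Finset.sum_comm]
  have hin : ∀ x₁' x₂', ∑ g : (Z₁ × Z₂) × Y,
      (if ch.z₁ x₁' s₁ = g.1.1 ∧ ch.z₂ x₂' s₂ = g.1.2 then ch.W x₁' x₂' s₁ s₂ g.2 else 0) = 1 := by
    intro x₁' x₂'
    rw [Fintype.sum_prod_type, Finset.sum_eq_single (ch.z₁ x₁' s₁, ch.z₂ x₂' s₂)]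
    · simp [sum_W]
    · rintro ⟨ζ₁, ζ₂⟩ _ hne
      refine Finset.sum_eq_zero fun y _ => if_neg ?_
      rintro ⟨rfl, rfl⟩
      exact hne rfl
    · simp
  have hx : ∀ x₁', ∑ g : (Z₁ × Z₂) × Y, ∑ x₂', kern k.1 (a s₁) x₁ x₁' * kern k.2 (b s₂) x₂ x₂' *
      (if ch.z₁ x₁' s₁ = g.1.1 ∧ ch.z₂ x₂' s₂ = g.1.2 then ch.W x₁' x₂' s₁ s₂ g.2 else 0) =
      kern k.1 (a s₁) x₁ x₁' := by
    intro x₁'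
    rw [Finset.sum_comm]
    simp only [← Finset.mul_sum, hin, mul_one, sum_kern k.2 (hb s₂).2]
  have := Finset.sum_congr (rfl : (Finset.univ : Finset X₁) = Finset.univ) fun x₁' _ => hx x₁'
  rw [sum_kern k.1 (ha s₁).2] at this
  convert this using 2

/-- The number of message pairs that differ at most in the coordinates flagged by `k`. -/
def numMsg (M₁ M₂ : ℕ) (k : Bool × Bool) : ℝ :=
  (if k.1 then (M₁ : ℝ) else 1) * (if k.2 then (M₂ : ℝ) else 1)

/-- A weight that ignores the flagged messages makes a fixed guess of them correct with probability
one over their number, and the reward `numMsg` compensates this exactly. -/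
lemma sum_numMsg_mul {M₁ M₂ : ℕ} (k : Bool × Bool) (d : Fin M₁ × Fin M₂)
    (h : Fin M₁ × Fin M₂ → ℝ)
    (hh : ∀ m m', (k.1 = false → m.1 = m'.1) → (k.2 = false → m.2 = m'.2) → h m = h m') :
    ∑ m, h m * (if (k.1 = true → d.1 = m.1) ∧ (k.2 = true → d.2 = m.2)
      then numMsg M₁ M₂ k else 0) = ∑ m, h m := by
  obtain ⟨d₁, d₂⟩ := d
  rw [Fintype.sum_prod_type, Fintype.sum_prod_type]
  rcases k with ⟨_ | _, _ | _⟩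
  · simp [numMsg]
  · have : ∀ m₁ m₂, h (m₁, m₂) = h (m₁, d₂) := fun m₁ m₂ => hh _ _ (by simp) (by simp)
    simp [numMsg, this, mul_comm]
  · have : ∀ m₁ m₂, h (m₁, m₂) = h (d₁, m₂) := fun m₁ m₂ => hh _ _ (by simp) (by simp)
    rw [Finset.sum_comm]
    simp [numMsg, this, mul_comm, Finset.mul_sum]
  · have : ∀ m₁ m₂, h (m₁, m₂) = h (d₁, d₂) := fun m₁ m₂ => hh _ _ (by simp) (by simp)
    simp only [this]
    simp [numMsg, ite_and, mul_comm, mul_assoc]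

variable {n M₁ M₂ : ℕ} (c : Code S₁ S₂ X₁ X₂ Y Z₁ Z₂ n M₁ M₂) [Nonempty X₁] [Nonempty X₂]

/-- The alphabet of time indices, state sequences and histories of cribbed signals. -/
abbrev HistAlphabet (S₁ S₂ Z₁ Z₂ : Type*) (n : ℕ) : Type _ :=
  Σ i : Fin n, (Fin n → S₁ × S₂) × (Set.Iio i → Z₁ × Z₂)

/-- The law of the time index and the history. -/
def codeU (u : HistAlphabet S₁ S₂ Z₁ Z₂ n) : ℝ :=
  (n : ℝ)⁻¹ * (((M₁ : ℝ) * M₂)⁻¹ * ((∏ j, ch.pS (u.2.1 j)) *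
    ((compSet₁ ch c u.1 (fun j => (u.2.1 j).1) u.2.2).card *
      (compSet₂ ch c u.1 (fun j => (u.2.1 j).2) u.2.2).card)))

/-- The conditional law of input 1 given the time index and the history. -/
def codeX₁ (u : HistAlphabet S₁ S₂ Z₁ Z₂ n) : S₁ → X₁ → ℝ :=
  selLaw₁ ch c u.1 (fun j => (u.2.1 j).1) u.2.2

/-- The conditional law of input 2 given the time index and the history. -/
def codeX₂ (u : HistAlphabet S₁ S₂ Z₁ Z₂ n) : S₂ → X₂ → ℝ :=
  selLaw₂ ch c u.1 (fun j => (u.2.1 j).2) u.2.2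

lemma codeX₁_mem (u : HistAlphabet S₁ S₂ Z₁ Z₂ n) (s : S₁) :
    codeX₁ ch c u s ∈ stdSimplex ℝ X₁ := empLaw_mem_stdSimplex _ _

lemma codeX₂_mem (u : HistAlphabet S₁ S₂ Z₁ Z₂ n) (s : S₂) :
    codeX₂ ch c u s ∈ stdSimplex ℝ X₂ := empLaw_mem_stdSimplex _ _

/-- Time averages along the code are expectations under the single-letter law. -/
lemma sum_path_eq_sum_codeU (hn : 0 < n)
    (ψ : HistAlphabet S₁ S₂ Z₁ Z₂ n → S₁ × S₂ → X₁ → X₂ → ℝ)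
    (hψ : ∀ i s t z, ψ ⟨i, Function.update s i t, z⟩ = ψ ⟨i, s, z⟩) :
    ∑ i, ∑ m, ∑ s : Fin n → S₁ × S₂, ((M₁ : ℝ) * M₂)⁻¹ * ((∏ j, ch.pS (s j)) *
        ψ ⟨i, s, fun j => pathCrib ch c m s j⟩ (s i) (pathIn ch c m s i).1
          (pathIn ch c m s i).2) =
      n * ∑ u, codeU ch c u * ∑ t, ∑ x₁, ∑ x₂, ch.pS t * codeX₁ ch c u t.1 x₁ *
        codeX₂ ch c u t.2 x₂ * ψ u t x₁ x₂ := by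
  have hn' : (n : ℝ) ≠ 0 := by exact_mod_cast hn.ne'
  rw [Fintype.sum_sigma, Finset.mul_sum]
  refine Finset.sum_congr rfl fun i _ => ?_
  simp only [← Finset.mul_sum]
  rw [sum_path_eq ch c i fun s z x₁ x₂ => ψ ⟨i, s, z⟩ (s i) x₁ x₂, Fintype.sum_prod_type]
  simp only [hψ, Function.update_self, codeU, codeX₁, codeX₂, Finset.mul_sum (s :=
    (Finset.univ : Finset (Fin n → S₁ × S₂))), Finset.mul_sum (s :=
    (Finset.univ : Finset (Set.Iio i → Z₁ × Z₂)))]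
  refine Finset.sum_congr rfl fun s _ => Finset.sum_congr rfl fun z _ => ?_
  field_simp

/-- The total mass is the case ψ = 1 of the preceding identity. -/
lemma codeU_mem (hn : 0 < n) (h₁ : 0 < M₁) (h₂ : 0 < M₂) :
    codeU ch c ∈ stdSimplex ℝ (HistAlphabet S₁ S₂ Z₁ Z₂ n) := by
  refine ⟨fun u => mul_nonneg (by positivity) (mul_nonneg (by positivity)
    (mul_nonneg (prod_pS_nonneg ch _) (by positivity))), ?_⟩
  have h := sum_path_eq_sum_codeU ch c hn (fun _ _ _ _ => 1) (fun _ _ _ _ => rfl)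
  simp only [mul_one, ← Finset.mul_sum, (codeX₁_mem ch c _ _).2, (codeX₂_mem ch c _ _).2,
    ch.pS_mem.2, sum_prod_pS] at h
  have h₁' : (M₁ : ℝ) ≠ 0 := by exact_mod_cast h₁.ne'
  have h₂' : (M₂ : ℝ) ≠ 0 := by exact_mod_cast h₂.ne'
  have hn' : (n : ℝ) ≠ 0 := by exact_mod_cast hn.ne'
  simp at h
  field_simp at h
  exact (h.resolve_right hn.ne').symm

/-- The cribbing density along the path of a message pair. -/
def pathDen (k : Bool × Bool) (m : Fin M₁ × Fin M₂) (s : Fin n → S₁ × S₂) (i : Fin n) (y : Y) :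
    ℝ :=
  cribDen ch k (selLaw₁ ch c i (fun j => (s j).1) fun j => pathCrib ch c m s j)
    (selLaw₂ ch c i (fun j => (s j).2) fun j => pathCrib ch c m s j) (s i).1 (s i).2
    (pathIn ch c m s i).1 (pathIn ch c m s i).2 y

/-- The conditional law of the cribbed signals and the output given the past. -/
def histDen (k : Bool × Bool) (m : Fin M₁ × Fin M₂) (s : Fin n → S₁ × S₂) (i : Fin n)
    (v : Fin n → (Z₁ × Z₂) × Y) : ℝ :=
  cribLaw ch k (selLaw₁ ch c i (fun j => (s j).1) fun j => (v j).1)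
    (selLaw₂ ch c i (fun j => (s j).2) fun j => (v j).1) (s i).1 (s i).2
    (encIn₁ c i m.1 (fun j => (s j).1) fun j => (v j).1)
    (encIn₂ c i m.2 (fun j => (s j).2) fun j => (v j).1) (v i).1.1 (v i).1.2 (v i).2

lemma pathDen_eq_histDen (k : Bool × Bool) (m : Fin M₁ × Fin M₂) (s : Fin n → S₁ × S₂)
    (i : Fin n) (y : Fin n → Y) : pathDen ch c k m s i (y i) =
      histDen ch c k m s i fun j => (pathCrib ch c m s j, y j) := by
  simp only [pathDen, histDen, cribDen, pathCrib, pathIn_eq ch c m s i]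

lemma histDen_nonneg (k : Bool × Bool) (m : Fin M₁ × Fin M₂) (s : Fin n → S₁ × S₂) (i : Fin n)
    (v : Fin n → (Z₁ × Z₂) × Y) : 0 ≤ histDen ch c k m s i v :=
  cribLaw_nonneg ch k (fun _ => (empLaw_nonneg _ _)) (fun _ => (empLaw_nonneg _ _)) ..

/-- Each factor is a probability law of the current crib and output given the earlier ones, so the
chain rule bounds the mass of the product by one. -/
lemma sum_prod_histDen_le (k : Bool × Bool) (m : Fin M₁ × Fin M₂) (s : Fin n → S₁ × S₂) :
    ∑ v, ∏ i, histDen ch c k m s i v ≤ 1 := by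
  have hu : ∀ {j k : Fin n}, j ≤ k → ∀ (v : Fin n → (Z₁ × Z₂) × Y) g,
      (fun l : Set.Iio j => (Function.update v k g l).1) = fun l : Set.Iio j => (v l).1 := by
    intro j k hjk v g
    funext l
    rw [Function.update_of_ne (lt_of_lt_of_le (Set.mem_Iio.1 l.2) hjk).ne]
  refine sum_prod_adapted_le_one (fun i v => histDen ch c k m s i v)
    (fun i v => histDen_nonneg ch c k m s i v) ?_ ?_
  · intro j l hjl v g
    simp only [histDen, hu hjl.le, Function.update_of_ne hjl.ne]
  · intro i v
    simp only [histDen, hu le_rfl, Function.update_self]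
    exact (sum_cribLaw ch k (fun _ => empLaw_mem_stdSimplex _ _)
      (fun _ => empLaw_mem_stdSimplex _ _) _ _ _ _).le

/-- The reward is at most 1 plus `numMsg` times the indicator of a correct guess, and each of the
two parts contributes at most 1. On full sequences of cribs and outputs the reference law does not
involve the flagged messages, and the decoder sees only outputs and states, so it can only guess. -/
lemma sum_pathDen_le (k : Bool × Bool) (h₁ : 0 < M₁) (h₂ : 0 < M₂) :
    ∑ m, ∑ s : Fin n → S₁ × S₂, ((M₁ : ℝ) * M₂)⁻¹ * ((∏ j, ch.pS (s j)) *
      ∑ y : Fin n → Y, (∏ i, pathDen ch c k m s i (y i)) *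
        (if (k.1 = true → c.dec₁ y (fun j => (s j).1) (fun j => (s j).2) = m.1) ∧
          (k.2 = true → c.dec₂ y (fun j => (s j).1) (fun j => (s j).2) = m.2)
          then numMsg M₁ M₂ k else 1)) ≤ 2 := by
  classical
  have hnum : 0 ≤ numMsg M₁ M₂ k := mul_nonneg (by split_ifs <;> positivity)
    (by split_ifs <;> positivity)
  have hs : ∀ s : Fin n → S₁ × S₂, ∑ m, ∑ y : Fin n → Y, (∏ i, pathDen ch c k m s i (y i)) *
        (if (k.1 = true → c.dec₁ y (fun j => (s j).1) (fun j => (s j).2) = m.1) ∧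
          (k.2 = true → c.dec₂ y (fun j => (s j).1) (fun j => (s j).2) = m.2)
          then numMsg M₁ M₂ k else 1) ≤ 2 * (M₁ * M₂) := by
    intro s
    let d : (Fin n → (Z₁ × Z₂) × Y) → Fin M₁ × Fin M₂ := fun v =>
      (c.dec₁ (fun j => (v j).2) (fun j => (s j).1) (fun j => (s j).2),
        c.dec₂ (fun j => (v j).2) (fun j => (s j).1) (fun j => (s j).2))
    let T : Fin M₁ × Fin M₂ → (Fin n → (Z₁ × Z₂) × Y) → ℝ := fun m v =>
      (∏ i, histDen ch c k m s i v) *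
        (1 + if (k.1 = true → (d v).1 = m.1) ∧ (k.2 = true → (d v).2 = m.2)
          then numMsg M₁ M₂ k else 0)
    have hT : ∀ m v, 0 ≤ T m v := fun m v => mul_nonneg
      (Finset.prod_nonneg fun i _ => histDen_nonneg ..) (by split_ifs <;> positivity)
    calc _ ≤ ∑ m, ∑ v, T m v := by
          refine Finset.sum_le_sum fun m _ => ?_
          calc _ ≤ ∑ y : Fin n → Y, T m fun j => (pathCrib ch c m s j, y j) := by
                refine Finset.sum_le_sum fun y _ => ?_
                simp only [pathDen_eq_histDen ch c k m s _ y, T, d]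
                refine mul_le_mul_of_nonneg_left ?_ (Finset.prod_nonneg fun i _ =>
                  histDen_nonneg ..)
                split_ifs <;> linarith
            -- The cribs are determined by `m`, whose dependence on the flagged messages is
            -- unwanted. Enlarging the sum to arbitrary crib sequences `v` removes it and only adds
            -- nonnegative terms.
            _ = ∑ v ∈ Finset.univ.image fun (y : Fin n → Y) j => (pathCrib ch c m s j, y j),
                  T m v := by
                rw [Finset.sum_image]
                intro y _ y' _ hyy
                funext j
                exact congrArg Prod.snd (congrFun hyy j)
            _ ≤ _ := Finset.sum_le_sum_of_subset_of_nonneg (Finset.subset_univ _)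
                fun v _ _ => hT m v
      _ = ∑ m, ∑ v, (∏ i, histDen ch c k m s i v) + ∑ v, ∑ m, (∏ i, histDen ch c k m s i v) *
            (if (k.1 = true → (d v).1 = m.1) ∧ (k.2 = true → (d v).2 = m.2)
              then numMsg M₁ M₂ k else 0) := by
          simp only [T, mul_add, mul_one, Finset.sum_add_distrib]
          exact congrArg _ Finset.sum_comm
      _ = 2 * ∑ m : Fin M₁ × Fin M₂, ∑ v, (∏ i, histDen ch c k m s i v) := by
          rw [two_mul]
          congr 1
          refine Eq.trans (Finset.sum_congr rfl fun v _ => ?_) Finset.sum_comm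
          refine sum_numMsg_mul k (d v) (fun m => ∏ i, histDen ch c k m s i v) ?_
          intro m m' e₁ e₂
          refine Finset.prod_congr rfl fun i _ => ?_
          exact cribLaw_congr ch k _ _ _ _ (fun h => by rw [e₁ h]) (fun h => by rw [e₂ h]) _ _ _
      _ ≤ 2 * ∑ m : Fin M₁ × Fin M₂, 1 := by
          gcongr with m
          exact sum_prod_histDen_le ch c k m s
      _ = 2 * (M₁ * M₂) := by simp
  have h₁' : (M₁ : ℝ) ≠ 0 := by exact_mod_cast h₁.ne'
  have h₂' : (M₂ : ℝ) ≠ 0 := by exact_mod_cast h₂.ne'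
  rw [Finset.sum_comm]
  simp only [← Finset.mul_sum]
  calc _ ≤ ((M₁ : ℝ) * M₂)⁻¹ * ∑ s : Fin n → S₁ × S₂, (∏ j, ch.pS (s j)) * (2 * (M₁ * M₂)) :=
        mul_le_mul_of_nonneg_left (Finset.sum_le_sum fun s _ =>
          mul_le_mul_of_nonneg_left (hs s) (prod_pS_nonneg ch s)) (by positivity)
    _ = 2 := by
        rw [← Finset.sum_mul, sum_prod_pS]
        field_simp

end Converse

end CribMAC
end

noncomputable section
namespace CribMAC

set_option linter.unusedSectionVars false

/-! ### Converse: the rate bounds for achievable pairs -/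

section Converse

variable {S₁ S₂ X₁ X₂ Y Z₁ Z₂ : Type*} [Fintype S₁] [Fintype S₂] [Fintype X₁] [Fintype X₂]
  [Fintype Y] [Fintype Z₁] [Fintype Z₂] [Nonempty X₁] [Nonempty X₂]
  (ch : Channel S₁ S₂ X₁ X₂ Y Z₁ Z₂) {n M₁ M₂ : ℕ} (c : Code S₁ S₂ X₁ X₂ Y Z₁ Z₂ n M₁ M₂)

lemma one_sub_errorProb_le (h₁ : 0 < M₁) (h₂ : 0 < M₂)
    (E : (Fin M₁ × Fin M₂) → (Fin n → S₁ × S₂) → (Fin n → Y) → Prop)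
    [∀ m s y, Decidable (E m s y)]
    (hE : ∀ m s y, (c.dec₁ y (fun j => (s j).1) (fun j => (s j).2),
      c.dec₂ y (fun j => (s j).1) (fun j => (s j).2)) = m → E m s y) :
    1 - errorProb ch c ≤ ∑ ω, codeProb ch c ω * if E ω.1 ω.2.1 ω.2.2 then 1 else 0 := by
  rw [sub_le_iff_le_add, errorProb_eq_sum, ← Finset.sum_add_distrib]
  refine (sum_codeProb ch c h₁ h₂).symm.le.trans ?_
  refine Finset.sum_le_sum fun ω _ => ?_
  have h0 := codeProb_nonneg ch c ω
  by_cases hd : (c.dec₁ ω.2.2 (fun j => (ω.2.1 j).1) (fun j => (ω.2.1 j).2),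
      c.dec₂ ω.2.2 (fun j => (ω.2.1 j).1) (fun j => (ω.2.1 j).2)) = ω.1
  · simp [hE _ _ _ hd, hd]
  · simp only [ne_eq, hd, not_false_eq_true, if_true, mul_one]
    split_ifs <;> simp [h0]

lemma pos_of_codeProb_pos {m : Fin M₁ × Fin M₂} {s : Fin n → S₁ × S₂} {y : Fin n → Y}
    (h : 0 < codeProb ch c (m, s, y)) :
    0 < ∏ j, ch.pS (s j) ∧ ∀ i, 0 < pathW ch c m s i (y i) := by
  have hne := h.ne'
  rw [codeProb, mul_ne_zero_iff, mul_ne_zero_iff] at hne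
  exact ⟨(prod_pS_nonneg ch _).lt_of_ne' hne.1.2, fun i => (pathW_nonneg ..).lt_of_ne'
    (Finset.prod_ne_zero_iff.1 hne.2 i (Finset.mem_univ i))⟩

lemma logb_numMsg_nonneg (h₁ : 0 < M₁) (h₂ : 0 < M₂) (k : Bool × Bool) :
    1 ≤ numMsg M₁ M₂ k := by
  have h₁' : (1 : ℝ) ≤ M₁ := by exact_mod_cast h₁
  have h₂' : (1 : ℝ) ≤ M₂ := by exact_mod_cast h₂
  refine one_le_mul_of_one_le_of_one_le ?_ ?_ <;> split_ifs <;> simp [h₁', h₂']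

/-- Converse for the messages flagged by `k`. -/
lemma mul_logb_le_sum_cribInfo (hn : 0 < n) (h₁ : 0 < M₁) (h₂ : 0 < M₂) (k : Bool × Bool) :
    (1 - errorProb ch c) * Real.logb 2 (numMsg M₁ M₂ k) - 1 ≤
      n * ∑ u, codeU ch c u * cribInfo ch k (codeX₁ ch c u) (codeX₂ ch c u) := by
  classical
  have hnum := logb_numMsg_nonneg h₁ h₂ k
  have key := mul_logb_sub_one_le ch c h₁ h₂ (pathDen ch c k)
    (fun m s i y => cribLaw_nonneg ch k (fun _ => (empLaw_nonneg _ _))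
      (fun _ => (empLaw_nonneg _ _)) ..)
    (fun m s y h i => cribDen_pos ch k (fun _ => (empLaw_nonneg _ _))
      (fun _ => (empLaw_nonneg _ _)) (selLaw₁_path_pos ch c m s i) (selLaw₂_path_pos ch c m s i)
      ((pos_of_codeProb_pos ch c h).2 i))
    (fun m s y => (k.1 = true → c.dec₁ y (fun j => (s j).1) (fun j => (s j).2) = m.1) ∧
          (k.2 = true → c.dec₂ y (fun j => (s j).1) (fun j => (s j).2) = m.2))
    (K := numMsg M₁ M₂ k) (by linarith) (by
      refine le_trans (le_of_eq ?_) (sum_pathDen_le ch c k h₁ h₂)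
      congr!)
  have hle := mul_le_mul_of_nonneg_right (one_sub_errorProb_le ch c h₁ h₂
    (fun m s y => (k.1 = true → c.dec₁ y (fun j => (s j).1) (fun j => (s j).2) = m.1) ∧
          (k.2 = true → c.dec₂ y (fun j => (s j).1) (fun j => (s j).2) = m.2))
    (fun m s y h => by simp [← h])) (Real.logb_nonneg one_lt_two hnum)
  refine (sub_le_sub_right hle 1).trans (key.trans (le_of_eq ?_))
  have hsum := sum_path_eq_sum_codeU ch c hn (fun u t x₁ x₂ => ∑ y, ch.W x₁ x₂ t.1 t.2 y *
    Real.logb 2 (ch.W x₁ x₂ t.1 t.2 y / cribDen ch k (codeX₁ ch c u) (codeX₂ ch c u) t.1 t.2 x₁ x₂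
      y)) (by
        intro i s t z
        -- The integrand must ignore the stored state at time `i`, because that state is resampled.
        have e1 : codeX₁ ch c ⟨i, Function.update s i t, z⟩ = codeX₁ ch c ⟨i, s, z⟩ :=
          selLaw₁_congr ch c i z fun j hj => by simp only [Function.update_of_ne hj.ne]
        have e2 : codeX₂ ch c ⟨i, Function.update s i t, z⟩ = codeX₂ ch c ⟨i, s, z⟩ :=
          selLaw₂_congr ch c i z fun j hj => by simp only [Function.update_of_ne hj.ne]
        simp only [e1, e2])
  refine Eq.trans ?_ (hsum.trans ?_)
  · rfl
  · simp only [cribInfo, Fintype.sum_prod_type, Finset.mul_sum, mul_assoc]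

/-- Converse for the sum rate without cribbing. -/
lemma mul_logb_le_outInfo (hn : 0 < n) (h₁ : 0 < M₁) (h₂ : 0 < M₂) :
    (1 - errorProb ch c) * Real.logb 2 (numMsg M₁ M₂ (true, true)) - 1 ≤
      n * outInfo ch (codeU ch c) (codeX₁ ch c) (codeX₂ ch c) := by
  classical
  have hnum := logb_numMsg_nonneg h₁ h₂ (true, true)
  have h₁' : (0 : ℝ) < M₁ := by exact_mod_cast h₁
  have h₂' : (0 : ℝ) < M₂ := by exact_mod_cast h₂
  have hn' : (0 : ℝ) < n := by exact_mod_cast hn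
  have hU := codeU_mem ch c hn h₁ h₂
  -- The reference output law may be chosen freely. Taking the time-averaged law at every time gives
  -- `outInfo` of the averaged law directly, without a separate concavity argument.
  set q := outLaw ch (codeU ch c) (codeX₁ ch c) (codeX₂ ch c) with hq
  have hq0 : ∀ s₁ s₂ y, 0 ≤ q s₁ s₂ y := fun s₁ s₂ y =>
    Finset.sum_nonneg fun u _ => Finset.sum_nonneg fun x₁ _ => Finset.sum_nonneg fun x₂ _ =>
      mul_nonneg (mul_nonneg (mul_nonneg (hU.1 u) ((codeX₁_mem ch c u s₁).1 x₁))
        ((codeX₂_mem ch c u s₂).1 x₂)) (W_nonneg ..)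
  have hq1 : ∀ s₁ s₂, ∑ y, q s₁ s₂ y = 1 := fun s₁ s₂ => by
    rw [hq, sum_outLaw ch (codeX₁_mem ch c) (codeX₂_mem ch c), hU.2]
  have key := mul_logb_sub_one_le ch c h₁ h₂ (fun _ s i y => q (s i).1 (s i).2 y)
    (fun _ _ _ _ => hq0 ..)
    (fun m s y h i => by
      obtain ⟨hS, hW⟩ := pos_of_codeProb_pos ch c h
      have hcomp := (pathCrib_eq_iff ch c m s i _).1 rfl
      have hu : 0 < codeU ch c ⟨i, s, fun j => pathCrib ch c m s j⟩ := by
        have c1 : (0 : ℝ) < ((compSet₁ ch c i (fun j => (s j).1)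
          fun j => pathCrib ch c m s j).card : ℝ) := by
          exact_mod_cast Finset.card_pos.2 ⟨_, hcomp.1⟩
        have c2 : (0 : ℝ) < ((compSet₂ ch c i (fun j => (s j).2)
          fun j => pathCrib ch c m s j).card : ℝ) := by
          exact_mod_cast Finset.card_pos.2 ⟨_, hcomp.2⟩
        exact mul_pos (inv_pos.2 hn') (mul_pos (inv_pos.2 (mul_pos h₁' h₂'))
          (mul_pos hS (mul_pos c1 c2)))
      exact outLaw_pos ch hU.1 (fun u s => (codeX₁_mem ch c u s).1)
        (fun u s => (codeX₂_mem ch c u s).1)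
        (u := ⟨i, s, fun j => pathCrib ch c m s j⟩) (mul_pos (mul_pos (mul_pos hu
          (selLaw₁_path_pos ch c m s i)) (selLaw₂_path_pos ch c m s i)) (hW i)))
    (fun m s y => (c.dec₁ y (fun j => (s j).1) (fun j => (s j).2),
      c.dec₂ y (fun j => (s j).1) (fun j => (s j).2)) = m)
    (K := numMsg M₁ M₂ (true, true)) (by linarith) (by
      have hle : ∀ m (s : Fin n → S₁ × S₂) (y : Fin n → Y),
          (if (c.dec₁ y (fun j => (s j).1) (fun j => (s j).2),
            c.dec₂ y (fun j => (s j).1) (fun j => (s j).2)) = m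
            then numMsg M₁ M₂ (true, true) else 1) ≤
          1 + if m = (c.dec₁ y (fun j => (s j).1) (fun j => (s j).2),
            c.dec₂ y (fun j => (s j).1) (fun j => (s j).2))
            then numMsg M₁ M₂ (true, true) else 0 := by
        intro m s y
        by_cases hm : m = (c.dec₁ y (fun j => (s j).1) (fun j => (s j).2),
            c.dec₂ y (fun j => (s j).1) (fun j => (s j).2))
        · simp [hm]
        · simp [hm, Ne.symm hm]
      have hy : ∀ s : Fin n → S₁ × S₂,
          ∑ y : Fin n → Y, ∏ i, q (s i).1 (s i).2 (y i) = 1 := fun s =>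
        sum_pi_prod_eq_one (fun i => q (s i).1 (s i).2) fun i => hq1 ..
      rw [Finset.sum_comm]
      simp only [← Finset.mul_sum]
      have hs : ∀ s : Fin n → S₁ × S₂, ∑ m, ∑ y : Fin n → Y, (∏ i, q (s i).1 (s i).2 (y i)) *
          (if (c.dec₁ y (fun j => (s j).1) (fun j => (s j).2),
            c.dec₂ y (fun j => (s j).1) (fun j => (s j).2)) = m
            then numMsg M₁ M₂ (true, true) else 1) ≤ 2 * (M₁ * M₂) := by
        intro s
        rw [Finset.sum_comm]
        calc _ ≤ ∑ y : Fin n → Y, (∏ i, q (s i).1 (s i).2 (y i)) * (2 * (M₁ * M₂)) := by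
              refine Finset.sum_le_sum fun y _ => ?_
              rw [← Finset.mul_sum]
              refine mul_le_mul_of_nonneg_left ((Finset.sum_le_sum fun m _ => hle m s y).trans ?_)
                (Finset.prod_nonneg fun i _ => hq0 ..)
              rw [Finset.sum_add_distrib, Finset.sum_ite_eq' Finset.univ]
              simp [numMsg]
              linarith
          _ = _ := by rw [← Finset.sum_mul, hy, one_mul]
      calc _ ≤ ((M₁ : ℝ) * M₂)⁻¹ * ∑ s : Fin n → S₁ × S₂, (∏ j, ch.pS (s j)) *
              (2 * (M₁ * M₂)) :=
            mul_le_mul_of_nonneg_left (Finset.sum_le_sum fun s _ =>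
              mul_le_mul_of_nonneg_left (hs s) (prod_pS_nonneg ch s)) (by positivity)
        _ = 2 := by
            rw [← Finset.sum_mul, sum_prod_pS]
            field_simp)
  have hle := mul_le_mul_of_nonneg_right (one_sub_errorProb_le ch c h₁ h₂
    (fun m s y => (c.dec₁ y (fun j => (s j).1) (fun j => (s j).2),
      c.dec₂ y (fun j => (s j).1) (fun j => (s j).2)) = m) (fun m s y h => h))
      (Real.logb_nonneg one_lt_two hnum)
  refine (sub_le_sub_right hle 1).trans (key.trans (le_of_eq ?_))
  have hsum := sum_path_eq_sum_codeU ch c hn (fun u t x₁ x₂ => ∑ y, ch.W x₁ x₂ t.1 t.2 y *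
    Real.logb 2 (ch.W x₁ x₂ t.1 t.2 y / q t.1 t.2 y)) (fun i s t z => rfl)
  refine Eq.trans ?_ (hsum.trans ?_)
  · rfl
  · simp only [outInfo, ← hq, Fintype.sum_prod_type, Finset.mul_sum, mul_assoc,
      mul_left_comm (codeU ch c _)]

lemma le_logb_natCeil_rpow (x : ℝ) : x ≤ Real.logb 2 (⌈(2 : ℝ) ^ x⌉₊ : ℝ) := by
  rw [Real.le_logb_iff_rpow_le one_lt_two]
  · exact Nat.le_ceil _
  · exact_mod_cast Nat.ceil_pos.2 (by positivity)

/-- Every achievable rate pair satisfies the rate bounds up to arbitrarily small slack. -/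
lemma exists_rateBounds_of_achievable {R : ℝ × ℝ} (hR : Achievable ch R) {δ : ℝ} (hδ : 0 < δ) :
    ∃ n : ℕ, ∃ pU : HistAlphabet S₁ S₂ Z₁ Z₂ n → ℝ, pU ∈ stdSimplex ℝ _ ∧
      ∃ pX₁ : HistAlphabet S₁ S₂ Z₁ Z₂ n → S₁ → X₁ → ℝ, (∀ u s₁, pX₁ u s₁ ∈ stdSimplex ℝ X₁) ∧
      ∃ pX₂ : HistAlphabet S₁ S₂ Z₁ Z₂ n → S₂ → X₂ → ℝ, (∀ u s₂, pX₂ u s₂ ∈ stdSimplex ℝ X₂) ∧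
        RateBounds ch pU pX₁ pX₂ (R.1 - δ) (R.2 - δ) := by
  obtain ⟨hR1, hR2, hach⟩ := hR
  -- The slack δ is spent in halves: the error probability costs ε r ≤ δ/2 for every r ≤ R₁ + R₂,
  -- and the lost bit costs 1/n ≤ δ/2. The bound ε ≤ 1 keeps the factor of the log-cardinality
  -- nonnegative.
  set ε := min 1 (δ / (2 * (R.1 + R.2 + 1))) with hε
  have hpos : 0 < 2 * (R.1 + R.2 + 1) := by linarith
  have hε0 : 0 < ε := lt_min one_pos (div_pos hδ hpos)
  have hε1 : ε ≤ 1 := min_le_left _ _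
  have hεR : ε * (2 * (R.1 + R.2 + 1)) ≤ δ := by
    rw [← le_div_iff₀ hpos]
    exact min_le_right _ _
  obtain ⟨n, ⟨c, hc⟩, hn⟩ := ((hach ε hε0).and (eventually_ge_atTop (⌈2 / δ⌉₊ + 1))).exists
  have hn0 : 0 < n := by omega
  have hn' : (0 : ℝ) < n := by exact_mod_cast hn0
  have hnδ : 2 ≤ n * δ := by
    have : 2 / δ ≤ n := (Nat.le_ceil _).trans (by exact_mod_cast (by omega))
    rwa [div_le_iff₀ hδ] at this
  have hM₁ : 0 < ⌈(2 : ℝ) ^ ((n : ℝ) * R.1)⌉₊ := Nat.ceil_pos.2 (by positivity)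
  have hM₂ : 0 < ⌈(2 : ℝ) ^ ((n : ℝ) * R.2)⌉₊ := Nat.ceil_pos.2 (by positivity)
  have hl₁ := le_logb_natCeil_rpow (n * R.1)
  have hl₂ := le_logb_natCeil_rpow (n * R.2)
  have hgen : ∀ (L F r : ℝ), 0 ≤ r → r ≤ R.1 + R.2 → n * r ≤ L →
      (1 - errorProb ch c) * L - 1 ≤ n * F → r - δ ≤ F := by
    intro L F r hr0 hr hL h
    have hnr : 0 ≤ n * r := by positivity
    have e1 : (1 - ε) * (n * r) ≤ (1 - errorProb ch c) * L :=
      (mul_le_mul_of_nonneg_left hL (by linarith)).trans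
        (mul_le_mul_of_nonneg_right (by linarith) (by linarith))
    have e2 : ε * (2 * r) ≤ δ := (mul_le_mul_of_nonneg_left (by linarith) hε0.le).trans hεR
    have e3 : n * (ε * (2 * r)) ≤ n * δ := mul_le_mul_of_nonneg_left e2 hn'.le
    have e4 : n * (r - δ) ≤ n * F := by nlinarith
    exact le_of_mul_le_mul_left e4 hn'
  have hU := codeU_mem ch c hn0 hM₁ hM₂
  refine ⟨n, codeU ch c, hU, codeX₁ ch c, codeX₁_mem ch c, codeX₂ ch c, codeX₂_mem ch c, ?_⟩
  rw [rateBounds_iff ch hU (codeX₁_mem ch c) (codeX₂_mem ch c)]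
  have hsum : n * (R.1 + R.2) ≤ Real.logb 2 (numMsg ⌈(2 : ℝ) ^ ((n : ℝ) * R.1)⌉₊
      ⌈(2 : ℝ) ^ ((n : ℝ) * R.2)⌉₊ (true, true)) := by
    simp only [numMsg, if_true]
    rw [Real.logb_mul (by exact_mod_cast hM₁.ne') (by exact_mod_cast hM₂.ne')]
    linarith
  have hk := mul_logb_le_sum_cribInfo ch c hn0 hM₁ hM₂
  have b1 := hgen _ _ R.1 hR1 (by linarith) (by simpa [numMsg] using hl₁) (hk (true, false))
  have b2 := hgen _ _ R.2 hR2 (by linarith) (by simpa [numMsg] using hl₂) (hk (false, true))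
  have b3 := hgen _ _ (R.1 + R.2) (by linarith) le_rfl hsum (hk (true, true))
  have b4 := hgen _ _ (R.1 + R.2) (by linarith) le_rfl hsum (mul_logb_le_outInfo ch c hn0 hM₁ hM₂)
  exact ⟨b1, b2, by linarith, by linarith⟩

end Converse

end CribMAC
end

noncomputable section
namespace CribMAC

set_option linter.unusedSectionVars false

/-! ### Achievability: code trees -/

section TreeCode

variable {S₁ S₂ X₁ X₂ Y Z₁ Z₂ U : Type*} [Fintype S₁] [Fintype S₂] [Fintype X₁] [Fintype X₂]
  [Fintype Y] [Fintype Z₁] [Fintype Z₂] [Fintype U]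
  (ch : Channel S₁ S₂ X₁ X₂ Y Z₁ Z₂) {n M₁ M₂ : ℕ}

/-- The content of a node of a code tree: an auxiliary letter and, for each message of each
encoder, a map from auxiliary letters and states to inputs. -/
abbrev Node (S₁ S₂ X₁ X₂ U : Type*) (M₁ M₂ : ℕ) : Type _ :=
  U × (Fin M₁ → U → S₁ → X₁) × (Fin M₂ → U → S₂ → X₂)

/-- The inputs that a node prescribes for a message pair and a state pair. -/
def Node.input (ξ : Node S₁ S₂ X₁ X₂ U M₁ M₂) (m : Fin M₁ × Fin M₂) (t : S₁ × S₂) : X₁ × X₂ :=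
  (ξ.2.1 m.1 ξ.1 t.1, ξ.2.2 m.2 ξ.1 t.2)

/-- A code tree has a node for every time and every history of cribbed signals. -/
abbrev CodeTree (S₁ S₂ X₁ X₂ Z₁ Z₂ U : Type*) (n M₁ M₂ : ℕ) : Type _ :=
  (i : Fin n) → (Set.Iio i → Z₁ × Z₂) → Node S₁ S₂ X₁ X₂ U M₁ M₂

/-- The inputs along the path of a message pair in a code tree. -/
def treeIn (C : CodeTree S₁ S₂ X₁ X₂ Z₁ Z₂ U n M₁ M₂) (m : Fin M₁ × Fin M₂)
    (s : Fin n → S₁ × S₂) (i : Fin n) : X₁ × X₂ :=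
  (C i fun j => (ch.z₁ (treeIn C m s j).1 (s j).1, ch.z₂ (treeIn C m s j).2 (s j).2)).input m (s i)
termination_by i
decreasing_by all_goals exact j.2

/-- The cribbed signals along the path of a message pair in a code tree. -/
def treeCrib (C : CodeTree S₁ S₂ X₁ X₂ Z₁ Z₂ U n M₁ M₂) (m : Fin M₁ × Fin M₂)
    (s : Fin n → S₁ × S₂) (i : Fin n) : Z₁ × Z₂ :=
  (ch.z₁ (treeIn ch C m s i).1 (s i).1, ch.z₂ (treeIn ch C m s i).2 (s i).2)

/-- The node visited at time `i`. -/
def treeNode (C : CodeTree S₁ S₂ X₁ X₂ Z₁ Z₂ U n M₁ M₂) (m : Fin M₁ × Fin M₂)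
    (s : Fin n → S₁ × S₂) (i : Fin n) : Node S₁ S₂ X₁ X₂ U M₁ M₂ :=
  C i fun j => treeCrib ch C m s j

lemma treeIn_eq (C : CodeTree S₁ S₂ X₁ X₂ Z₁ Z₂ U n M₁ M₂) (m : Fin M₁ × Fin M₂)
    (s : Fin n → S₁ × S₂) (i : Fin n) :
    treeIn ch C m s i = (treeNode ch C m s i).input m (s i) := by
  rw [treeIn]
  rfl

/-- Encoder 1 follows the path in the tree, computing its own cribbed signals. -/
def treeEnc₁ (C : CodeTree S₁ S₂ X₁ X₂ Z₁ Z₂ U n M₁ M₂) (i : Fin n) (m₁ : Fin M₁)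
    (s : Set.Iic i → S₁) (z : Set.Iio i → Z₂) : X₁ :=
  let ξ := C i fun j => (ch.z₁ (treeEnc₁ C j m₁
    (fun k =>
      s ⟨k, Set.mem_Iic.2 (le_trans (Set.mem_Iic.1 k.2) (le_of_lt (Set.mem_Iio.1 j.2)))⟩)
    (fun k => z ⟨k, Set.mem_Iio.2 (lt_trans (Set.mem_Iio.1 k.2) (Set.mem_Iio.1 j.2))⟩))
    (s ⟨j, Set.mem_Iic.2 (le_of_lt (Set.mem_Iio.1 j.2))⟩), z j)
  ξ.2.1 m₁ ξ.1 (s ⟨i, Set.mem_Iic.2 le_rfl⟩)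
termination_by i
decreasing_by exact j.2

/-- Encoder 2 follows the path in the tree, computing its own cribbed signals. -/
def treeEnc₂ (C : CodeTree S₁ S₂ X₁ X₂ Z₁ Z₂ U n M₁ M₂) (i : Fin n) (m₂ : Fin M₂)
    (s : Set.Iic i → S₂) (z : Set.Iio i → Z₁) : X₂ :=
  let ξ := C i fun j => (z j, ch.z₂ (treeEnc₂ C j m₂
    (fun k =>
      s ⟨k, Set.mem_Iic.2 (le_trans (Set.mem_Iic.1 k.2) (le_of_lt (Set.mem_Iio.1 j.2)))⟩)
    (fun k => z ⟨k, Set.mem_Iio.2 (lt_trans (Set.mem_Iio.1 k.2) (Set.mem_Iio.1 j.2))⟩))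
    (s ⟨j, Set.mem_Iic.2 (le_of_lt (Set.mem_Iio.1 j.2))⟩))
  ξ.2.2 m₂ ξ.1 (s ⟨i, Set.mem_Iic.2 le_rfl⟩)
termination_by i
decreasing_by exact j.2

/-- The block code given by a code tree and a decoder. -/
def treeCode (C : CodeTree S₁ S₂ X₁ X₂ Z₁ Z₂ U n M₁ M₂)
    (d : (Fin n → Y) → (Fin n → S₁ × S₂) → Fin M₁ × Fin M₂) :
    Code S₁ S₂ X₁ X₂ Y Z₁ Z₂ n M₁ M₂ where
  enc₁ i m₁ s z := treeEnc₁ ch C i m₁ s z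
  enc₂ i m₂ s z := treeEnc₂ ch C i m₂ s z
  dec₁ y s₁ s₂ := (d y fun j => (s₁ j, s₂ j)).1
  dec₂ y s₁ s₂ := (d y fun j => (s₁ j, s₂ j)).2

/-- Encoder 1 reconstructs its own earlier inputs, hence its own crib, and receives the crib of
encoder 2. By induction it finds the common node of the tree from causal information. -/
lemma treeEnc₁_eq (C : CodeTree S₁ S₂ X₁ X₂ Z₁ Z₂ U n M₁ M₂) (m : Fin M₁ × Fin M₂)
    (s : Fin n → S₁ × S₂) (i : Fin n) :
    treeEnc₁ ch C i m.1 (fun j => (s j).1) (fun j => (treeCrib ch C m s j).2) =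
      (treeIn ch C m s i).1 := by
  induction i using WellFoundedLT.induction with
  | _ i ih =>
    rw [treeEnc₁, treeIn_eq, treeNode]
    have : ∀ j : Set.Iio i, treeEnc₁ ch C j m.1 (fun k => (s k).1)
        (fun k => (treeCrib ch C m s k).2) = (treeIn ch C m s j).1 := fun j => ih j j.2
    simp only [this]
    rfl

lemma treeEnc₂_eq (C : CodeTree S₁ S₂ X₁ X₂ Z₁ Z₂ U n M₁ M₂) (m : Fin M₁ × Fin M₂)
    (s : Fin n → S₁ × S₂) (i : Fin n) :
    treeEnc₂ ch C i m.2 (fun j => (s j).2) (fun j => (treeCrib ch C m s j).1) =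
      (treeIn ch C m s i).2 := by
  induction i using WellFoundedLT.induction with
  | _ i ih =>
    rw [treeEnc₂, treeIn_eq, treeNode]
    have : ∀ j : Set.Iio i, treeEnc₂ ch C j m.2 (fun k => (s k).2)
        (fun k => (treeCrib ch C m s k).1) = (treeIn ch C m s j).2 := fun j => ih j j.2
    simp only [this]
    rfl

lemma pathIn_treeCode (C : CodeTree S₁ S₂ X₁ X₂ Z₁ Z₂ U n M₁ M₂)
    (d : (Fin n → Y) → (Fin n → S₁ × S₂) → Fin M₁ × Fin M₂) (m : Fin M₁ × Fin M₂)
    (s : Fin n → S₁ × S₂) (i : Fin n) :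
    pathIn ch (treeCode ch C d) m s i = treeIn ch C m s i := by
  induction i using WellFoundedLT.induction with
  | _ i ih =>
    have hz : ∀ j : Set.Iio i, pathCrib ch (treeCode ch C d) m s j = treeCrib ch C m s j := by
      intro j
      rw [pathCrib, ih j j.2, treeCrib]
    rw [pathIn_eq]
    simp only [encIn₁, encIn₂, hz]
    exact Prod.ext (treeEnc₁_eq ch C m s i) (treeEnc₂_eq ch C m s i)

/-- A path up to time `i` uses no nodes of later levels, so a random tree can be revealed level by
level, with earlier factors adapted to the levels already seen. -/
lemma treeIn_update (C : CodeTree S₁ S₂ X₁ X₂ Z₁ Z₂ U n M₁ M₂) (m : Fin M₁ × Fin M₂)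
    (s : Fin n → S₁ × S₂) {i k : Fin n} (hik : i < k)
    (g : (Set.Iio k → Z₁ × Z₂) → Node S₁ S₂ X₁ X₂ U M₁ M₂) :
    treeIn ch (Function.update C k g) m s i = treeIn ch C m s i := by
  induction i using WellFoundedLT.induction with
  | _ i ih =>
    rw [treeIn, treeIn, Function.update_of_ne hik.ne]
    have : ∀ j : Set.Iio i, treeIn ch (Function.update C k g) m s j = treeIn ch C m s j :=
      fun j => ih j j.2 (lt_trans j.2 hik)
    simp only [this]

lemma treeCrib_update (C : CodeTree S₁ S₂ X₁ X₂ Z₁ Z₂ U n M₁ M₂) (m : Fin M₁ × Fin M₂)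
    (s : Fin n → S₁ × S₂) {i k : Fin n} (hik : i < k)
    (g : (Set.Iio k → Z₁ × Z₂) → Node S₁ S₂ X₁ X₂ U M₁ M₂) :
    treeCrib ch (Function.update C k g) m s i = treeCrib ch C m s i := by
  rw [treeCrib, treeIn_update ch C m s hik, treeCrib]

lemma treeNode_update (C : CodeTree S₁ S₂ X₁ X₂ Z₁ Z₂ U n M₁ M₂) (m : Fin M₁ × Fin M₂)
    (s : Fin n → S₁ × S₂) {i k : Fin n} (hik : i < k)
    (g : (Set.Iio k → Z₁ × Z₂) → Node S₁ S₂ X₁ X₂ U M₁ M₂) :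
    treeNode ch (Function.update C k g) m s i = treeNode ch C m s i := by
  rw [treeNode, Function.update_of_ne hik.ne, treeNode]
  congr 1
  funext j
  exact treeCrib_update ch C m s (lt_trans (Set.mem_Iio.1 j.2) hik) g

lemma treeNode_update_self (C : CodeTree S₁ S₂ X₁ X₂ Z₁ Z₂ U n M₁ M₂) (m : Fin M₁ × Fin M₂)
    (s : Fin n → S₁ × S₂) (k : Fin n)
    (g : (Set.Iio k → Z₁ × Z₂) → Node S₁ S₂ X₁ X₂ U M₁ M₂) :
    treeNode ch (Function.update C k g) m s k = g fun j => treeCrib ch C m s j := by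
  rw [treeNode, Function.update_self]
  congr 1
  funext j
  exact treeCrib_update ch C m s (Set.mem_Iio.1 j.2) g

end TreeCode

/-! ### Achievability: the law of a random node -/

section Weights

variable {S₁ S₂ X₁ X₂ Z₁ Z₂ U : Type*} [Fintype S₁] [Fintype S₂] [Fintype X₁] [Fintype X₂]
  [Fintype Z₁] [Fintype Z₂] [Fintype U] [DecidableEq U] [DecidableEq S₁] [DecidableEq S₂]
  {n M₁ M₂ : ℕ} (pU : U → ℝ) (pX₁ : U → S₁ → X₁ → ℝ)
  (pX₂ : U → S₂ → X₂ → ℝ)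

/-- The law of a random node. -/
def nodeWeight (ξ : Node S₁ S₂ X₁ X₂ U M₁ M₂) : ℝ :=
  pU ξ.1 * ((∏ m, ∏ u, ∏ t, pX₁ u t (ξ.2.1 m u t)) * ∏ m, ∏ u, ∏ t, pX₂ u t (ξ.2.2 m u t))

lemma nodeWeight_nonneg (hU : ∀ u, 0 ≤ pU u) (h₁ : ∀ u s x, 0 ≤ pX₁ u s x)
    (h₂ : ∀ u s x, 0 ≤ pX₂ u s x) (ξ : Node S₁ S₂ X₁ X₂ U M₁ M₂) :
    0 ≤ nodeWeight pU pX₁ pX₂ ξ :=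
  mul_nonneg (hU _) (mul_nonneg
    (Finset.prod_nonneg fun _ _ => Finset.prod_nonneg fun _ _ => Finset.prod_nonneg fun _ _ =>
      h₁ ..)
    (Finset.prod_nonneg fun _ _ => Finset.prod_nonneg fun _ _ => Finset.prod_nonneg fun _ _ =>
      h₂ ..))

lemma pos_of_nodeWeight_ne_zero (hU : ∀ u, 0 ≤ pU u) (h₁ : ∀ u s x, 0 ≤ pX₁ u s x)
    (h₂ : ∀ u s x, 0 ≤ pX₂ u s x) {ξ : Node S₁ S₂ X₁ X₂ U M₁ M₂}
    (h : nodeWeight pU pX₁ pX₂ ξ ≠ 0) (m : Fin M₁ × Fin M₂) (t : S₁ × S₂) :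
    0 < pU ξ.1 ∧ 0 < pX₁ ξ.1 t.1 (ξ.input m t).1 ∧ 0 < pX₂ ξ.1 t.2 (ξ.input m t).2 := by
  simp only [nodeWeight, mul_ne_zero_iff, Finset.prod_ne_zero_iff, Finset.mem_univ,
    true_implies] at h
  exact ⟨(hU _).lt_of_ne' h.1, (h₁ ..).lt_of_ne' (h.2.1 m.1 ξ.1 t.1),
    (h₂ ..).lt_of_ne' (h.2.2 m.2 ξ.1 t.2)⟩

lemma sum_nested_marginal {S X : Type*} [Fintype S] [Fintype X] [DecidableEq S]
    (q : U → S → X → ℝ)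
    (hq : ∀ u s, ∑ x, q u s x = 1) (u : U) (t : S) (H : X → ℝ) :
    ∑ g : U → S → X, (∏ u, ∏ t, q u t (g u t)) * H (g u t) = ∑ x, q u t x * H x := by
  rw [sum_pi_marginal (fun u (g : S → X) => ∏ t, q u t (g t))
    (fun u => sum_pi_prod_eq_one _ (hq u)) u fun g => H (g t)]
  exact sum_pi_marginal (q u) (hq u) t H

/-- Different messages at the same node have independent inputs, and equal messages have the same
input. `kern` covers both cases, which is why the same `cribDen` appears in achievability. -/
lemma sum_encoder_marginal {S X : Type*} [Fintype S] [Fintype X] [DecidableEq S] {M : ℕ}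
    (q : U → S → X → ℝ)
    (hq : ∀ u s, ∑ x, q u s x = 1) (u : U) (t : S) (m m' : Fin M) (G : X → X → ℝ) :
    ∑ f : Fin M → U → S → X, (∏ m, ∏ u, ∏ t, q u t (f m u t)) * G (f m u t) (f m' u t) =
      ∑ x', q u t x' * ∑ x, kern (decide (m ≠ m')) (q u t) x' x * G x x' := by
  classical
  have h1 : ∑ g : U → S → X, ∏ u, ∏ t, q u t (g u t) = 1 :=
    sum_pi_prod_eq_one (fun u (g : S → X) => ∏ t, q u t (g t))
      (fun u => sum_pi_prod_eq_one _ (hq u))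
  by_cases hm : m = m'
  · subst hm
    rw [sum_pi_marginal (fun (_ : Fin M) (g : U → S → X) => ∏ u, ∏ t, q u t (g u t))
      (fun _ => h1) m fun g => G (g u t) (g u t),
      sum_nested_marginal q hq u t fun x => G x x]
    simp [kern]
  · rw [sum_pi_marginal₂ (fun (_ : Fin M) (g : U → S → X) => ∏ u, ∏ t, q u t (g u t))
      (fun _ => h1) hm fun g g' => G (g u t) (g' u t)]
    have : ∀ x, ∑ g' : U → S → X, (∏ u, ∏ t, q u t (g' u t)) * G x (g' u t) =
        ∑ x', q u t x' * G x x' := fun x => sum_nested_marginal q hq u t fun x' => G x x'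
    simp only [this]
    rw [sum_nested_marginal q hq u t fun x => ∑ x', q u t x' * G x x']
    simp only [kern, ne_eq, hm, not_false_eq_true, decide_true, if_true, Finset.mul_sum]
    rw [Finset.sum_comm]
    exact Finset.sum_congr rfl fun x' _ => Finset.sum_congr rfl fun x _ => by ring

/-- The flags of the coordinates in which two message pairs differ. -/
def diffKind (m m' : Fin M₁ × Fin M₂) : Bool × Bool := (decide (m.1 ≠ m'.1), decide (m.2 ≠ m'.2))

/-- The joint law of the inputs of two message pairs at a random node. -/
lemma sum_nodeWeight_pair (h₁ : ∀ u s, ∑ x, pX₁ u s x = 1) (h₂ : ∀ u s, ∑ x, pX₂ u s x = 1)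
    (m m' : Fin M₁ × Fin M₂) (t : S₁ × S₂) (F : U → X₁ × X₂ → X₁ × X₂ → ℝ) :
    ∑ ξ, nodeWeight pU pX₁ pX₂ ξ * F ξ.1 (ξ.input m t) (ξ.input m' t) =
      ∑ u, ∑ x₁', ∑ x₂', pU u * pX₁ u t.1 x₁' * pX₂ u t.2 x₂' *
        ∑ x₁, ∑ x₂, kern (diffKind m m').1 (pX₁ u t.1) x₁' x₁ *
          kern (diffKind m m').2 (pX₂ u t.2) x₂' x₂ * F u (x₁, x₂) (x₁', x₂') := by
  rw [Fintype.sum_prod_type]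
  refine Finset.sum_congr rfl fun u _ => ?_
  rw [Fintype.sum_prod_type]
  simp only [nodeWeight, Node.input, mul_assoc]
  simp only [← Finset.mul_sum]
  have e2 : ∀ a a', ∑ f₂ : Fin M₂ → U → S₂ → X₂, (∏ m, ∏ u, ∏ t, pX₂ u t (f₂ m u t)) *
      F u (a, f₂ m.2 u t.2) (a', f₂ m'.2 u t.2) = _ := fun a a' =>
    sum_encoder_marginal pX₂ h₂ u t.2 m.2 m'.2 fun b b' => F u (a, b) (a', b')
  simp only [e2]
  rw [sum_encoder_marginal pX₁ h₁ u t.1 m.1 m'.1 fun a a' => ∑ x₂', pX₂ u t.2 x₂' *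
    ∑ x₂, kern (decide (m.2 ≠ m'.2)) (pX₂ u t.2) x₂' x₂ * F u (a, x₂) (a', x₂')]
  simp only [Finset.mul_sum, diffKind]
  refine Finset.sum_congr rfl fun x₁' _ => ?_
  rw [Finset.sum_comm]
  refine Finset.sum_congr rfl fun x₂' _ => Finset.sum_congr rfl fun x₁ _ =>
    Finset.sum_congr rfl fun x₂ _ => by ring

/-- The law of the inputs of a message pair at a random node. -/
lemma sum_nodeWeight_single (h₁ : ∀ u s, ∑ x, pX₁ u s x = 1) (h₂ : ∀ u s, ∑ x, pX₂ u s x = 1)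
    (m : Fin M₁ × Fin M₂) (t : S₁ × S₂) (F : U → X₁ × X₂ → ℝ) :
    ∑ ξ, nodeWeight pU pX₁ pX₂ ξ * F ξ.1 (ξ.input m t) =
      ∑ u, ∑ x₁, ∑ x₂, pU u * pX₁ u t.1 x₁ * pX₂ u t.2 x₂ * F u (x₁, x₂) := by
  classical
  rw [sum_nodeWeight_pair pU pX₁ pX₂ h₁ h₂ m m t fun u x _ => F u x]
  refine Finset.sum_congr rfl fun u _ => Finset.sum_congr rfl fun x₁ _ =>
    Finset.sum_congr rfl fun x₂ _ => ?_
  simp [diffKind, kern]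

lemma sum_nodeWeight (hU : ∑ u, pU u = 1) (h₁ : ∀ u s, ∑ x, pX₁ u s x = 1)
    (h₂ : ∀ u s, ∑ x, pX₂ u s x = 1) :
    ∑ ξ : Node S₁ S₂ X₁ X₂ U M₁ M₂, nodeWeight pU pX₁ pX₂ ξ = 1 := by
  have e₁ : ∑ f : Fin M₁ → U → S₁ → X₁, ∏ m, ∏ u, ∏ t, pX₁ u t (f m u t) = 1 := by
    classical
    exact sum_pi_prod_eq_one (fun _ (g : U → S₁ → X₁) => ∏ u, ∏ t, pX₁ u t (g u t)) fun _ =>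
      sum_pi_prod_eq_one (fun u (g : S₁ → X₁) => ∏ t, pX₁ u t (g t))
      (fun u => sum_pi_prod_eq_one _ (h₁ u))
  have e₂ : ∑ f : Fin M₂ → U → S₂ → X₂, ∏ m, ∏ u, ∏ t, pX₂ u t (f m u t) = 1 := by
    classical
    exact sum_pi_prod_eq_one (fun _ (g : U → S₂ → X₂) => ∏ u, ∏ t, pX₂ u t (g u t)) fun _ =>
      sum_pi_prod_eq_one (fun u (g : S₂ → X₂) => ∏ t, pX₂ u t (g t))
      (fun u => sum_pi_prod_eq_one _ (h₂ u))
  simp only [Fintype.sum_prod_type, nodeWeight, ← Finset.mul_sum, e₂, mul_one, e₁, hU]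

end Weights

end CribMAC
end

noncomputable section
namespace CribMAC

set_option linter.unusedSectionVars false
set_option synthInstance.maxSize 1000

/-! ### Achievability: likelihood ratios of wrong message pairs -/

section RandomTree

variable {S₁ S₂ X₁ X₂ Y Z₁ Z₂ U : Type*} [Fintype S₁] [Fintype S₂] [Fintype X₁] [Fintype X₂]
  [Fintype Y] [Fintype Z₁] [Fintype Z₂] [Fintype U] [DecidableEq U] [DecidableEq S₁]
  [DecidableEq S₂] [DecidableEq Z₁] [DecidableEq Z₂]
  (ch : Channel S₁ S₂ X₁ X₂ Y Z₁ Z₂) {n M₁ M₂ : ℕ} (pU : U → ℝ) (pX₁ : U → S₁ → X₁ → ℝ)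
  (pX₂ : U → S₂ → X₂ → ℝ)

/-- The law of the nodes of a random code tree at one time. -/
def levelWeight {i : Fin n} (g : (Set.Iio i → Z₁ × Z₂) → Node S₁ S₂ X₁ X₂ U M₁ M₂) : ℝ :=
  ∏ h, nodeWeight pU pX₁ pX₂ (g h)

/-- The channel with paired arguments. -/
def pairW (x : X₁ × X₂) (t : S₁ × S₂) (y : Y) : ℝ := ch.W x.1 x.2 t.1 t.2 y

/-- The cribbed signals with paired arguments. -/
def pairCrib (x : X₁ × X₂) (t : S₁ × S₂) : Z₁ × Z₂ := (ch.z₁ x.1 t.1, ch.z₂ x.2 t.2)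

/-- The likelihood ratio against a path with the same cribbed signals. -/
def cribRatio (k : Bool × Bool) (u : U) (t : S₁ × S₂) (x : X₁ × X₂) (y : Y) : ℝ :=
  pairW ch x t y / cribDen ch k (pX₁ u) (pX₂ u) t.1 t.2 x.1 x.2 y

/-- The likelihood ratio against an independent path. -/
def outRatio (t : S₁ × S₂) (x : X₁ × X₂) (y : Y) : ℝ :=
  pairW ch x t y / outLaw ch pU pX₁ pX₂ t.1 t.2 y

/-- The likelihood ratio at time `i` against a path that diverges at time `r`. -/
def stepRatio (k : Bool × Bool) (r : ℕ) (i : Fin n) (u : U) (t : S₁ × S₂) (x : X₁ × X₂) (y : Y) :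
    ℝ :=
  if i.val < r then cribRatio ch pX₁ pX₂ k u t x y else if i.val = r then 1
  else outRatio ch pU pX₁ pX₂ t x y

/-- The likelihood ratio along the path of `m` against a path diverging at time `r`. -/
def treeRatio (k : Bool × Bool) (r : ℕ) (C : CodeTree S₁ S₂ X₁ X₂ Z₁ Z₂ U n M₁ M₂)
    (m : Fin M₁ × Fin M₂) (s : Fin n → S₁ × S₂) (y : Fin n → Y) : ℝ :=
  ∏ i, stepRatio ch pU pX₁ pX₂ k r i (treeNode ch C m s i).1 (s i) (treeIn ch C m s i) (y i)

lemma pairW_nonneg (x : X₁ × X₂) (t : S₁ × S₂) (y : Y) : 0 ≤ pairW ch x t y := W_nonneg ..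

variable {pU pX₁ pX₂}

lemma outLaw_nonneg (hU : pU ∈ stdSimplex ℝ U) (h₁ : ∀ u s, pX₁ u s ∈ stdSimplex ℝ X₁)
    (h₂ : ∀ u s, pX₂ u s ∈ stdSimplex ℝ X₂) (s₁ : S₁) (s₂ : S₂) (y : Y) :
    0 ≤ outLaw ch pU pX₁ pX₂ s₁ s₂ y :=
  Finset.sum_nonneg fun u _ => Finset.sum_nonneg fun x₁ _ => Finset.sum_nonneg fun x₂ _ =>
    mul_nonneg (mul_nonneg (mul_nonneg (hU.1 u) ((h₁ u s₁).1 x₁)) ((h₂ u s₂).1 x₂)) (W_nonneg ..)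

lemma cribRatio_nonneg (h₁ : ∀ u s, pX₁ u s ∈ stdSimplex ℝ X₁)
    (h₂ : ∀ u s, pX₂ u s ∈ stdSimplex ℝ X₂) (k : Bool × Bool) (u : U) (t : S₁ × S₂)
    (x : X₁ × X₂) (y : Y) : 0 ≤ cribRatio ch pX₁ pX₂ k u t x y :=
  div_nonneg (pairW_nonneg ..) (cribLaw_nonneg ch k (fun s => (h₁ u s).1) (fun s => (h₂ u s).1) ..)

lemma outRatio_nonneg (hU : pU ∈ stdSimplex ℝ U) (h₁ : ∀ u s, pX₁ u s ∈ stdSimplex ℝ X₁)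
    (h₂ : ∀ u s, pX₂ u s ∈ stdSimplex ℝ X₂) (t : S₁ × S₂)
    (x : X₁ × X₂) (y : Y) : 0 ≤ outRatio ch pU pX₁ pX₂ t x y :=
  div_nonneg (pairW_nonneg ..) (outLaw_nonneg ch hU h₁ h₂ ..)

lemma stepRatio_nonneg (hU : pU ∈ stdSimplex ℝ U) (h₁ : ∀ u s, pX₁ u s ∈ stdSimplex ℝ X₁)
    (h₂ : ∀ u s, pX₂ u s ∈ stdSimplex ℝ X₂) (k : Bool × Bool) (r : ℕ) (i : Fin n) (u : U)
    (t : S₁ × S₂) (x : X₁ × X₂) (y : Y) : 0 ≤ stepRatio ch pU pX₁ pX₂ k r i u t x y := by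
  unfold stepRatio
  split_ifs
  · exact cribRatio_nonneg ch h₁ h₂ ..
  · exact zero_le_one
  · exact outRatio_nonneg ch hU h₁ h₂ ..

lemma levelWeight_nonneg (hU : pU ∈ stdSimplex ℝ U) (h₁ : ∀ u s, pX₁ u s ∈ stdSimplex ℝ X₁)
    (h₂ : ∀ u s, pX₂ u s ∈ stdSimplex ℝ X₂) {i : Fin n}
    (g : (Set.Iio i → Z₁ × Z₂) → Node S₁ S₂ X₁ X₂ U M₁ M₂) :
    0 ≤ levelWeight pU pX₁ pX₂ g :=
  Finset.prod_nonneg fun _ _ => nodeWeight_nonneg pU pX₁ pX₂ hU.1 (fun u s => (h₁ u s).1)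
    (fun u s => (h₂ u s).1) _

lemma sum_levelWeight (hU : pU ∈ stdSimplex ℝ U) (h₁ : ∀ u s, pX₁ u s ∈ stdSimplex ℝ X₁)
    (h₂ : ∀ u s, pX₂ u s ∈ stdSimplex ℝ X₂) (i : Fin n) :
    ∑ g : (Set.Iio i → Z₁ × Z₂) → Node S₁ S₂ X₁ X₂ U M₁ M₂, levelWeight pU pX₁ pX₂ g = 1 :=
  sum_pi_prod_eq_one (fun _ => nodeWeight pU pX₁ pX₂) fun _ =>
    sum_nodeWeight pU pX₁ pX₂ hU.2 (fun u s => (h₁ u s).2) (fun u s => (h₂ u s).2)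

lemma sum_levelWeight_mul (hU : pU ∈ stdSimplex ℝ U) (h₁ : ∀ u s, pX₁ u s ∈ stdSimplex ℝ X₁)
    (h₂ : ∀ u s, pX₂ u s ∈ stdSimplex ℝ X₂) {i : Fin n} (h : Set.Iio i → Z₁ × Z₂)
    (F : Node S₁ S₂ X₁ X₂ U M₁ M₂ → ℝ) :
    ∑ g : (Set.Iio i → Z₁ × Z₂) → Node S₁ S₂ X₁ X₂ U M₁ M₂, levelWeight pU pX₁ pX₂ g * F (g h) =
      ∑ ξ, nodeWeight pU pX₁ pX₂ ξ * F ξ :=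
  sum_pi_marginal (fun _ => nodeWeight pU pX₁ pX₂) (fun _ =>
    sum_nodeWeight pU pX₁ pX₂ hU.2 (fun u s => (h₁ u s).2) (fun u s => (h₂ u s).2)) h F

/-- Different histories lead to different, independent nodes; this applies to two paths that have
diverged. -/
lemma sum_levelWeight_mul₂ (hU : pU ∈ stdSimplex ℝ U) (h₁ : ∀ u s, pX₁ u s ∈ stdSimplex ℝ X₁)
    (h₂ : ∀ u s, pX₂ u s ∈ stdSimplex ℝ X₂) {i : Fin n} {h h' : Set.Iio i → Z₁ × Z₂} (hne : h ≠ h')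
    (F : Node S₁ S₂ X₁ X₂ U M₁ M₂ → Node S₁ S₂ X₁ X₂ U M₁ M₂ → ℝ) :
    ∑ g : (Set.Iio i → Z₁ × Z₂) → Node S₁ S₂ X₁ X₂ U M₁ M₂,
        levelWeight pU pX₁ pX₂ g * F (g h) (g h') =
      ∑ ξ, nodeWeight pU pX₁ pX₂ ξ * ∑ ξ', nodeWeight pU pX₁ pX₂ ξ' * F ξ ξ' :=
  sum_pi_marginal₂ (fun _ => nodeWeight pU pX₁ pX₂) (fun _ =>
    sum_nodeWeight pU pX₁ pX₂ hU.2 (fun u s => (h₁ u s).2) (fun u s => (h₂ u s).2)) hne F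

lemma sum_nodeWeight_pairW (h₁ : ∀ u s, pX₁ u s ∈ stdSimplex ℝ X₁)
    (h₂ : ∀ u s, pX₂ u s ∈ stdSimplex ℝ X₂) (m : Fin M₁ × Fin M₂) (t : S₁ × S₂) (y : Y) :
    ∑ ξ, nodeWeight pU pX₁ pX₂ ξ * pairW ch (ξ.input m t) t y = outLaw ch pU pX₁ pX₂ t.1 t.2 y :=
  sum_nodeWeight_single pU pX₁ pX₂ (fun u s => (h₁ u s).2) (fun u s => (h₂ u s).2) m t
    fun _ x => pairW ch x t y

/-- Before the divergence: the expected likelihood of the true path times the likelihood ratio of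
another path with the same cribbed signal. -/
lemma sum_nodeWeight_cribRatio_le (hU : pU ∈ stdSimplex ℝ U)
    (h₁ : ∀ u s, pX₁ u s ∈ stdSimplex ℝ X₁)
    (h₂ : ∀ u s, pX₂ u s ∈ stdSimplex ℝ X₂) (m m' : Fin M₁ × Fin M₂) (t : S₁ × S₂) (y : Y) :
    ∑ ξ, nodeWeight pU pX₁ pX₂ ξ *
      (if pairCrib ch (ξ.input m t) t = pairCrib ch (ξ.input m' t) t then
        pairW ch (ξ.input m t) t y *
          cribRatio ch pX₁ pX₂ (diffKind m m') ξ.1 t (ξ.input m' t) y else 0) ≤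
      outLaw ch pU pX₁ pX₂ t.1 t.2 y := by
  rw [sum_nodeWeight_pair pU pX₁ pX₂ (fun u s => (h₁ u s).2) (fun u s => (h₂ u s).2) m m' t
    fun u x x' => if pairCrib ch x t = pairCrib ch x' t then
        pairW ch x t y * cribRatio ch pX₁ pX₂ (diffKind m m') u t x' y else 0, outLaw]
  refine Finset.sum_le_sum fun u _ => Finset.sum_le_sum fun x₁' _ => Finset.sum_le_sum
    fun x₂' _ => mul_le_mul_of_nonneg_left ?_ (mul_nonneg (mul_nonneg (hU.1 u) ((h₁ u _).1 _))
      ((h₂ u _).1 _))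
  -- With the input of the wrong pair fixed, averaging the true likelihood over inputs with the same
  -- crib gives the denominator of `cribRatio`. After cancellation the likelihood of the wrong pair
  -- is left, whose mean is `outLaw`.
  have hden : ∑ x₁, ∑ x₂, kern (diffKind m m').1 (pX₁ u t.1) x₁' x₁ *
      kern (diffKind m m').2 (pX₂ u t.2) x₂' x₂ *
        (if pairCrib ch (x₁, x₂) t = pairCrib ch (x₁', x₂') t then
          pairW ch (x₁, x₂) t y * cribRatio ch pX₁ pX₂ (diffKind m m') u t (x₁', x₂') y else 0) =
      cribDen ch (diffKind m m') (pX₁ u) (pX₂ u) t.1 t.2 x₁' x₂' y *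
        cribRatio ch pX₁ pX₂ (diffKind m m') u t (x₁', x₂') y := by
    simp only [cribDen, cribLaw, Finset.sum_mul]
    refine Finset.sum_congr rfl fun x₁ _ => Finset.sum_congr rfl fun x₂ _ => ?_
    by_cases hz : ch.z₁ x₁ t.1 = ch.z₁ x₁' t.1 ∧ ch.z₂ x₂ t.2 = ch.z₂ x₂' t.2
    · simp only [pairCrib, hz, and_self, if_true, pairW, mul_assoc]
    · simp only [pairCrib, Prod.mk.injEq, hz, if_false, mul_zero, zero_mul]
  rw [hden, cribRatio]
  rcases eq_or_ne (cribDen ch (diffKind m m') (pX₁ u) (pX₂ u) t.1 t.2 x₁' x₂' y) 0 with h0 | h0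
  · rw [h0, zero_mul]
    exact W_nonneg ..
  · rw [mul_div_cancel₀ _ h0]
    exact le_rfl

/-- After the divergence: the two paths are independent. -/
lemma sum_nodeWeight_outRatio_le (hU : pU ∈ stdSimplex ℝ U)
    (h₁ : ∀ u s, pX₁ u s ∈ stdSimplex ℝ X₁)
    (h₂ : ∀ u s, pX₂ u s ∈ stdSimplex ℝ X₂) (m m' : Fin M₁ × Fin M₂) (t : S₁ × S₂) (y : Y) :
    ∑ ξ, nodeWeight pU pX₁ pX₂ ξ * ∑ ξ', nodeWeight pU pX₁ pX₂ ξ' *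
      (pairW ch (ξ.input m t) t y * outRatio ch pU pX₁ pX₂ t (ξ'.input m' t) y) ≤
      outLaw ch pU pX₁ pX₂ t.1 t.2 y := by
  have e : ∀ ξ : Node S₁ S₂ X₁ X₂ U M₁ M₂, ∑ ξ', nodeWeight pU pX₁ pX₂ ξ' *
      (pairW ch (ξ.input m t) t y * outRatio ch pU pX₁ pX₂ t (ξ'.input m' t) y) =
      pairW ch (ξ.input m t) t y * (outLaw ch pU pX₁ pX₂ t.1 t.2 y /
        outLaw ch pU pX₁ pX₂ t.1 t.2 y) := by
    intro ξ
    rw [← sum_nodeWeight_pairW ch h₁ h₂ m' t y, Finset.sum_div, Finset.mul_sum]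
    refine Finset.sum_congr rfl fun ξ' _ => ?_
    rw [outRatio, sum_nodeWeight_pairW ch h₁ h₂ m' t y]
    ring
  simp only [e]
  simp only [← mul_assoc]
  rw [← Finset.sum_mul, sum_nodeWeight_pairW ch h₁ h₂ m t y]
  -- The mean of the ratio is 1, or 0 where the output law vanishes.
  exact mul_le_of_le_one_right (outLaw_nonneg ch hU h₁ h₂ ..) (div_self_le_one _)

lemma treeCrib_eq_pairCrib (C : CodeTree S₁ S₂ X₁ X₂ Z₁ Z₂ U n M₁ M₂) (m : Fin M₁ × Fin M₂)
    (s : Fin n → S₁ × S₂) (i : Fin n) :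
    treeCrib ch C m s i = pairCrib ch ((treeNode ch C m s i).input m (s i)) (s i) := by
  rw [treeCrib, treeIn_eq, pairCrib]

/-- The part of the likelihood of the path of `m` times the likelihood ratio of the path of `m'`
that belongs to time `i`, restricted to a divergence of the two paths at time `r`. -/
def divergeFactor (pU : U → ℝ) (pX₁ : U → S₁ → X₁ → ℝ) (pX₂ : U → S₂ → X₂ → ℝ)
    (m m' : Fin M₁ × Fin M₂) (s : Fin n → S₁ × S₂) (y : Fin n → Y) (r : ℕ)
    (i : Fin n) (C : CodeTree S₁ S₂ X₁ X₂ Z₁ Z₂ U n M₁ M₂) : ℝ :=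
  let x := (treeNode ch C m s i).input m (s i)
  let x' := (treeNode ch C m' s i).input m' (s i)
  if i.val < r then
    if pairCrib ch x (s i) = pairCrib ch x' (s i) then pairW ch x (s i) (y i) *
      cribRatio ch pX₁ pX₂ (diffKind m m') (treeNode ch C m' s i).1 (s i) x' (y i) else 0
  else if i.val = r then
    if pairCrib ch x (s i) = pairCrib ch x' (s i) then 0 else pairW ch x (s i) (y i)
  else pairW ch x (s i) (y i) * outRatio ch pU pX₁ pX₂ (s i) x' (y i)

lemma divergeFactor_nonneg (hU : pU ∈ stdSimplex ℝ U)
    (h₁ : ∀ u s, pX₁ u s ∈ stdSimplex ℝ X₁)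
    (h₂ : ∀ u s, pX₂ u s ∈ stdSimplex ℝ X₂) (m m' : Fin M₁ × Fin M₂) (s : Fin n → S₁ × S₂)
    (y : Fin n → Y) (r : ℕ) (i : Fin n) (C : CodeTree S₁ S₂ X₁ X₂ Z₁ Z₂ U n M₁ M₂) :
    0 ≤ divergeFactor ch pU pX₁ pX₂ m m' s y r i C := by
  unfold divergeFactor
  have a := cribRatio_nonneg (ch := ch) h₁ h₂
  have b := outRatio_nonneg (ch := ch) hU h₁ h₂
  have c := pairW_nonneg ch
  dsimp only
  split_ifs
  · exact mul_nonneg (c ..) (a ..)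
  · exact le_rfl
  · exact le_rfl
  · exact c ..
  · exact mul_nonneg (c ..) (b ..)

/-- The expected contribution of a wrong message pair whose path diverges at time `r`. -/
lemma sum_prod_divergeFactor_le (hU : pU ∈ stdSimplex ℝ U)
    (h₁ : ∀ u s, pX₁ u s ∈ stdSimplex ℝ X₁)
    (h₂ : ∀ u s, pX₂ u s ∈ stdSimplex ℝ X₂) (m m' : Fin M₁ × Fin M₂) (s : Fin n → S₁ × S₂)
    (y : Fin n → Y) (r : ℕ) :
    ∑ C : CodeTree S₁ S₂ X₁ X₂ Z₁ Z₂ U n M₁ M₂, (∏ i, levelWeight pU pX₁ pX₂ (C i)) *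
      ∏ i, divergeFactor ch pU pX₁ pX₂ m m' s y r i C ≤
      ∏ i, outLaw ch pU pX₁ pX₂ (s i).1 (s i).2 (y i) := by
  refine sum_prod_adapted_le (fun i => levelWeight pU pX₁ pX₂)
    (fun i g => levelWeight_nonneg hU h₁ h₂ g) (fun i => sum_levelWeight hU h₁ h₂ i)
    (divergeFactor ch pU pX₁ pX₂ m m' s y r) (divergeFactor_nonneg ch hU h₁ h₂ m m' s y r) ?_
    _ (fun i => outLaw_nonneg ch hU h₁ h₂ ..) ?_
  · intro j k hjk C g
    simp only [divergeFactor, treeNode_update ch C _ s hjk]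
  · intro i C hprev
    simp only [divergeFactor, treeNode_update_self]
    -- Nonvanishing earlier factors carry the information where the paths are: equal cribs before
    -- `r`, and hence a common node up to time `r`.
    have hcrib : ∀ j < i, j.val < r → treeCrib ch C m s j = treeCrib ch C m' s j := by
      intro j hj hjr
      by_contra hne
      refine hprev j hj ?_
      rw [treeCrib_eq_pairCrib, treeCrib_eq_pairCrib] at hne
      simp only [divergeFactor, hjr, if_true, hne, if_false]
    by_cases hir : i.val < r
    · have hh : (fun j : Set.Iio i => treeCrib ch C m s j) =
          fun j : Set.Iio i => treeCrib ch C m' s j :=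
        funext fun j => hcrib j j.2 (lt_trans (Fin.lt_def.1 (Set.mem_Iio.1 j.2)) hir)
      simp only [hir, if_true, hh]
      rw [sum_levelWeight_mul hU h₁ h₂ _ fun ξ => if pairCrib ch (ξ.input m (s i)) (s i) =
        pairCrib ch (ξ.input m' (s i)) (s i) then pairW ch (ξ.input m (s i)) (s i) (y i) *
          cribRatio ch pX₁ pX₂ (diffKind m m') ξ.1 (s i) (ξ.input m' (s i)) (y i) else 0]
      exact sum_nodeWeight_cribRatio_le ch hU h₁ h₂ m m' (s i) (y i)
    · simp only [hir, if_false]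
      by_cases hir' : i.val = r
      · simp only [hir', if_true]
        -- At the divergence the ratio was set to 1; dropping the indicator leaves the mean
        -- likelihood of the true path.
        refine le_trans (Finset.sum_le_sum fun g _ => mul_le_mul_of_nonneg_left
          (c := pairW ch ((g fun j => treeCrib ch C m s j).input m (s i)) (s i) (y i))
          ?_ (levelWeight_nonneg hU h₁ h₂ g)) ?_
        · split_ifs
          · exact pairW_nonneg ..
          · exact le_rfl
        · rw [sum_levelWeight_mul hU h₁ h₂ _ fun ξ => pairW ch (ξ.input m (s i)) (s i) (y i)]
          exact (sum_nodeWeight_pairW ch h₁ h₂ m (s i) (y i)).le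
      · simp only [hir', if_false]
        have hri : r < i.val := by omega
        let j : Fin n := ⟨r, hri.trans i.2⟩
        have hj : j < i := hri
        -- The nonzero factor at time `r` says that the cribs differ there, so the two histories
        -- stay different forever.
        have hne : (fun j : Set.Iio i => treeCrib ch C m s j) ≠
            fun j : Set.Iio i => treeCrib ch C m' s j := by
          intro heq
          have hj' := congrFun heq ⟨j, Set.mem_Iio.2 hj⟩
          refine hprev j hj ?_
          simp only [treeCrib_eq_pairCrib] at hj'
          simp [divergeFactor, j, hj']
        rw [sum_levelWeight_mul₂ hU h₁ h₂ hne fun ξ ξ' => pairW ch (ξ.input m (s i)) (s i) (y i) *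
          outRatio ch pU pX₁ pX₂ (s i) (ξ'.input m' (s i)) (y i)]
        exact sum_nodeWeight_outRatio_le ch hU h₁ h₂ m m' (s i) (y i)

open Classical in
/-- A wrong message pair that passes the threshold test has a large likelihood ratio against its
own divergence time. -/
lemma prod_pairW_mul_ite_le (hU : pU ∈ stdSimplex ℝ U)
    (h₁ : ∀ u s, pX₁ u s ∈ stdSimplex ℝ X₁)
    (h₂ : ∀ u s, pX₂ u s ∈ stdSimplex ℝ X₂) (m m' : Fin M₁ × Fin M₂) (s : Fin n → S₁ × S₂)
    (y : Fin n → Y) (C : CodeTree S₁ S₂ X₁ X₂ Z₁ Z₂ U n M₁ M₂) {τ : ℝ} (hτ : 0 < τ) :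
    (∏ i, pairW ch (treeIn ch C m s i) (s i) (y i)) *
      (if ∀ r ∈ Finset.range (n + 1), τ ≤ treeRatio ch pU pX₁ pX₂ (diffKind m m') r C m' s y
        then 1 else 0) ≤
      ∑ r ∈ Finset.range (n + 1), τ⁻¹ * ∏ i, divergeFactor ch pU pX₁ pX₂ m m' s y r i C := by
  have hnn : ∀ r ∈ Finset.range (n + 1),
      0 ≤ τ⁻¹ * ∏ i, divergeFactor ch pU pX₁ pX₂ m m' s y r i C := fun r _ =>
    mul_nonneg (inv_nonneg.2 hτ.le) (Finset.prod_nonneg fun i _ =>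
      divergeFactor_nonneg ch hU h₁ h₂ ..)
  split_ifs with hpass
  swap
  · rw [mul_zero]
    exact Finset.sum_nonneg hnn
  rw [mul_one]
  -- `r` is the first time at which the cribs differ, or `n` if they never do; hence the range of n
  -- + 1 values.
  obtain ⟨r, hr, hlt, heq⟩ : ∃ r ∈ Finset.range (n + 1),
      (∀ i : Fin n, i.val < r → treeCrib ch C m s i = treeCrib ch C m' s i) ∧
      (∀ i : Fin n, i.val = r → treeCrib ch C m s i ≠ treeCrib ch C m' s i) := by
    by_cases hall : ∀ i, treeCrib ch C m s i = treeCrib ch C m' s i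
    · exact ⟨n, by simp, fun i _ => hall i, fun i hi => absurd i.2 (by omega)⟩
    · push Not at hall
      obtain ⟨i, hi, hmin⟩ := WellFounded.has_min (wellFounded_lt (α := Fin n))
        {i | treeCrib ch C m s i ≠ treeCrib ch C m' s i} hall
      refine ⟨i, by simp, fun j hj => ?_, fun j hj => ?_⟩
      · by_contra hne
        exact hmin j hne hj
      · rw [Fin.ext hj]
        exact hi
  refine le_trans ?_ (Finset.single_le_sum hnn hr)
  have hprod : ∏ i, divergeFactor ch pU pX₁ pX₂ m m' s y r i C =
      (∏ i, pairW ch (treeIn ch C m s i) (s i) (y i)) *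
        treeRatio ch pU pX₁ pX₂ (diffKind m m') r C m' s y := by
    rw [treeRatio, ← Finset.prod_mul_distrib]
    refine Finset.prod_congr rfl fun i _ => ?_
    have h1 := hlt i
    have h2 := heq i
    rw [treeCrib_eq_pairCrib, treeCrib_eq_pairCrib] at h1 h2
    simp only [divergeFactor, stepRatio, treeIn_eq]
    by_cases hir : i.val < r
    · simp [hir, h1 hir]
    · by_cases hir' : i.val = r
      · simp [hir', h2 hir']
      · simp [hir, hir']
  rw [hprod, inv_mul_eq_div, le_div_iff₀ hτ]
  exact mul_le_mul_of_nonneg_left (hpass r hr) (Finset.prod_nonneg fun i _ => pairW_nonneg ..)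

lemma sum_pi_prod_eq {ι : Type*} [Fintype ι] [DecidableEq ι] {V : ι → Type*}
    [∀ i, Fintype (V i)] (w : ∀ i, V i → ℝ) :
    ∑ v : ∀ i, V i, ∏ i, w i (v i) = ∏ i, ∑ g, w i g := by
  rw [← Fintype.piFinset_univ, ← Finset.prod_univ_sum]

open Classical in
/-- The probability that a given wrong message pair passes the threshold test. -/
lemma sum_wrong_le (hU : pU ∈ stdSimplex ℝ U)
    (h₁ : ∀ u s, pX₁ u s ∈ stdSimplex ℝ X₁)
    (h₂ : ∀ u s, pX₂ u s ∈ stdSimplex ℝ X₂) (m m' : Fin M₁ × Fin M₂) {τ : ℝ} (hτ : 0 < τ) :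
    ∑ C : CodeTree S₁ S₂ X₁ X₂ Z₁ Z₂ U n M₁ M₂, (∏ i, levelWeight pU pX₁ pX₂ (C i)) *
      ∑ s : Fin n → S₁ × S₂, (∏ j, ch.pS (s j)) * ∑ y : Fin n → Y,
        (∏ i, pairW ch (treeIn ch C m s i) (s i) (y i)) *
      (if ∀ r ∈ Finset.range (n + 1), τ ≤ treeRatio ch pU pX₁ pX₂ (diffKind m m') r C m' s y
        then 1 else 0) ≤ (n + 1) * τ⁻¹ := by
  calc _ ≤ ∑ C : CodeTree S₁ S₂ X₁ X₂ Z₁ Z₂ U n M₁ M₂, (∏ i, levelWeight pU pX₁ pX₂ (C i)) *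
      ∑ s : Fin n → S₁ × S₂, (∏ j, ch.pS (s j)) * ∑ y : Fin n → Y,
        ∑ r ∈ Finset.range (n + 1), τ⁻¹ * ∏ i, divergeFactor ch pU pX₁ pX₂ m m' s y r i C := by
        refine Finset.sum_le_sum fun C _ => mul_le_mul_of_nonneg_left (Finset.sum_le_sum fun s _ =>
          mul_le_mul_of_nonneg_left (Finset.sum_le_sum fun y _ =>
            prod_pairW_mul_ite_le ch hU h₁ h₂ m m' s y C hτ) (prod_pS_nonneg ch s))
          (Finset.prod_nonneg fun i _ => levelWeight_nonneg hU h₁ h₂ _)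
    _ = ∑ s : Fin n → S₁ × S₂, (∏ j, ch.pS (s j)) * ∑ y : Fin n → Y,
        ∑ r ∈ Finset.range (n + 1), τ⁻¹ * ∑ C : CodeTree S₁ S₂ X₁ X₂ Z₁ Z₂ U n M₁ M₂,
          (∏ i, levelWeight pU pX₁ pX₂ (C i)) *
            ∏ i, divergeFactor ch pU pX₁ pX₂ m m' s y r i C := by
        simp only [Finset.mul_sum]
        rw [Finset.sum_comm]
        refine Finset.sum_congr rfl fun s _ => ?_
        rw [Finset.sum_comm]
        refine Finset.sum_congr rfl fun y _ => ?_
        rw [Finset.sum_comm]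
        refine Finset.sum_congr rfl fun r _ => Finset.sum_congr rfl fun C _ => by ring
    _ ≤ ∑ s : Fin n → S₁ × S₂, (∏ j, ch.pS (s j)) * ∑ y : Fin n → Y,
        ∑ r ∈ Finset.range (n + 1), τ⁻¹ * ∏ i, outLaw ch pU pX₁ pX₂ (s i).1 (s i).2 (y i) := by
        refine Finset.sum_le_sum fun s _ => mul_le_mul_of_nonneg_left (Finset.sum_le_sum fun y _ =>
          Finset.sum_le_sum fun r _ => mul_le_mul_of_nonneg_left
            (sum_prod_divergeFactor_le ch hU h₁ h₂ m m' s y r) (inv_nonneg.2 hτ.le))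
          (prod_pS_nonneg ch s)
    _ = (n + 1) * τ⁻¹ := by
        have hy : ∀ s : Fin n → S₁ × S₂,
            ∑ y : Fin n → Y, ∏ i, outLaw ch pU pX₁ pX₂ (s i).1 (s i).2 (y i) = 1 := fun s =>
          sum_pi_prod_eq_one (fun i => outLaw ch pU pX₁ pX₂ (s i).1 (s i).2) fun i => by
            rw [sum_outLaw ch h₁ h₂, hU.2]
        simp only [Finset.sum_const, Finset.card_range, nsmul_eq_mul, ← Finset.mul_sum, hy,
          ← Finset.sum_mul, sum_prod_pS]
        push_cast
        ring

end RandomTree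
end CribMAC
end

noncomputable section
namespace CribMAC

set_option linter.unusedSectionVars false
set_option synthInstance.maxSize 1000

/-! ### Achievability: threshold decoding and the random coding bound -/

section RandomCoding

variable {S₁ S₂ X₁ X₂ Y Z₁ Z₂ U : Type*} [Fintype S₁] [Fintype S₂] [Fintype X₁] [Fintype X₂]
  [Fintype Y] [Fintype Z₁] [Fintype Z₂] [Fintype U] [DecidableEq U] [DecidableEq S₁]
  [DecidableEq S₂] [DecidableEq Z₁] [DecidableEq Z₂]
  (ch : Channel S₁ S₂ X₁ X₂ Y Z₁ Z₂) {n M₁ M₂ : ℕ} (pU : U → ℝ) (pX₁ : U → S₁ → X₁ → ℝ)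
  (pX₂ : U → S₂ → X₂ → ℝ)

/-- The expectation over a random code tree, the states and the outputs when `m` is sent. -/
def treeMean (m : Fin M₁ × Fin M₂)
    (F : CodeTree S₁ S₂ X₁ X₂ Z₁ Z₂ U n M₁ M₂ → (Fin n → S₁ × S₂) → (Fin n → Y) → ℝ) : ℝ :=
  ∑ C : CodeTree S₁ S₂ X₁ X₂ Z₁ Z₂ U n M₁ M₂, (∏ i, levelWeight pU pX₁ pX₂ (C i)) *
    ∑ s : Fin n → S₁ × S₂, (∏ j, ch.pS (s j)) * ∑ y : Fin n → Y,
      (∏ i, pairW ch (treeIn ch C m s i) (s i) (y i)) * F C s y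

/-- The single-letter expectation. -/
def letterMean (f : U → S₁ × S₂ → X₁ × X₂ → Y → ℝ) : ℝ :=
  ∑ ω, jointPMF ch pU pX₁ pX₂ ω *
    f ω.1 (ω.2.1, ω.2.2.1) (ω.2.2.2.1, ω.2.2.2.2.1) ω.2.2.2.2.2

lemma treeMean_eq (m : Fin M₁ × Fin M₂)
    (F : CodeTree S₁ S₂ X₁ X₂ Z₁ Z₂ U n M₁ M₂ → (Fin n → S₁ × S₂) → (Fin n → Y) → ℝ) :
    treeMean ch pU pX₁ pX₂ m F =
      ∑ s : Fin n → S₁ × S₂, (∏ j, ch.pS (s j)) * ∑ y : Fin n → Y,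
        ∑ C : CodeTree S₁ S₂ X₁ X₂ Z₁ Z₂ U n M₁ M₂, (∏ i, levelWeight pU pX₁ pX₂ (C i)) *
          ((∏ i, pairW ch (treeIn ch C m s i) (s i) (y i)) * F C s y) := by
  simp only [treeMean, Finset.mul_sum]
  rw [Finset.sum_comm]
  refine Finset.sum_congr rfl fun s _ => ?_
  rw [Finset.sum_comm]
  exact Finset.sum_congr rfl fun y _ => Finset.sum_congr rfl fun C _ => by ring

lemma treeMean_add (m : Fin M₁ × Fin M₂)
    (F G : CodeTree S₁ S₂ X₁ X₂ Z₁ Z₂ U n M₁ M₂ → (Fin n → S₁ × S₂) → (Fin n → Y) → ℝ) :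
    treeMean ch pU pX₁ pX₂ m (fun C s y => F C s y + G C s y) =
      treeMean ch pU pX₁ pX₂ m F + treeMean ch pU pX₁ pX₂ m G := by
  simp only [treeMean, mul_add, Finset.sum_add_distrib]

lemma treeMean_sum {ι : Type*} (K : Finset ι) (m : Fin M₁ × Fin M₂)
    (F : ι → CodeTree S₁ S₂ X₁ X₂ Z₁ Z₂ U n M₁ M₂ → (Fin n → S₁ × S₂) → (Fin n → Y) → ℝ) :
    treeMean ch pU pX₁ pX₂ m (fun C s y => ∑ k ∈ K, F k C s y) =
      ∑ k ∈ K, treeMean ch pU pX₁ pX₂ m (F k) := by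
  classical
  induction K using Finset.induction_on with
  | empty => simp [treeMean]
  | insert a K ha ih => simp only [Finset.sum_insert ha, treeMean_add, ih]

variable {pU pX₁ pX₂}

lemma treeMean_mono (hU : pU ∈ stdSimplex ℝ U) (h₁ : ∀ u s, pX₁ u s ∈ stdSimplex ℝ X₁)
    (h₂ : ∀ u s, pX₂ u s ∈ stdSimplex ℝ X₂) (m : Fin M₁ × Fin M₂)
    {F G : CodeTree S₁ S₂ X₁ X₂ Z₁ Z₂ U n M₁ M₂ → (Fin n → S₁ × S₂) → (Fin n → Y) → ℝ}
    (hFG : ∀ C s y, F C s y ≤ G C s y) :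
    treeMean ch pU pX₁ pX₂ m F ≤ treeMean ch pU pX₁ pX₂ m G :=
  Finset.sum_le_sum fun C _ => mul_le_mul_of_nonneg_left (Finset.sum_le_sum fun s _ =>
    mul_le_mul_of_nonneg_left (Finset.sum_le_sum fun y _ =>
      mul_le_mul_of_nonneg_left (hFG C s y) (Finset.prod_nonneg fun _ _ => pairW_nonneg ..))
      (prod_pS_nonneg ch s)) (Finset.prod_nonneg fun _ _ => levelWeight_nonneg hU h₁ h₂ _)

lemma sum_pS_mul_eq_letterMean (f : U → S₁ × S₂ → X₁ × X₂ → Y → ℝ) :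
    ∑ t, ch.pS t * ∑ y, ∑ u, ∑ x₁, ∑ x₂, pU u * pX₁ u t.1 x₁ * pX₂ u t.2 x₂ *
      (pairW ch (x₁, x₂) t y * f u t (x₁, x₂) y) = letterMean ch pU pX₁ pX₂ f := by
  rw [letterMean, sum_jointPMF_mul]
  have e : ∀ t : S₁ × S₂, ch.pS t * ∑ y, ∑ u, ∑ x₁, ∑ x₂, pU u * pX₁ u t.1 x₁ * pX₂ u t.2 x₂ *
      (pairW ch (x₁, x₂) t y * f u t (x₁, x₂) y) = ∑ u, ∑ x₁, ∑ x₂, ∑ y,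
        ch.pS t * pU u * pX₁ u t.1 x₁ * pX₂ u t.2 x₂ * ch.W x₁ x₂ t.1 t.2 y *
          f u t (x₁, x₂) y := by
    intro t
    simp only [Finset.mul_sum]
    rw [Finset.sum_comm]
    refine Finset.sum_congr rfl fun u _ => ?_
    rw [Finset.sum_comm]
    refine Finset.sum_congr rfl fun x₁ _ => ?_
    rw [Finset.sum_comm]
    exact Finset.sum_congr rfl fun x₂ _ => Finset.sum_congr rfl fun y _ => by
      simp only [pairW]; ring
  simp only [e]
  rw [Finset.sum_comm]
  refine Finset.sum_congr rfl fun u _ => ?_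
  rw [Fintype.sum_prod_type]

/-- The expectation of a product of single-letter factors along the path of the message. -/
lemma sum_prod_path_le (hU : pU ∈ stdSimplex ℝ U) (h₁ : ∀ u s, pX₁ u s ∈ stdSimplex ℝ X₁)
    (h₂ : ∀ u s, pX₂ u s ∈ stdSimplex ℝ X₂) (m : Fin M₁ × Fin M₂)
    (f : Fin n → U → S₁ × S₂ → X₁ × X₂ → Y → ℝ) (hf : ∀ i u t x y, 0 ≤ f i u t x y) :
    treeMean ch pU pX₁ pX₂ m (fun C s y =>
      ∏ i, f i (treeNode ch C m s i).1 (s i) (treeIn ch C m s i) (y i)) ≤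
      ∏ i, letterMean ch pU pX₁ pX₂ (f i) := by
  let κ : Fin n → S₁ × S₂ → Y → ℝ := fun i t y =>
    ∑ u, ∑ x₁, ∑ x₂, pU u * pX₁ u t.1 x₁ * pX₂ u t.2 x₂ *
      (pairW ch (x₁, x₂) t y * f i u t (x₁, x₂) y)
  have hκ : ∀ i t y, 0 ≤ κ i t y := fun i t y =>
    Finset.sum_nonneg fun u _ => Finset.sum_nonneg fun x₁ _ => Finset.sum_nonneg fun x₂ _ =>
      mul_nonneg (mul_nonneg (mul_nonneg (hU.1 u) ((h₁ u t.1).1 x₁)) ((h₂ u t.2).1 x₂))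
        (mul_nonneg (pairW_nonneg ..) (hf ..))
  have hC : ∀ (s : Fin n → S₁ × S₂) (y : Fin n → Y),
      ∑ C : CodeTree S₁ S₂ X₁ X₂ Z₁ Z₂ U n M₁ M₂, (∏ i, levelWeight pU pX₁ pX₂ (C i)) *
          ((∏ i, pairW ch (treeIn ch C m s i) (s i) (y i)) *
            ∏ i, f i (treeNode ch C m s i).1 (s i) (treeIn ch C m s i) (y i)) ≤
        ∏ i, κ i (s i) (y i) := by
    intro s y
    simp only [← Finset.prod_mul_distrib, treeIn_eq]
    simp only [Finset.prod_mul_distrib (f := fun i => levelWeight _ _ _ _)]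
    refine sum_prod_adapted_le (fun i => levelWeight pU pX₁ pX₂)
      (fun i g => levelWeight_nonneg hU h₁ h₂ g) (fun i => sum_levelWeight hU h₁ h₂ i)
      (fun i C => pairW ch ((treeNode ch C m s i).input m (s i)) (s i) (y i) *
        f i (treeNode ch C m s i).1 (s i) ((treeNode ch C m s i).input m (s i)) (y i))
      (fun i C => mul_nonneg (pairW_nonneg ..) (hf ..)) ?_ _ (fun i => hκ i _ _) ?_
    · intro j k hjk C g
      simp only [treeNode_update ch C _ s hjk]
    · intro i C _
      simp only [treeNode_update_self]
      rw [sum_levelWeight_mul hU h₁ h₂ _ fun ξ => pairW ch (ξ.input m (s i)) (s i) (y i) *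
        f i ξ.1 (s i) (ξ.input m (s i)) (y i)]
      exact (sum_nodeWeight_single pU pX₁ pX₂ (fun u s => (h₁ u s).2) (fun u s => (h₂ u s).2) m
        (s i) fun u x => pairW ch x (s i) (y i) * f i u (s i) x (y i)).le
  rw [treeMean_eq]
  calc _ ≤ ∑ s : Fin n → S₁ × S₂, (∏ j, ch.pS (s j)) * ∑ y : Fin n → Y,
        ∏ i, κ i (s i) (y i) :=
        Finset.sum_le_sum fun s _ => mul_le_mul_of_nonneg_left
          (Finset.sum_le_sum fun y _ => hC s y) (prod_pS_nonneg ch s)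
    _ = ∏ i, letterMean ch pU pX₁ pX₂ (f i) := by
        have hy : ∀ s : Fin n → S₁ × S₂, ∑ y : Fin n → Y, ∏ i, κ i (s i) (y i) =
            ∏ i, ∑ y, κ i (s i) y := fun s => sum_pi_prod_eq fun i => κ i (s i)
        simp only [hy, ← Finset.prod_mul_distrib]
        rw [sum_pi_prod_eq fun i t => ch.pS t * ∑ y, κ i t y]
        exact Finset.prod_congr rfl fun i _ => sum_pS_mul_eq_letterMean ch (f i)

/-- On the support of the random code the likelihood ratios are positive. -/
lemma stepRatio_pos (hU : pU ∈ stdSimplex ℝ U) (h₁ : ∀ u s, pX₁ u s ∈ stdSimplex ℝ X₁)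
    (h₂ : ∀ u s, pX₂ u s ∈ stdSimplex ℝ X₂) (k : Bool × Bool) (r : ℕ) (i : Fin n) {u : U}
    {t : S₁ × S₂} {x : X₁ × X₂} {y : Y} (hu : 0 < pU u) (hx₁ : 0 < pX₁ u t.1 x.1)
    (hx₂ : 0 < pX₂ u t.2 x.2) (hW : 0 < pairW ch x t y) :
    0 < stepRatio ch pU pX₁ pX₂ k r i u t x y := by
  unfold stepRatio
  split_ifs
  · exact div_pos hW (cribDen_pos ch k (fun s => (h₁ u s).1) (fun s => (h₂ u s).1) hx₁ hx₂ hW)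
  · exact one_pos
  · exact div_pos hW (outLaw_pos ch hU.1 (fun u s => (h₁ u s).1) (fun u s => (h₂ u s).1)
      (mul_pos (mul_pos (mul_pos hu hx₁) hx₂) hW))

open Classical in
/-- The probability that the transmitted message pair fails a threshold test. -/
lemma treeMean_miss_le (hU : pU ∈ stdSimplex ℝ U) (h₁ : ∀ u s, pX₁ u s ∈ stdSimplex ℝ X₁)
    (h₂ : ∀ u s, pX₂ u s ∈ stdSimplex ℝ X₂) (m : Fin M₁ × Fin M₂) (k : Bool × Bool) (r : ℕ)
    {τ l : ℝ} (hτ : 0 < τ) (hl : 0 ≤ l) :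
    treeMean ch pU pX₁ pX₂ m (fun (C : CodeTree S₁ S₂ X₁ X₂ Z₁ Z₂ U n M₁ M₂) s y =>
      if treeRatio ch pU pX₁ pX₂ k r C m s y < τ then 1 else 0) ≤
      τ ^ l * ∏ i : Fin n, letterMean ch pU pX₁ pX₂
        (fun u t x y => stepRatio ch pU pX₁ pX₂ k r i u t x y ^ (-l)) := by
  have hsr := stepRatio_nonneg (n := n) ch hU h₁ h₂ k r
  refine le_trans ?_ (mul_le_mul_of_nonneg_left (sum_prod_path_le ch hU h₁ h₂ m
    (fun i u t x y => stepRatio ch pU pX₁ pX₂ k r i u t x y ^ (-l))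
    fun i u t x y => Real.rpow_nonneg (hsr ..) _) (Real.rpow_nonneg hτ.le _))
  simp only [treeMean_eq, Finset.mul_sum]
  refine Finset.sum_le_sum fun s _ => Finset.sum_le_sum fun y _ => Finset.sum_le_sum fun C _ => ?_
  have hw : ∀ i, 0 ≤ levelWeight pU pX₁ pX₂ (C i) := fun i => levelWeight_nonneg hU h₁ h₂ _
  have hP : ∀ i, 0 ≤ pairW ch (treeIn ch C m s i) (s i) (y i) := fun i => pairW_nonneg ..
  have hG : ∀ i, 0 ≤ stepRatio ch pU pX₁ pX₂ k r i (treeNode ch C m s i).1 (s i)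
      (treeIn ch C m s i) (y i) := fun i => hsr ..
  rw [mul_left_comm (τ ^ l)]
  refine mul_le_mul_of_nonneg_left ?_ (prod_pS_nonneg ch s)
  rw [mul_left_comm (τ ^ l)]
  -- Trees and outputs of weight zero contribute nothing; all others have a positive likelihood
  -- ratio, so its negative powers behave properly.
  by_cases hw0 : ∏ i, levelWeight pU pX₁ pX₂ (C i) = 0
  · rw [hw0, zero_mul, zero_mul]
  refine mul_le_mul_of_nonneg_left ?_ (Finset.prod_nonneg fun i _ => hw i)
  rw [mul_left_comm (τ ^ l)]
  by_cases hP0 : ∏ i, pairW ch (treeIn ch C m s i) (s i) (y i) = 0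
  · rw [hP0, zero_mul, zero_mul]
  refine mul_le_mul_of_nonneg_left ?_ (Finset.prod_nonneg fun i _ => hP i)
  rw [Real.finsetProd_rpow _ _ fun i _ => hG i]
  change _ ≤ τ ^ l * treeRatio ch pU pX₁ pX₂ k r C m s y ^ (-l)
  have hpos : 0 < treeRatio ch pU pX₁ pX₂ k r C m s y := by
    refine Finset.prod_pos fun i _ => ?_
    have hnode : nodeWeight pU pX₁ pX₂ (treeNode ch C m s i) ≠ 0 :=
      Finset.prod_ne_zero_iff.1 (Finset.prod_ne_zero_iff.1 hw0 i (Finset.mem_univ _)) _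
        (Finset.mem_univ _)
    obtain ⟨hu, hx₁, hx₂⟩ := pos_of_nodeWeight_ne_zero pU pX₁ pX₂ hU.1 (fun u s => (h₁ u s).1)
      (fun u s => (h₂ u s).1) hnode m (s i)
    rw [← treeIn_eq] at hx₁ hx₂
    exact stepRatio_pos ch hU h₁ h₂ k r i hu hx₁ hx₂
      ((hP i).lt_of_ne' (Finset.prod_ne_zero_iff.1 hP0 i (Finset.mem_univ _)))
  -- Markov's inequality for the power −l: if the ratio is below τ, then (τ/ratio)^l ≥ 1.
  split_ifs with hlt
  · rw [Real.rpow_neg hpos.le, ← div_eq_mul_inv, one_le_div (Real.rpow_pos_of_pos hpos _)]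
    exact Real.rpow_le_rpow hpos.le hlt.le hl
  · exact mul_nonneg (Real.rpow_nonneg hτ.le _) (Real.rpow_nonneg hpos.le _)

lemma pathW_treeCode (C : CodeTree S₁ S₂ X₁ X₂ Z₁ Z₂ U n M₁ M₂)
    (d : (Fin n → Y) → (Fin n → S₁ × S₂) → Fin M₁ × Fin M₂) (m : Fin M₁ × Fin M₂)
    (s : Fin n → S₁ × S₂) (i : Fin n) (y : Y) :
    pathW ch (treeCode ch C d) m s i y = pairW ch (treeIn ch C m s i) (s i) y := by
  rw [pathW, pathIn_treeCode, pairW]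

lemma errorProb_treeCode (C : CodeTree S₁ S₂ X₁ X₂ Z₁ Z₂ U n M₁ M₂)
    (d : (Fin n → Y) → (Fin n → S₁ × S₂) → Fin M₁ × Fin M₂) :
    errorProb ch (treeCode ch C d) = ∑ m, ((M₁ : ℝ) * M₂)⁻¹ * ∑ s : Fin n → S₁ × S₂,
      (∏ j, ch.pS (s j)) * ∑ y : Fin n → Y,
        (∏ i, pairW ch (treeIn ch C m s i) (s i) (y i)) * (if d y s ≠ m then 1 else 0) := by
  rw [errorProb_eq_sum]
  refine (sum_codeProb_mul ch (treeCode ch C d) fun m s y => if d y s ≠ m then 1 else 0).trans ?_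
  simp only [pathW_treeCode, Finset.mul_sum]

/-- The number of message pairs that differ from a given one in exactly the coordinates flagged by
`k` is at most `numMsg M₁ M₂ k`. -/
lemma card_diffKind_le (m : Fin M₁ × Fin M₂) (k : Bool × Bool) :
    ((Finset.univ.filter fun m' => diffKind m m' = k).card : ℝ) ≤ numMsg M₁ M₂ k := by
  classical
  have hsub : (Finset.univ.filter fun m' => diffKind m m' = k) ⊆
      (if k.1 then Finset.univ else {m.1}) ×ˢ (if k.2 then Finset.univ else {m.2}) := by
    intro m' hm'
    simp only [Finset.mem_filter, Finset.mem_univ, true_and] at hm'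
    subst hm'
    simp only [diffKind, Finset.mem_product]
    constructor
    · by_cases h : m.1 = m'.1 <;> simp [h]
    · by_cases h : m.2 = m'.2 <;> simp [h]
  have hcard := Finset.card_le_card hsub
  rw [Finset.card_product] at hcard
  refine (Nat.cast_le.2 hcard).trans (le_of_eq ?_)
  rcases k with ⟨_ | _, _ | _⟩ <;> simp [numMsg]

lemma sum_diffKind_le (m : Fin M₁ × Fin M₂) (K : Finset (Bool × Bool))
    (hK : ∀ m', m' ≠ m → diffKind m m' ∈ K) (f : Bool × Bool → ℝ) (hf : ∀ k, 0 ≤ f k) :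
    ∑ m' ∈ Finset.univ.filter (· ≠ m), f (diffKind m m') ≤ ∑ k ∈ K, numMsg M₁ M₂ k * f k := by
  classical
  rw [← Finset.sum_fiberwise_of_maps_to (g := diffKind m) (t := K)
    fun m' hm' => hK m' (Finset.mem_filter.1 hm').2]
  refine Finset.sum_le_sum fun k _ => ?_
  rw [Finset.sum_congr rfl fun m' hm' => by rw [(Finset.mem_filter.1 hm').2], Finset.sum_const,
    nsmul_eq_mul]
  refine mul_le_mul_of_nonneg_right (le_trans ?_ (card_diffKind_le m k)) (hf k)
  exact_mod_cast Finset.card_le_card (Finset.filter_subset_filter _ (Finset.filter_subset _ _))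

/-- The threshold tests that a message pair has to pass to be decoded. -/
def Passes (pU : U → ℝ) (pX₁ : U → S₁ → X₁ → ℝ) (pX₂ : U → S₂ → X₂ → ℝ)
    (K : Finset (Bool × Bool)) (τ : Bool × Bool → ℝ) (C : CodeTree S₁ S₂ X₁ X₂ Z₁ Z₂ U n M₁ M₂)
    (m : Fin M₁ × Fin M₂) (s : Fin n → S₁ × S₂) (y : Fin n → Y) : Prop :=
  ∀ k ∈ K, ∀ r ∈ Finset.range (n + 1), τ k ≤ treeRatio ch pU pX₁ pX₂ k r C m s y

open Classical in
/-- The threshold decoder. -/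
def thresholdDec (pU : U → ℝ) (pX₁ : U → S₁ → X₁ → ℝ) (pX₂ : U → S₂ → X₂ → ℝ)
    (K : Finset (Bool × Bool)) (τ : Bool × Bool → ℝ) (C : CodeTree S₁ S₂ X₁ X₂ Z₁ Z₂ U n M₁ M₂)
    (m₀ : Fin M₁ × Fin M₂) (y : Fin n → Y) (s : Fin n → S₁ × S₂) : Fin M₁ × Fin M₂ :=
  if h : ∃ m, Passes ch pU pX₁ pX₂ K τ C m s y then h.choose else m₀

open Classical in
/-- The union bound for the threshold decoder. -/
lemma ite_thresholdDec_ne_le (K : Finset (Bool × Bool)) (τ : Bool × Bool → ℝ)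
    (C : CodeTree S₁ S₂ X₁ X₂ Z₁ Z₂ U n M₁ M₂) (m₀ m : Fin M₁ × Fin M₂)
    (hK : ∀ m', m' ≠ m → diffKind m m' ∈ K) (y : Fin n → Y) (s : Fin n → S₁ × S₂) :
    (if thresholdDec ch pU pX₁ pX₂ K τ C m₀ y s ≠ m then (1 : ℝ) else 0) ≤
      (∑ k ∈ K, ∑ r ∈ Finset.range (n + 1),
        if treeRatio ch pU pX₁ pX₂ k r C m s y < τ k then 1 else 0) +
      ∑ m' ∈ Finset.univ.filter (· ≠ m),
        if ∀ r ∈ Finset.range (n + 1), τ (diffKind m m') ≤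
          treeRatio ch pU pX₁ pX₂ (diffKind m m') r C m' s y then 1 else 0 := by
  have h0 : ∀ p : Prop, (0 : ℝ) ≤ if p then 1 else 0 := fun p => by split_ifs <;> simp
  have hA : (0 : ℝ) ≤ ∑ k ∈ K, ∑ r ∈ Finset.range (n + 1),
      if treeRatio ch pU pX₁ pX₂ k r C m s y < τ k then 1 else 0 :=
    Finset.sum_nonneg fun k _ => Finset.sum_nonneg fun r _ => h0 _
  have hB : (0 : ℝ) ≤ ∑ m' ∈ Finset.univ.filter (· ≠ m),
        if ∀ r ∈ Finset.range (n + 1), τ (diffKind m m') ≤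
          treeRatio ch pU pX₁ pX₂ (diffKind m m') r C m' s y then 1 else 0 :=
    Finset.sum_nonneg fun k _ => h0 _
  split_ifs with hne
  swap
  · exact add_nonneg hA hB
  -- If the true pair passes, some pair was chosen by the decoder. If it is wrong, it passes in
  -- particular the tests of its own kind of difference.
  by_cases hm : Passes ch pU pX₁ pX₂ K τ C m s y
  · refine le_trans ?_ (le_add_of_nonneg_left hA)
    have hex : ∃ m, Passes ch pU pX₁ pX₂ K τ C m s y := ⟨m, hm⟩
    have hdec : Passes ch pU pX₁ pX₂ K τ C (thresholdDec ch pU pX₁ pX₂ K τ C m₀ y s) s y := by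
      rw [thresholdDec, dif_pos hex]
      exact hex.choose_spec
    have hmem : thresholdDec ch pU pX₁ pX₂ K τ C m₀ y s ∈ Finset.univ.filter (· ≠ m) := by
      simpa using hne
    refine le_trans ?_ (Finset.single_le_sum (fun m' _ => h0 _) hmem)
    rw [if_pos (hdec _ (hK _ hne))]
  · refine le_trans ?_ (le_add_of_nonneg_right hB)
    simp only [Passes, not_forall, not_le] at hm
    obtain ⟨k, hk, r, hr, hlt⟩ := hm
    refine le_trans ?_ (Finset.single_le_sum
      (fun k _ => Finset.sum_nonneg fun r _ => h0 _) hk)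
    refine le_trans ?_ (Finset.single_le_sum (fun r _ => h0 _) hr)
    rw [if_pos hlt]

/-- The random coding bound. -/
lemma exists_code (hU : pU ∈ stdSimplex ℝ U) (h₁ : ∀ u s, pX₁ u s ∈ stdSimplex ℝ X₁)
    (h₂ : ∀ u s, pX₂ u s ∈ stdSimplex ℝ X₂) (hM₁ : 0 < M₁) (hM₂ : 0 < M₂)
    (K : Finset (Bool × Bool)) (hK : ∀ m m' : Fin M₁ × Fin M₂, m' ≠ m → diffKind m m' ∈ K)
    (τ l : Bool × Bool → ℝ) (hτ : ∀ k, 0 < τ k) (hl : ∀ k, 0 ≤ l k) :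
    ∃ c : Code S₁ S₂ X₁ X₂ Y Z₁ Z₂ n M₁ M₂, errorProb ch c ≤
      (∑ k ∈ K, ∑ r ∈ Finset.range (n + 1), τ k ^ l k * ∏ i : Fin n,
        letterMean ch pU pX₁ pX₂ (fun u t x y => stepRatio ch pU pX₁ pX₂ k r i u t x y ^ (-l k))) +
      ∑ k ∈ K, numMsg M₁ M₂ k * ((n + 1) * (τ k)⁻¹) := by
  classical
  set B := (∑ k ∈ K, ∑ r ∈ Finset.range (n + 1), τ k ^ l k * ∏ i : Fin n,
        letterMean ch pU pX₁ pX₂ (fun u t x y => stepRatio ch pU pX₁ pX₂ k r i u t x y ^ (-l k))) +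
      ∑ k ∈ K, numMsg M₁ M₂ k * ((n + 1) * (τ k)⁻¹) with hB
  let m₀ : Fin M₁ × Fin M₂ := (⟨0, hM₁⟩, ⟨0, hM₂⟩)
  let w : CodeTree S₁ S₂ X₁ X₂ Z₁ Z₂ U n M₁ M₂ → ℝ := fun C => ∏ i, levelWeight pU pX₁ pX₂ (C i)
  let e : CodeTree S₁ S₂ X₁ X₂ Z₁ Z₂ U n M₁ M₂ → ℝ := fun C =>
    errorProb ch (treeCode ch C (thresholdDec ch pU pX₁ pX₂ K τ C m₀))
  have hm : ∀ m : Fin M₁ × Fin M₂, treeMean ch pU pX₁ pX₂ m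
      (fun (C : CodeTree S₁ S₂ X₁ X₂ Z₁ Z₂ U n M₁ M₂) s y =>
        if thresholdDec ch pU pX₁ pX₂ K τ C m₀ y s ≠ m then 1 else 0) ≤ B := by
    intro m
    refine (treeMean_mono ch hU h₁ h₂ m fun C s y =>
      ite_thresholdDec_ne_le ch K τ C m₀ m (hK m) y s).trans ?_
    rw [treeMean_add, treeMean_sum, treeMean_sum, hB]
    refine add_le_add (Finset.sum_le_sum fun k _ => ?_) ?_
    · rw [treeMean_sum]
      exact Finset.sum_le_sum fun r _ => treeMean_miss_le ch hU h₁ h₂ m k r (hτ k) (hl k)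
    · refine le_trans (Finset.sum_le_sum fun m' _ => ?_) (sum_diffKind_le m K (hK m)
        (fun k => (n + 1) * (τ k)⁻¹)
        fun k => mul_nonneg (by positivity) (inv_nonneg.2 (hτ k).le))
      exact sum_wrong_le ch hU h₁ h₂ m m' (hτ _)
  have hsum : ∑ C, w C * e C ≤ B := by
    have hswap : ∑ C, w C * e C = ∑ m : Fin M₁ × Fin M₂, ((M₁ : ℝ) * M₂)⁻¹ *
        treeMean ch pU pX₁ pX₂ m
          (fun (C : CodeTree S₁ S₂ X₁ X₂ Z₁ Z₂ U n M₁ M₂) s y =>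
        if thresholdDec ch pU pX₁ pX₂ K τ C m₀ y s ≠ m then 1 else 0) := by
      simp only [e, errorProb_treeCode, treeMean]
      simp only [Finset.mul_sum (Finset.univ : Finset (Fin M₁ × Fin M₂))]
      rw [Finset.sum_comm]
      refine Finset.sum_congr rfl fun m _ => ?_
      rw [Finset.mul_sum]
      exact Finset.sum_congr rfl fun C _ => mul_left_comm ..
    rw [hswap]
    refine (Finset.sum_le_sum fun m _ => mul_le_mul_of_nonneg_left (hm m)
      (by positivity)).trans (le_of_eq ?_)
    have h₁' : (M₁ : ℝ) ≠ 0 := by exact_mod_cast hM₁.ne'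
    have h₂' : (M₂ : ℝ) ≠ 0 := by exact_mod_cast hM₂.ne'
    simp
    field_simp
  have hw : ∑ C, w C = 1 := sum_pi_prod_eq_one (fun _ => levelWeight pU pX₁ pX₂)
    fun i => sum_levelWeight hU h₁ h₂ i
  -- Some tree is at least as good as the average: if every tree exceeded `B`, all weights would
  -- have to vanish.
  by_contra hcon
  push Not at hcon
  have hlt : ∀ C, B < e C := fun C => hcon _
  have hw0 : ∀ C, 0 ≤ w C := fun C => Finset.prod_nonneg fun i _ => levelWeight_nonneg hU h₁ h₂ _
  have : ∑ C, w C * (e C - B) ≤ 0 := by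
    simp only [mul_sub, Finset.sum_sub_distrib, ← Finset.sum_mul, hw]
    linarith
  have hzero := (Finset.sum_eq_zero_iff_of_nonneg fun C _ =>
    mul_nonneg (hw0 C) (sub_nonneg.2 (hlt C).le)).1 (le_antisymm this (Finset.sum_nonneg fun C _ =>
    mul_nonneg (hw0 C) (sub_nonneg.2 (hlt C).le)))
  have : ∑ C, w C = 0 := Finset.sum_eq_zero fun C hC =>
    (mul_eq_zero.1 (hzero C hC)).resolve_right (sub_pos.2 (hlt C)).ne'
  rw [hw] at this
  exact one_ne_zero this

end RandomCoding
end CribMAC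
end

noncomputable section
namespace CribMAC

set_option linter.unusedSectionVars false
set_option synthInstance.maxSize 1000

/-! ### Achievability: exponents, thresholds and the inner bound -/

section Achievability

variable {S₁ S₂ X₁ X₂ Y Z₁ Z₂ U : Type*} [Fintype S₁] [Fintype S₂] [Fintype X₁] [Fintype X₂]
  [Fintype Y] [Fintype Z₁] [Fintype Z₂] [Fintype U]
  (ch : Channel S₁ S₂ X₁ X₂ Y Z₁ Z₂) {pU : U → ℝ} {pX₁ : U → S₁ → X₁ → ℝ}
  {pX₂ : U → S₂ → X₂ → ℝ}

lemma sum_jointPMF (hU : pU ∈ stdSimplex ℝ U) (h₁ : ∀ u s, pX₁ u s ∈ stdSimplex ℝ X₁)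
    (h₂ : ∀ u s, pX₂ u s ∈ stdSimplex ℝ X₂) : ∑ ω, jointPMF ch pU pX₁ pX₂ ω = 1 := by
  have h := sum_jointPMF_mul ch (pU := pU) (pX₁ := pX₁) (pX₂ := pX₂) fun _ => 1
  simp only [mul_one] at h
  rw [h]
  simp only [← Finset.mul_sum, sum_W, mul_one, (h₁ _ _).2, (h₂ _ _).2]
  have hpS := ch.pS_mem.2
  rw [Fintype.sum_prod_type] at hpS
  simp only [← Finset.sum_mul, hpS, hU.2, one_mul]

/-- A product of factors at most one of which exceeds `ρ`. -/
lemma prod_le_pow_pred {n : ℕ} (a : Fin n → ℝ) (r : ℕ) {ρ : ℝ} (hρ : 0 ≤ ρ) (hρ1 : ρ ≤ 1)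
    (ha : ∀ i, 0 ≤ a i) (hne : ∀ i : Fin n, i.val ≠ r → a i ≤ ρ)
    (heq : ∀ i : Fin n, i.val = r → a i ≤ 1) : ∏ i, a i ≤ ρ ^ (n - 1) := by
  by_cases hr : r < n
  · let j : Fin n := ⟨r, hr⟩
    rw [← Finset.mul_prod_erase _ _ (Finset.mem_univ j)]
    refine (mul_le_of_le_one_left (Finset.prod_nonneg fun i _ => ha i) (heq j rfl)).trans ?_
    refine (Finset.prod_le_prod (fun i _ => ha i) fun i hi => hne i fun h =>
      (Finset.ne_of_mem_erase hi) (Fin.ext h)).trans (le_of_eq ?_)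
    rw [Finset.prod_const, Finset.card_erase_of_mem (Finset.mem_univ _), Finset.card_univ,
      Fintype.card_fin]
  · refine (Finset.prod_le_prod (fun i _ => ha i) fun i _ => hne i fun h =>
      hr (h ▸ i.2)).trans ?_
    rw [Finset.prod_const, Finset.card_univ, Fintype.card_fin]
    exact pow_le_pow_of_le_one hρ hρ1 (Nat.sub_le n 1)

/-- Both estimates hold for all sufficiently small positive exponents, so one `l` serves both ratios
and thus every divergence time `r`. -/
lemma exists_letterMean_rpow_le (hU : pU ∈ stdSimplex ℝ U)
    (h₁ : ∀ u s, pX₁ u s ∈ stdSimplex ℝ X₁) (h₂ : ∀ u s, pX₂ u s ∈ stdSimplex ℝ X₂)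
    (k : Bool × Bool) {J : ℝ} (hJ : J < ∑ u, pU u * cribInfo ch k (pX₁ u) (pX₂ u))
    (hJ' : J < outInfo ch pU pX₁ pX₂) :
    ∃ l : ℝ, 0 < l ∧
      letterMean ch pU pX₁ pX₂ (fun u t x y => cribRatio ch pX₁ pX₂ k u t x y ^ (-l)) ≤
        2 ^ (-(l * J)) ∧
      letterMean ch pU pX₁ pX₂ (fun _ t x y => outRatio ch pU pX₁ pX₂ t x y ^ (-l)) ≤
        2 ^ (-(l * J)) := by
  have hp := sum_jointPMF ch hU h₁ h₂
  rw [← sum_jointPMF_eq_cribInfo ch k] at hJ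
  have hout : outInfo ch pU pX₁ pX₂ = ∑ ω, jointPMF ch pU pX₁ pX₂ ω *
      Real.logb 2 (outRatio ch pU pX₁ pX₂ (ω.2.1, ω.2.2.1) (ω.2.2.2.1, ω.2.2.2.2.1)
        ω.2.2.2.2.2) := by
    rw [sum_jointPMF_mul]
    rfl
  rw [hout] at hJ'
  have e1 := eventually_sum_mul_rpow_le (jointPMF ch pU pX₁ pX₂)
    (fun ω => cribRatio ch pX₁ pX₂ k ω.1 (ω.2.1, ω.2.2.1) (ω.2.2.2.1, ω.2.2.2.2.1) ω.2.2.2.2.2)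
    hp (by
      rintro ⟨u, s₁, s₂, x₁, x₂, y⟩ hω
      obtain ⟨_, _, ha, hb, hW⟩ := pos_of_jointPMF_ne_zero ch hU.1 h₁ h₂ hω
      exact div_pos hW (cribDen_pos ch k (fun s => (h₁ u s).1) (fun s => (h₂ u s).1) ha hb hW)) hJ
  have e2 := eventually_sum_mul_rpow_le (jointPMF ch pU pX₁ pX₂)
    (fun ω => outRatio ch pU pX₁ pX₂ (ω.2.1, ω.2.2.1) (ω.2.2.2.1, ω.2.2.2.2.1) ω.2.2.2.2.2)
    hp (by
      rintro ⟨u, s₁, s₂, x₁, x₂, y⟩ hω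
      obtain ⟨_, hu, ha, hb, hW⟩ := pos_of_jointPMF_ne_zero ch hU.1 h₁ h₂ hω
      exact div_pos hW (outLaw_pos ch hU.1 (fun u s => (h₁ u s).1) (fun u s => (h₂ u s).1)
        (mul_pos (mul_pos (mul_pos hu ha) hb) hW))) hJ'
  obtain ⟨l, ⟨hl1, hl2⟩, hl⟩ := ((e1.and e2).and self_mem_nhdsWithin).exists
  exact ⟨l, hl, hl1, hl2⟩

lemma letterMean_nonneg (hU : pU ∈ stdSimplex ℝ U) (h₁ : ∀ u s, pX₁ u s ∈ stdSimplex ℝ X₁)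
    (h₂ : ∀ u s, pX₂ u s ∈ stdSimplex ℝ X₂) {f : U → S₁ × S₂ → X₁ × X₂ → Y → ℝ}
    (hf : ∀ u t x y, 0 ≤ f u t x y) : 0 ≤ letterMean ch pU pX₁ pX₂ f :=
  Finset.sum_nonneg fun ω _ => mul_nonneg (jointPMF_nonneg ch hU.1 h₁ h₂ ω) (hf ..)

/-- Every time contributes at most ρ except possibly time `r`, whose ratio is 1; hence the exponent
n − 1. -/
lemma prod_letterMean_stepRatio_le (hU : pU ∈ stdSimplex ℝ U)
    (h₁ : ∀ u s, pX₁ u s ∈ stdSimplex ℝ X₁) (h₂ : ∀ u s, pX₂ u s ∈ stdSimplex ℝ X₂)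
    (k : Bool × Bool) {l ρ : ℝ} (hρ : 0 ≤ ρ) (hρ1 : ρ ≤ 1)
    (hc : letterMean ch pU pX₁ pX₂ (fun u t x y => cribRatio ch pX₁ pX₂ k u t x y ^ (-l)) ≤ ρ)
    (ho : letterMean ch pU pX₁ pX₂ (fun _ t x y => outRatio ch pU pX₁ pX₂ t x y ^ (-l)) ≤ ρ)
    (n r : ℕ) :
    ∏ i : Fin n, letterMean ch pU pX₁ pX₂
      (fun u t x y => stepRatio ch pU pX₁ pX₂ k r i u t x y ^ (-l)) ≤ ρ ^ (n - 1) := by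
  classical
  refine prod_le_pow_pred _ r hρ hρ1 (fun i => letterMean_nonneg ch hU h₁ h₂ fun u t x y =>
    Real.rpow_nonneg (stepRatio_nonneg ch hU h₁ h₂ ..) _) (fun i hi => ?_) fun i hi => ?_
  · rcases hi.lt_or_gt with hlt | hgt
    · simpa only [stepRatio, hlt, if_true] using hc
    · simpa only [stepRatio, hgt.not_gt, hi, if_false] using ho
  · simp only [stepRatio, hi, lt_irrefl, if_false, if_true, Real.one_rpow, letterMean, mul_one]
    exact (sum_jointPMF ch hU h₁ h₂).le

/-- The total rate of the encoders flagged by `k`. -/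
def kindRate (R : ℝ × ℝ) (k : Bool × Bool) : ℝ :=
  (if k.1 then R.1 else 0) + (if k.2 then R.2 else 0)

lemma natCeil_rpow_le {x : ℝ} (hx : 0 ≤ x) : (⌈(2 : ℝ) ^ x⌉₊ : ℝ) ≤ 2 * 2 ^ x := by
  have h1 := (Nat.ceil_lt_add_one (Real.rpow_nonneg zero_le_two x)).le
  have h2 : (1 : ℝ) ≤ 2 ^ x := Real.one_le_rpow one_le_two hx
  linarith

/-- Each of the two roundings up costs at most a factor 2. -/
lemma numMsg_le {R : ℝ × ℝ} (hR1 : 0 ≤ R.1) (hR2 : 0 ≤ R.2) (n : ℕ) (k : Bool × Bool) :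
    numMsg ⌈(2 : ℝ) ^ ((n : ℝ) * R.1)⌉₊ ⌈(2 : ℝ) ^ ((n : ℝ) * R.2)⌉₊ k ≤
      4 * 2 ^ ((n : ℝ) * kindRate R k) := by
  have hc : ∀ (b : Bool) {x : ℝ}, 0 ≤ x →
      (if b then (⌈(2 : ℝ) ^ ((n : ℝ) * x)⌉₊ : ℝ) else 1) ≤
        2 * 2 ^ ((n : ℝ) * if b then x else 0) := by
    intro b x hx
    cases b
    · simp
    · simpa using natCeil_rpow_le (mul_nonneg n.cast_nonneg hx)
  have h0 : ∀ (b : Bool) (x : ℝ), (0 : ℝ) ≤ if b then (⌈(2 : ℝ) ^ ((n : ℝ) * x)⌉₊ : ℝ) else 1 := by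
    intro b x
    split_ifs <;> positivity
  refine (mul_le_mul (hc k.1 hR1) (hc k.2 hR2) (h0 _ _) (by positivity)).trans (le_of_eq ?_)
  rw [kindRate, mul_add, Real.rpow_add two_pos]
  ring

lemma tendsto_succ_mul_pow {a : ℝ} (ha : 0 ≤ a) (ha1 : a < 1) :
    Tendsto (fun n : ℕ => ((n : ℝ) + 1) * a ^ n) atTop (𝓝 0) := by
  have := (tendsto_self_mul_const_pow_of_lt_one ha ha1).add
    (tendsto_pow_atTop_nhds_zero_of_lt_one ha ha1)
  simpa [add_mul] using this

lemma subsingleton_fin_natCeil (n : ℕ) {x : ℝ} (hx : x = 0) :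
    Subsingleton (Fin ⌈(2 : ℝ) ^ ((n : ℝ) * x)⌉₊) := by
  subst hx
  simp only [mul_zero, Real.rpow_zero, Nat.ceil_one]
  infer_instance

/-- Rate pairs strictly inside the bounds are achievable. -/
lemma achievable_of_lt (hU : pU ∈ stdSimplex ℝ U)
    (h₁ : ∀ u s, pX₁ u s ∈ stdSimplex ℝ X₁) (h₂ : ∀ u s, pX₂ u s ∈ stdSimplex ℝ X₂)
    {R : ℝ × ℝ} (hR1 : 0 ≤ R.1) (hR2 : 0 ≤ R.2)
    (hR : ∀ k : Bool × Bool, k ≠ (false, false) → (k.1 = true → R.1 ≠ 0) →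
      (k.2 = true → R.2 ≠ 0) →
      kindRate R k < ∑ u, pU u * cribInfo ch k (pX₁ u) (pX₂ u) ∧
      kindRate R k < outInfo ch pU pX₁ pX₂) :
    Achievable ch R := by
  classical
  -- An encoder of rate zero has one message and cannot be wrong. Such kinds of error are left out,
  -- since no strict inequality is available for them.
  let K : Finset (Bool × Bool) := Finset.univ.filter fun k =>
    k ≠ (false, false) ∧ (k.1 = true → R.1 ≠ 0) ∧ (k.2 = true → R.2 ≠ 0)
  have hrate : ∀ k, 0 ≤ kindRate R k := fun k =>
    add_nonneg (by split_ifs <;> simp [hR1]) (by split_ifs <;> simp [hR2])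
  have hex : ∀ k, ∃ δ l : ℝ, 0 < δ ∧ 0 < l ∧ (k ∈ K →
      letterMean ch pU pX₁ pX₂ (fun u t x y => cribRatio ch pX₁ pX₂ k u t x y ^ (-l)) ≤
        2 ^ (-(l * (kindRate R k + 2 * δ))) ∧
      letterMean ch pU pX₁ pX₂ (fun _ t x y => outRatio ch pU pX₁ pX₂ t x y ^ (-l)) ≤
        2 ^ (-(l * (kindRate R k + 2 * δ)))) := by
    intro k
    by_cases hk : k ∈ K
    · obtain ⟨hk0, hk1, hk2⟩ := (Finset.mem_filter.1 hk).2
      obtain ⟨hF, hO⟩ := hR k hk0 hk1 hk2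
      obtain ⟨J, hJ, hJ'⟩ := exists_between (lt_min hF hO)
      obtain ⟨l, hl, hb⟩ := exists_letterMean_rpow_le ch hU h₁ h₂ k
        (hJ'.trans_le (min_le_left _ _)) (hJ'.trans_le (min_le_right _ _))
      -- The gap between rate and `J` is 2δ: half of it separates the rate from the threshold
      -- exponent, half separates that from `J`.
      refine ⟨(J - kindRate R k) / 2, l, by linarith, hl, fun _ => ?_⟩
      rwa [mul_div_cancel₀ _ two_ne_zero, add_sub_cancel]
    · exact ⟨1, 1, one_pos, one_pos, fun h => absurd h hk⟩
  choose δ l hδ hl hmean using hex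
  refine ⟨hR1, hR2, fun ε hε => ?_⟩
  have hlim : Tendsto (fun n : ℕ => ∑ k ∈ K,
      (2 ^ (l k * (kindRate R k + 2 * δ k)) *
        (((n : ℝ) + 1) * ((2 : ℝ) ^ (-(l k * δ k))) ^ n) +
        4 * (((n : ℝ) + 1) * ((2 : ℝ) ^ (-δ k)) ^ n))) atTop (𝓝 0) := by
    have hlt : ∀ x : ℝ, 0 < x → (2 : ℝ) ^ (-x) < 1 := fun x hx =>
      Real.rpow_lt_one_of_one_lt_of_neg one_lt_two (neg_lt_zero.2 hx)
    have := tendsto_finsetSum K fun k _ =>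
      ((tendsto_succ_mul_pow (Real.rpow_nonneg zero_le_two _)
        (hlt _ (mul_pos (hl k) (hδ k)))).const_mul
        ((2 : ℝ) ^ (l k * (kindRate R k + 2 * δ k)))).add
      ((tendsto_succ_mul_pow (Real.rpow_nonneg zero_le_two _) (hlt _ (hδ k))).const_mul 4)
    simpa using this
  filter_upwards [hlim.eventually (gt_mem_nhds hε), eventually_ge_atTop 1] with n hn hn1
  -- Wrong pairs then contribute a term of order (n+1) 2^(−nδ), and misses one of order (n+1)
  -- 2^(−nlδ).
  let τ : Bool × Bool → ℝ := fun k => 2 ^ ((n : ℝ) * (kindRate R k + δ k))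
  have hτ : ∀ k, 0 < τ k := fun k => Real.rpow_pos_of_pos two_pos _
  obtain ⟨c, hc⟩ := exists_code (n := n) (M₁ := ⌈(2 : ℝ) ^ ((n : ℝ) * R.1)⌉₊)
    (M₂ := ⌈(2 : ℝ) ^ ((n : ℝ) * R.2)⌉₊) ch hU h₁ h₂
    (Nat.ceil_pos.2 (Real.rpow_pos_of_pos two_pos _))
    (Nat.ceil_pos.2 (Real.rpow_pos_of_pos two_pos _)) K (by
      intro m m' hne
      refine Finset.mem_filter.2 ⟨Finset.mem_univ _, fun h => hne ?_, fun h h0 => ?_,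
        fun h h0 => ?_⟩
      · simp only [diffKind, Prod.mk.injEq, decide_eq_false_iff_not, not_not] at h
        exact (Prod.ext h.1 h.2).symm
      · have := subsingleton_fin_natCeil n h0
        simp only [diffKind, decide_eq_true_eq] at h
        exact h (Subsingleton.elim _ _)
      · have := subsingleton_fin_natCeil n h0
        simp only [diffKind, decide_eq_true_eq] at h
        exact h (Subsingleton.elim _ _)) τ l hτ (fun k => (hl k).le)
  refine ⟨c, hc.trans (le_trans ?_ hn.le)⟩
  rw [← Finset.sum_add_distrib]
  refine Finset.sum_le_sum fun k hk => add_le_add ?_ ?_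
  · have hρ1 : (2 : ℝ) ^ (-(l k * (kindRate R k + 2 * δ k))) ≤ 1 :=
      Real.rpow_le_one_of_one_le_of_nonpos one_le_two (neg_nonpos.2 (mul_nonneg (hl k).le
        (add_nonneg (hrate k) (mul_nonneg zero_le_two (hδ k).le))))
    refine (Finset.sum_le_sum fun r _ => mul_le_mul_of_nonneg_left
      (prod_letterMean_stepRatio_le ch hU h₁ h₂ k (Real.rpow_nonneg zero_le_two _) hρ1
        (hmean k hk).1 (hmean k hk).2 n r) (Real.rpow_nonneg (hτ k).le _)).trans (le_of_eq ?_)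
    rw [Finset.sum_const, Finset.card_range, nsmul_eq_mul]
    push_cast
    rw [mul_left_comm ((2 : ℝ) ^ _)]
    congr 1
    simp only [τ]
    rw [← Real.rpow_natCast, ← Real.rpow_natCast, ← Real.rpow_mul zero_le_two,
      ← Real.rpow_mul zero_le_two, ← Real.rpow_mul zero_le_two, ← Real.rpow_add two_pos,
      ← Real.rpow_add two_pos, Nat.cast_sub hn1]
    congr 1
    push_cast
    ring
  · refine (mul_le_mul_of_nonneg_right (numMsg_le hR1 hR2 n k) (mul_nonneg (by positivity)
      (inv_nonneg.2 (hτ k).le))).trans (le_of_eq ?_)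
    simp only [τ]
    rw [← Real.rpow_natCast, ← Real.rpow_mul zero_le_two, ← Real.rpow_neg zero_le_two,
      mul_assoc, mul_left_comm ((2 : ℝ) ^ _), ← Real.rpow_add two_pos]
    congr 3
    ring

/-- The region given by the rate bounds is contained in the capacity region. -/
lemma mem_capacityRegion_of_rateBounds (hU : pU ∈ stdSimplex ℝ U)
    (h₁ : ∀ u s, pX₁ u s ∈ stdSimplex ℝ X₁) (h₂ : ∀ u s, pX₂ u s ∈ stdSimplex ℝ X₂)
    {R : ℝ × ℝ} (hR1 : 0 ≤ R.1) (hR2 : 0 ≤ R.2) (h : RateBounds ch pU pX₁ pX₂ R.1 R.2) :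
    R ∈ capacityRegion ch := by
  obtain ⟨b1, b2, b3, b4⟩ := (rateBounds_iff ch hU h₁ h₂ _ _).1 h
  -- Scaling towards the origin makes the bounds strict for all kinds with nonzero rates. For a
  -- single encoder the bound by `outInfo` follows from the sum-rate bound, because the other rate
  -- is nonnegative.
  have hmem : ∀ θ : ℝ, 0 < θ → θ < 1 → Achievable ch (θ • R) := by
    intro θ hθ0 hθ1
    refine achievable_of_lt ch hU h₁ h₂ (mul_nonneg hθ0.le hR1) (mul_nonneg hθ0.le hR2) ?_
    have hlt : ∀ x : ℝ, 0 ≤ x → θ * x ≠ 0 → θ * x < x := fun x hx hne =>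
      mul_lt_of_lt_one_left (hx.lt_of_ne' (right_ne_zero_of_mul hne)) hθ1
    rintro ⟨_ | _, _ | _⟩ hk hk1 hk2
    · exact absurd rfl hk
    · have := hlt _ hR2 (hk2 rfl)
      simp only [kindRate, Prod.smul_fst, Prod.smul_snd, smul_eq_mul, if_true, zero_add,
        Bool.false_eq_true, if_false]
      exact ⟨this.trans_le b2, by linarith⟩
    · have := hlt _ hR1 (hk1 rfl)
      simp only [kindRate, Prod.smul_fst, Prod.smul_snd, smul_eq_mul, if_true, add_zero,
        Bool.false_eq_true, if_false]
      exact ⟨this.trans_le b1, by linarith⟩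
    · have h1 := hlt _ hR1 (hk1 rfl)
      have h2 := hlt _ hR2 (hk2 rfl)
      simp only [kindRate, Prod.smul_fst, Prod.smul_snd, smul_eq_mul, if_true]
      exact ⟨by linarith, by linarith⟩
  have hlim : Tendsto (fun θ : ℝ => θ • R) (𝓝[<] 1) (𝓝 R) := by
    have : Tendsto (fun θ : ℝ => θ • R) (𝓝 1) (𝓝 ((1 : ℝ) • R)) :=
      (continuous_id.smul continuous_const).tendsto 1
    rw [one_smul] at this
    exact this.mono_left nhdsWithin_le_nhds
  refine mem_closure_of_tendsto hlim ?_
  filter_upwards [Ioo_mem_nhdsLT (zero_lt_one' ℝ)] with θ hθ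
  exact hmem θ hθ.1 hθ.2

end Achievability

/-! ### The region with a bounded auxiliary alphabet -/

section Region

variable {S₁ S₂ X₁ X₂ Y Z₁ Z₂ : Type*} [Fintype S₁] [Fintype S₂] [Fintype X₁] [Fintype X₂]
  [Fintype Y] [Fintype Z₁] [Fintype Z₂] [Nonempty X₁] [Nonempty X₂]
  (ch : Channel S₁ S₂ X₁ X₂ Y Z₁ Z₂)

/-- The rate pairs satisfying the rate bounds with an auxiliary alphabet of size at most `N`. -/
def boundedRegion (N : ℕ) : Set (ℝ × ℝ) :=
  {R | ∃ k : ℕ, k ≤ N ∧ ∃ pU : Fin k → ℝ, pU ∈ stdSimplex ℝ (Fin k) ∧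
    ∃ pX₁ : Fin k → S₁ → X₁ → ℝ, (∀ u s₁, pX₁ u s₁ ∈ stdSimplex ℝ X₁) ∧
    ∃ pX₂ : Fin k → S₂ → X₂ → ℝ, (∀ u s₂, pX₂ u s₂ ∈ stdSimplex ℝ X₂) ∧
      RateBounds ch pU pX₁ pX₂ R.1 R.2}

/-- Only finitely many alphabet sizes are allowed, so the region is a finite union of closed sets.
This is where the cardinality bound helps the converse. -/
lemma isClosed_boundedRegion (N : ℕ) : IsClosed (boundedRegion ch N) := by
  have : boundedRegion ch N = ⋃ k ∈ Set.Iic N, {R : ℝ × ℝ | ∃ pU : Fin k → ℝ,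
      pU ∈ stdSimplex ℝ (Fin k) ∧
      ∃ pX₁ : Fin k → S₁ → X₁ → ℝ, (∀ u s₁, pX₁ u s₁ ∈ stdSimplex ℝ X₁) ∧
      ∃ pX₂ : Fin k → S₂ → X₂ → ℝ, (∀ u s₂, pX₂ u s₂ ∈ stdSimplex ℝ X₂) ∧
      RateBounds ch pU pX₁ pX₂ R.1 R.2} := by
    ext R
    simp only [boundedRegion, Set.mem_ofPred_eq, Set.mem_iUnion, Set.mem_Iic, exists_prop]
  rw [this]
  exact (Set.finite_Iic N).isClosed_biUnion fun k _ => isClosed_rateBounds (Fin k) ch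

/-- Achievable rate pairs satisfy the rate bounds. -/
lemma mem_boundedRegion_of_achievable {R : ℝ × ℝ} (hR : Achievable ch R) :
    R ∈ boundedRegion ch (min
      (Fintype.card S₁ * Fintype.card S₂ * (Fintype.card Y - 1) + 4)
      (Fintype.card S₁ * Fintype.card S₂ * (Fintype.card X₁ * Fintype.card X₂ - 1) + 3)) := by
  -- For each δ the converse uses an alphabet that depends on the block length; the cardinality
  -- bound brings all of them into one closed set before δ tends to 0.
  have hlim : Tendsto (fun δ : ℝ => R - (δ, δ)) (𝓝[>] 0) (𝓝 R) := by
    have : Tendsto (fun δ : ℝ => R - (δ, δ)) (𝓝 0) (𝓝 (R - ((0 : ℝ), (0 : ℝ)))) :=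
      (continuous_const.sub (continuous_id.prodMk continuous_id)).tendsto 0
    rw [Prod.mk_zero_zero, sub_zero] at this
    exact this.mono_left nhdsWithin_le_nhds
  refine (isClosed_boundedRegion ch _).mem_of_tendsto hlim ?_
  filter_upwards [self_mem_nhdsWithin] with δ hδ
  obtain ⟨n, pU, hU, pX₁, h₁, pX₂, h₂, hb⟩ := exists_rateBounds_of_achievable ch hR hδ
  exact exists_fin_of_rateBounds ch hU h₁ h₂ hb

end Region
end CribMAC
end

theorem theorem4 {S₁ S₂ X₁ X₂ Y Z₁ Z₂ : Type*} [Fintype S₁] [Fintype S₂] [Fintype X₁] [Fintype X₂]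
    [Fintype Y] [Fintype Z₁] [Fintype Z₂] [Nonempty X₁] [Nonempty X₂]
    (ch : CribMAC.Channel S₁ S₂ X₁ X₂ Y Z₁ Z₂) :
    CribMAC.capacityRegion ch =
      {R : ℝ × ℝ | 0 ≤ R.1 ∧ 0 ≤ R.2 ∧
        ∃ k : ℕ,
          k ≤ min
            (Fintype.card S₁ * Fintype.card S₂ * (Fintype.card Y - 1) + 4)
            (Fintype.card S₁ * Fintype.card S₂ * (Fintype.card X₁ * Fintype.card X₂ - 1) + 3) ∧
        ∃ pU : Fin k → ℝ, pU ∈ stdSimplex ℝ (Fin k) ∧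
        ∃ pX₁ : Fin k → S₁ → X₁ → ℝ, (∀ u s₁, pX₁ u s₁ ∈ stdSimplex ℝ X₁) ∧
        ∃ pX₂ : Fin k → S₂ → X₂ → ℝ, (∀ u s₂, pX₂ u s₂ ∈ stdSimplex ℝ X₂) ∧
          CribMAC.RateBounds ch pU pX₁ pX₂ R.1 R.2} := by
  refine Set.Subset.antisymm (closure_minimal (fun R hR => ?_) ?_) ?_
  · exact ⟨hR.1, hR.2.1, CribMAC.mem_boundedRegion_of_achievable ch hR⟩
  · exact (isClosed_le continuous_const continuous_fst).inter
      ((isClosed_le continuous_const continuous_snd).inter (CribMAC.isClosed_boundedRegion ch _))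
  -- Achievability works for every finite auxiliary alphabet, so the size bound is dropped.
  · rintro R ⟨hR1, hR2, k, -, pU, hU, pX₁, h₁, pX₂, h₂, hb⟩
    exact CribMAC.mem_capacityRegion_of_rateBounds ch hU h₁ h₂ hR1 hR2 hb
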